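/- Let $N\ge 4$, let $n=\lfloor N/2\rfloor$ and $j'=N+1-j$, and let $q\in\mathbb C\setminus\{0\}$ be not a root of unity, with a fixed square root $q^{1/2}$. Put $\rho_j=\tfrac N2-j$ and $\rho_{j'}=-\rho_j$ for $j\le n$, and $\rho_{n+1}=0$ if $N=2n+1$. Let $\mathcal A$ be the associative unital $\mathbb C$-algebra generated by $x_1,\dots,x_N$ with the relations $$x_ix_j=q\,x_jx_i\quad(i<j,\ i\ne j'),\qquad x_{i'}x_i-x_ix_{i'}=\frac{q-q^{-1}}{q^{\rho_i-1}+q^{1-\rho_i}}\sum_{j=i+1}^{(i+1)'}q^{\rho_{j'}}x_jx_{j'}\quad(i<n),$$ together with $x_{n'}x_n-x_nx_{n'}=(q^{1/2}-q^{-1/2})x_{n+1}^2$ if $N=2n+1$ and $x_{n'}x_n=x_nx_{n'}$ if $N=2n$. Put $Q=\sum_{i=1}^{N}q^{\rho_{i'}}x_ix_{i'}$ and $Q_2=\sum_{i=2}^{2'}q^{\rho_{i'}}x_ix_{i'}$. The quantum algebra $U_q(\mathrm{so}_N)$, with generators $K_i^{\pm1},E_i,F_i$ for $1\le i\le n$ and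 simple roots $\alpha_i=\varepsilon_i-\varepsilon_{i+1}$ $(i<n)$, $\alpha_n=\varepsilon_n$ if $N=2n+1$, and $\alpha_n=\varepsilon_{n-1}+\varepsilon_n$ if $N=2n$, acts on $\mathcal A$ so that $$E_i(ab)=K_i(a)E_i(b)+E_i(a)b,\qquad F_i(ab)=aF_i(b)+F_i(a)K_i^{-1}(b),$$ each $K_i$ acts by an algebra automorphism, $K_ix_m=q^{\langle\alpha_i,\varepsilon_m\rangle}x_m$, where $\varepsilon_{m'}=-\varepsilon_m$ for $m\le n$ and $\varepsilon_{n+1}=0$ if $N=2n+1$, and, all other values of $E_i$ and $F_i$ on the generators being $0$, - for $i<n$: $E_ix_{i+1}=x_i$, $E_ix_{i'}=-x_{(i+1)'}$, $F_ix_i=x_{i+1}$, $F_ix_{(i+1)'}=-x_{i'}$; - for $N=2n+1$: $E_nx_{n+1}=q^{1/2}x_n$, $E_nx_{n+2}=-x_{n+1}$, $F_nx_n=q^{-1/2}x_{n+1}$, $F_nx_{n+1}=-x_{n+2}$; - for $N=2n$: $E_nx_{n+1}=x_{n-1}$, $E_nx_{n+2}=-x_n$, $F_nx_{n-1}=x_{n+1}$,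 $F_nx_n=-x_{n+2}$. There are also elements $\hat K_i^{\pm1}$ $(1\le i\le n)$ that act by the algebra automorphisms $\hat K_i^{\pm1}x_m=q^{\pm\langle\varepsilon_i,\varepsilon_m\rangle}x_m$. Let $U_q(\mathrm{so}_{N-2})$ be the subalgebra generated by $K_i^{\pm1},E_i,F_i$ with $2\le i\le n$ if $N\ge5$, and by $\hat K_2^{\pm1}$ if $N=4$. Let $\mathcal A^{U_q(\mathrm{so}_{N-2})}$ be the space of all $a\in\mathcal A$ with $Xa=\epsilon(X)a$ for all $X\in U_q(\mathrm{so}_{N-2})$, where $\epsilon$ is the counit ($\epsilon(K_i)=\epsilon(\hat K_i)=1$, $\epsilon(E_i)=\epsilon(F_i)=0$). Then $$\mathcal A^{U_q(\mathrm{so}_{N-2})}=\bigoplus_{k,l\ge0}\mathbb C[Q_2]\,x_1^kx_{1'}^l=\bigoplus_{k,l\ge0}\mathbb C[Q]\,x_1^kx_{1'}^l ,$$ where both sums of subspaces of $\mathcal A$ are direct, and where for each $k,l$ the maps $f\mapsto f(Q_2)x_1^kx_{1'}^l$ and $f\mapsto f(Q)x_1^kx_{1'}^l$ from the polynomial ring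 $\mathbb C[t]$ to $\mathcal A$ are injective. -/

import Mathlib

namespace QEuclid

set_option linter.unusedSimpArgs false
set_option linter.unusedVariables false
set_option linter.unnecessarySeqFocus false

/-! The quantum Euclidean space. -/

/-- `2 ρ_i`; the index `i` runs over `0, …, N - 1`, and `i' = Fin.rev i`. -/
def twoRho (N : ℕ) (i : Fin N) : ℤ :=
  if i < i.rev then (N : ℤ) - 2 - 2 * (i : ℤ)
  else if i.rev < i then -((N : ℤ) - 2 - 2 * (i.rev : ℤ))
  else 0

/-- `q ^ ρ_i`, where `q = s ^ 2`. -/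
noncomputable def qRho (N : ℕ) (s : ℂ) (i : Fin N) : ℂ := s ^ twoRho N i

/-- The coefficient `(q - q⁻¹) / (q ^ (ρ_i - 1) + q ^ (1 - ρ_i))`. -/
noncomputable def lam (N : ℕ) (s : ℂ) (i : Fin N) : ℂ :=
  (s ^ 2 - (s ^ 2)⁻¹) / (qRho N s i * (s ^ 2)⁻¹ + (qRho N s i)⁻¹ * s ^ 2)

open FreeAlgebra in
/-- The defining relations of the quantum Euclidean space, for `q = s ^ 2`. -/
inductive Rel (N : ℕ) (s : ℂ) : FreeAlgebra ℂ (Fin N) → FreeAlgebra ℂ (Fin N) → Prop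
  | comm (i j : Fin N) (hij : i < j) (h : i ≠ j.rev) :
      Rel N s (ι ℂ i * ι ℂ j) (s ^ 2 • (ι ℂ j * ι ℂ i))
  | radial (i : Fin N) (hi : (i : ℕ) + 1 < N / 2) :
      Rel N s (ι ℂ i.rev * ι ℂ i - ι ℂ i * ι ℂ i.rev)
        (lam N s i • ∑ j : Fin N with i < j ∧ j < i.rev,
          qRho N s j.rev • (ι ℂ j * ι ℂ j.rev))
  | odd (i m : Fin N) (hN : N = 2 * (N / 2) + 1) (hi : (i : ℕ) + 1 = N / 2)
      (hm : (m : ℕ) = N / 2) :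
      Rel N s (ι ℂ i.rev * ι ℂ i - ι ℂ i * ι ℂ i.rev) ((s - s⁻¹) • (ι ℂ m * ι ℂ m))
  | even (i : Fin N) (hN : N = 2 * (N / 2)) (hi : (i : ℕ) + 1 = N / 2) :
      Rel N s (ι ℂ i.rev * ι ℂ i) (ι ℂ i * ι ℂ i.rev)

/-- The algebra `𝒜` of polynomials on the quantum Euclidean space. -/
def Alg (N : ℕ) (s : ℂ) : Type := RingQuot (Rel N s)

noncomputable instance (N : ℕ) (s : ℂ) : Ring (Alg N s) :=
  inferInstanceAs (Ring (RingQuot (Rel N s)))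

noncomputable instance (N : ℕ) (s : ℂ) : Algebra ℂ (Alg N s) :=
  inferInstanceAs (Algebra ℂ (RingQuot (Rel N s)))

/-- The projection of the free algebra to `𝒜`. -/
noncomputable def proj (N : ℕ) (s : ℂ) : FreeAlgebra ℂ (Fin N) →ₐ[ℂ] Alg N s :=
  RingQuot.mkAlgHom ℂ (Rel N s)

/-- The quantum Cartesian coordinates. -/
noncomputable def x (N : ℕ) (s : ℂ) (i : Fin N) : Alg N s := proj N s (FreeAlgebra.ι ℂ i)

/-- `q` is nonzero and not a root of unity. -/
structure Generic (s : ℂ) : Prop where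
  ne_zero : s ≠ 0
  not_root : ∀ m : ℕ, 0 < m → (s ^ 2) ^ m ≠ 1

theorem proj_surj (N : ℕ) (s : ℂ) : Function.Surjective (proj N s) :=
  RingQuot.mkAlgHom_surjective ℂ (Rel N s)

theorem Generic.q_ne {s : ℂ} (h : Generic s) : s ^ 2 - (s ^ 2)⁻¹ ≠ 0 := by
  have h0 := h.ne_zero
  intro e
  apply h.not_root 2 (by norm_num)
  field_simp at e
  linear_combination e

theorem Generic.denom_ne {s : ℂ} (h : Generic s) {N : ℕ} (i : Fin N) (hi : i < i.rev) :
    qRho N s i * (s ^ 2)⁻¹ + (qRho N s i)⁻¹ * s ^ 2 ≠ 0 := by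
  have h0 := h.ne_zero
  obtain ⟨t, ht⟩ : ∃ t : ℕ, twoRho N i = t := by
    refine ⟨N - 2 - 2 * i, ?_⟩
    rw [twoRho, if_pos hi]
    rw [Fin.lt_def, Fin.val_rev] at hi
    omega
  have hs : qRho N s i ≠ 0 := zpow_ne_zero _ h0
  have hq : qRho N s i ^ 2 = (s ^ 2) ^ t := by
    rw [qRho, ht, zpow_natCast]; ring
  intro e
  have e2 : (s ^ 2) ^ t = - (s ^ 2) ^ 2 := by
    rw [← hq]
    field_simp at e
    linear_combination e
  rcases lt_trichotomy t 2 with hlt | rfl | hgt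
  · interval_cases t
    · exact h.not_root 4 (by norm_num) (by linear_combination (-1 + (s ^ 2) ^ 2) * e2)
    · have e3 : s ^ 2 * (1 + s ^ 2) = 0 := by linear_combination e2
      have e4 := (mul_eq_zero.mp e3).resolve_left (pow_ne_zero _ h0)
      exact h.not_root 2 (by norm_num) (by linear_combination (s ^ 2 - 1) * e4)
  · have : (s ^ 2) ^ 2 = 0 := by linear_combination e2 / 2
    exact (by positivity : (s ^ 2) ^ 2 ≠ 0) this
  · obtain ⟨d, hd, rfl⟩ : ∃ d, 0 < d ∧ t = 2 + d := ⟨t - 2, by omega, by omega⟩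
    have hne : (s ^ 2) ^ 2 ≠ 0 := by positivity
    apply h.not_root (d + d) (by omega)
    have : (s ^ 2) ^ 2 * (1 + (s ^ 2) ^ d) = 0 := by
      rw [pow_add (s ^ 2) 2 d] at e2
      linear_combination e2
    have := (mul_eq_zero.mp this).resolve_left hne
    rw [pow_add]
    linear_combination ((s ^ 2) ^ d - 1) * this

/-- A family of elements of an algebra that satisfies the defining relations; the last three of
them are put here into one uniform shape. -/
structure Sat {B : Type} [Ring B] [Algebra ℂ B] (N : ℕ) (s : ℂ) (y : Fin N → B) : Prop where
  comm : ∀ i j : Fin N, i < j → i ≠ j.rev → y i * y j = s ^ 2 • (y j * y i)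
  radial : ∀ i : Fin N, i < i.rev → y i.rev * y i - y i * y i.rev =
    lam N s i • ∑ j : Fin N with i < j ∧ j < i.rev, qRho N s j.rev • (y j * y j.rev)

theorem lam_odd {N : ℕ} {s : ℂ} (h : Generic s) (i : Fin N) (hN : N = 2 * (N / 2) + 1)
    (hi : (i : ℕ) + 1 = N / 2) : lam N s i = s - s⁻¹ := by
  have h0 := h.ne_zero
  have hlt : i < i.rev := by rw [Fin.lt_def, Fin.val_rev]; omega
  have hd := h.denom_ne i hlt
  have hr : qRho N s i = s := by
    rw [qRho, twoRho, if_pos hlt, show (N : ℤ) - 2 - 2 * (i : ℤ) = 1 by omega, zpow_one]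
  rw [lam, div_eq_iff hd, hr]
  field_simp
  ring

theorem sum_odd {B : Type} [AddCommMonoid B] {N : ℕ} (i m : Fin N) (hN : N = 2 * (N / 2) + 1)
    (hi : (i : ℕ) + 1 = N / 2) (hm : (m : ℕ) = N / 2) (g : Fin N → B) :
    ∑ j : Fin N with i < j ∧ j < i.rev, g j = g m := by
  rw [show (Finset.univ.filter fun j : Fin N => i < j ∧ j < i.rev) = {m} by
    ext j
    simp only [Finset.mem_filter, Finset.mem_univ, true_and, Finset.mem_singleton, Fin.lt_def,
      Fin.val_rev, Fin.ext_iff]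
    omega]
  simp

theorem sum_even {B : Type} [AddCommMonoid B] {N : ℕ} (i : Fin N) (hN : N = 2 * (N / 2))
    (hi : (i : ℕ) + 1 = N / 2) (g : Fin N → B) :
    ∑ j : Fin N with i < j ∧ j < i.rev, g j = 0 := by
  rw [show (Finset.univ.filter fun j : Fin N => i < j ∧ j < i.rev) = ∅ by
    ext j
    simp only [Finset.mem_filter, Finset.mem_univ, true_and, Finset.notMem_empty, Fin.lt_def,
      Fin.val_rev, iff_false]
    omega]
  simp

theorem qRho_mid {N : ℕ} {s : ℂ} (m : Fin N) (hm : m.rev = m) : qRho N s m = 1 := by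
  simp [qRho, twoRho, hm]

theorem Sat.rel {B : Type} [Ring B] [Algebra ℂ B] {N : ℕ} {s : ℂ} {y : Fin N → B}
    (h : Generic s) (hy : Sat N s y) {u v : FreeAlgebra ℂ (Fin N)} (r : Rel N s u v) :
    FreeAlgebra.lift ℂ y u = FreeAlgebra.lift ℂ y v := by
  cases r with
  | comm i j hij hne => simpa using hy.comm i j hij hne
  | radial i hi =>
    have := hy.radial i (by rw [Fin.lt_def, Fin.val_rev]; omega)
    simpa [map_sum] using this
  | odd i m hN hi hm =>
    have := hy.radial i (by rw [Fin.lt_def, Fin.val_rev]; omega)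
    rw [sum_odd i m hN hi hm, lam_odd h i hN hi] at this
    have hm' : m.rev = m := by rw [Fin.ext_iff, Fin.val_rev]; omega
    rw [hm', qRho_mid m hm', one_smul] at this
    simpa using this
  | even i hN hi =>
    have := hy.radial i (by rw [Fin.lt_def, Fin.val_rev]; omega)
    rw [sum_even i hN hi, smul_zero, sub_eq_zero] at this
    simpa using this

/-- The universal property of `𝒜`. -/
noncomputable def lift {B : Type} [Ring B] [Algebra ℂ B] {N : ℕ} {s : ℂ} (h : Generic s)
    (y : Fin N → B) (hy : Sat N s y) : Alg N s →ₐ[ℂ] B :=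
  RingQuot.liftAlgHom ℂ ⟨FreeAlgebra.lift ℂ y, fun _ _ r => hy.rel h r⟩

theorem lift_proj {B : Type} [Ring B] [Algebra ℂ B] {N : ℕ} {s : ℂ} (h : Generic s)
    (y : Fin N → B) (hy : Sat N s y) (w : FreeAlgebra ℂ (Fin N)) :
    lift h y hy (proj N s w) = FreeAlgebra.lift ℂ y w :=
  RingQuot.liftAlgHom_mkAlgHom_apply ℂ _ _ _

theorem lift_x {B : Type} [Ring B] [Algebra ℂ B] {N : ℕ} {s : ℂ} (h : Generic s)
    (y : Fin N → B) (hy : Sat N s y) (i : Fin N) : lift h y hy (x N s i) = y i := by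
  simp [x, lift_proj]

theorem proj_rel {N : ℕ} {s : ℂ} {u v : FreeAlgebra ℂ (Fin N)} (r : Rel N s u v) :
    proj N s u = proj N s v := RingQuot.mkAlgHom_rel ℂ r

theorem sat_x {N : ℕ} {s : ℂ} (h : Generic s) : Sat N s (x N s) where
  comm i j hij hne := by
    have := proj_rel (Rel.comm (s := s) i j hij hne)
    simpa [x] using this
  radial i hi := by
    rw [Fin.lt_def, Fin.val_rev] at hi
    by_cases h1 : (i : ℕ) + 1 < N / 2
    · have := proj_rel (Rel.radial (s := s) i h1)
      simpa [x, map_sum] using this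
    · have h2 : (i : ℕ) + 1 = N / 2 := by omega
      rcases Nat.even_or_odd' N with ⟨n, hn | hn⟩
      · have hN : N = 2 * (N / 2) := by omega
        rw [sum_even i hN h2, smul_zero, sub_eq_zero]
        have := proj_rel (Rel.even (s := s) i hN h2)
        simpa [x] using this
      · have hN : N = 2 * (N / 2) + 1 := by omega
        let m : Fin N := ⟨N / 2, by omega⟩
        have hm' : m.rev = m := by rw [Fin.ext_iff, Fin.val_rev]; simp only [m]; omega
        rw [sum_odd i m hN h2 rfl, lam_odd h i hN h2, hm', qRho_mid m hm', one_smul]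
        have := proj_rel (Rel.odd (s := s) i m hN h2 rfl)
        simpa [x] using this

/-- Induction on `𝒜`. -/
theorem Alg.induct {N : ℕ} {s : ℂ} {C : Alg N s → Prop}
    (hc : ∀ c : ℂ, C (algebraMap ℂ _ c)) (hx : ∀ i, C (x N s i))
    (hmul : ∀ a b, C a → C b → C (a * b)) (hadd : ∀ a b, C a → C b → C (a + b))
    (a : Alg N s) : C a := by
  obtain ⟨w, rfl⟩ := proj_surj N s a
  induction w using FreeAlgebra.induction with
  | grade0 c => simpa using hc c
  | grade1 i => exact hx i
  | mul u v hu hv => rw [map_mul]; exact hmul _ _ hu hv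
  | add u v hu hv => rw [map_add]; exact hadd _ _ hu hv

theorem Alg.hom_ext {B : Type} [Ring B] [Algebra ℂ B] {N : ℕ} {s : ℂ}
    {φ ψ : Alg N s →ₐ[ℂ] B} (h : ∀ i, φ (x N s i) = ψ (x N s i)) : φ = ψ := by
  ext a
  induction a using Alg.induct with
  | hc c => simp
  | hx i => exact h i
  | hmul a b ha hb => simp [ha, hb]
  | hadd a b ha hb => simp [ha, hb]

/-! Diagonal automorphisms and twisted derivations. -/

/-- The automorphism `x_m ↦ q ^ (e m) x_m`, for an odd exponent function `e`. -/
noncomputable def diag {N : ℕ} {s : ℂ} (h : Generic s) (e : Fin N → ℤ)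
    (he : ∀ m, e m.rev = -e m) : Alg N s →ₐ[ℂ] Alg N s :=
  lift h (fun m => (s ^ 2) ^ e m • x N s m)
    { comm := fun i j hij hne => by
        have := (sat_x h).comm i j hij hne
        simp only [smul_mul_smul_comm]
        rw [this, smul_smul, smul_smul]
        congr 1
        ring
      radial := fun i hi => by
        have h0 : (s ^ 2 : ℂ) ≠ 0 := pow_ne_zero _ h.ne_zero
        have := (sat_x h).radial i hi
        have h1 : ∀ m, (s ^ 2) ^ e m * (s ^ 2) ^ (-e m) = 1 := fun m => by
          rw [← zpow_add₀ h0, add_neg_cancel, zpow_zero]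
        have h2 : ∀ m, (s ^ 2) ^ (-e m) * (s ^ 2) ^ e m = 1 := fun m => by rw [mul_comm, h1]
        simpa only [smul_mul_smul_comm, he, h1, h2, one_smul] using this }

theorem diag_x {N : ℕ} {s : ℂ} (h : Generic s) (e : Fin N → ℤ)
    (he : ∀ m, e m.rev = -e m) (m : Fin N) :
    diag h e he (x N s m) = (s ^ 2) ^ e m • x N s m := lift_x h _ _ m

/-- Compatibility of the values `d` of an `(R, P)`-derivation with the relations. -/
structure Compat {N : ℕ} {s : ℂ} (R P : Alg N s →ₐ[ℂ] Alg N s) (d : Fin N → Alg N s) :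
    Prop where
  comm : ∀ i j : Fin N, i < j → i ≠ j.rev →
    R (x N s i) * d j + d i * P (x N s j) =
      s ^ 2 • (R (x N s j) * d i + d j * P (x N s i))
  radial : ∀ i : Fin N, i < i.rev →
    (R (x N s i.rev) * d i + d i.rev * P (x N s i)) -
      (R (x N s i) * d i.rev + d i * P (x N s i.rev)) =
    lam N s i • ∑ j : Fin N with i < j ∧ j < i.rev,
      qRho N s j.rev • (R (x N s j) * d j.rev + d j * P (x N s j.rev))

theorem Compat.sat {N : ℕ} {s : ℂ} (h : Generic s) {R P : Alg N s →ₐ[ℂ] Alg N s}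
    {d : Fin N → Alg N s} (hd : Compat R P d) :
    Sat N s (fun m => (!![R (x N s m), d m; 0, P (x N s m)] :
      Matrix (Fin 2) (Fin 2) (Alg N s))) where
  comm i j hij hne := by
    have h1 := (sat_x h).comm i j hij hne
    have hR := congrArg R h1
    have hP := congrArg P h1
    have hD := hd.comm i j hij hne
    simp only [map_mul, map_smul] at hR hP
    ext u v
    fin_cases u <;> fin_cases v <;> simp [Matrix.mul_apply, Fin.sum_univ_two, hR, hP, hD]
  radial i hi := by
    have h1 := (sat_x h).radial i hi
    have hR := congrArg R h1
    have hP := congrArg P h1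
    have hD := hd.radial i hi
    simp only [map_mul, map_smul, map_sub, map_sum] at hR hP
    ext u v
    fin_cases u <;> fin_cases v <;> simp [Matrix.sum_apply, hR, hP, hD]

/-- The `(R, P)`-derivation `D` of `𝒜` with `D x_m = d m`, that is, the linear operator with
`D (a b) = R(a) D(b) + D(a) P(b)`; it is the corner of a representation by triangular matrices. -/
noncomputable def deriv {N : ℕ} {s : ℂ} (h : Generic s) {R P : Alg N s →ₐ[ℂ] Alg N s}
    {d : Fin N → Alg N s} (hd : Compat R P d) : Alg N s →ₗ[ℂ] Alg N s :=
  (Matrix.entryLinearMap ℂ (Alg N s) (0 : Fin 2) (1 : Fin 2)).comp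
    (lift h _ (hd.sat h)).toLinearMap

theorem deriv_x {N : ℕ} {s : ℂ} (h : Generic s) {R P : Alg N s →ₐ[ℂ] Alg N s}
    {d : Fin N → Alg N s} (hd : Compat R P d) (m : Fin N) : deriv h hd (x N s m) = d m := by
  simp [deriv, lift_x]

theorem deriv_mul {N : ℕ} {s : ℂ} (h : Generic s) {R P : Alg N s →ₐ[ℂ] Alg N s}
    {d : Fin N → Alg N s} (hd : Compat R P d) (a b : Alg N s) :
    deriv h hd (a * b) = R a * deriv h hd b + deriv h hd a * P b := by
  have key : ∀ a, (lift h _ (hd.sat h) a) 0 0 = R a ∧ (lift h _ (hd.sat h) a) 1 0 = 0 ∧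
      (lift h _ (hd.sat h) a) 1 1 = P a := by
    intro a
    induction a using Alg.induct with
    | hc c => simp [Matrix.algebraMap_matrix_apply]
    | hx i => simp [lift_x]
    | hmul a b ha hb => simp [Matrix.mul_apply, Fin.sum_univ_two, ha, hb]
    | hadd a b ha hb => simp [ha, hb]
  simp [deriv, Matrix.mul_apply, Fin.sum_univ_two, key]

theorem twisted_zero {N : ℕ} {s : ℂ} (D : Alg N s →ₗ[ℂ] Alg N s)
    (R P : Alg N s →ₐ[ℂ] Alg N s)
    (hD : ∀ a b, D (a * b) = R a * D b + D a * P b) (hx : ∀ m, D (x N s m) = 0) : D = 0 := by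
  ext a
  induction a using Alg.induct with
  | hc c =>
    have := hD 1 1
    simp only [mul_one, map_one, one_mul] at this
    rw [Algebra.algebraMap_eq_smul_one, map_smul, left_eq_add.mp this]
    simp
  | hx i => simpa using hx i
  | hmul a b ha hb => simp_all
  | hadd a b ha hb => simp_all


/-! The root data of `so_N`, where `n = N / 2` is the rank. -/

/-- The weight `ε_m` of `x_m`: `ε_{m'} = -ε_m`, and `ε_m = 0` if `m = m'`. -/
def wt (N : ℕ) (m : Fin N) (j : Fin (N / 2)) : ℤ :=
  (if (m : ℕ) = j then 1 else 0) - (if (m.rev : ℕ) = j then 1 else 0)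

/-- The last node of the Dynkin diagram in the even case. -/
def IsForkNode (N : ℕ) (i : Fin (N / 2)) : Prop := N = 2 * (N / 2) ∧ (i : ℕ) + 1 = N / 2

instance (N : ℕ) (i : Fin (N / 2)) : Decidable (IsForkNode N i) :=
  inferInstanceAs (Decidable (_ ∧ _))

/-- The simple roots: `ε_i - ε_{i+1}`, but for the last one, which is `ε_n` if `N = 2 n + 1` and
`ε_{n-1} + ε_n` if `N = 2 n`. -/
def root (N : ℕ) (i j : Fin (N / 2)) : ℤ :=
  if IsForkNode N i then
    (if (j : ℕ) + 1 = i then 1 else 0) + (if j = i then 1 else 0)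
  else
    (if j = i then 1 else 0) - (if (j : ℕ) = i + 1 then 1 else 0)

/-- The standard scalar product of weights. -/
def pairing {N : ℕ} (v w : Fin (N / 2) → ℤ) : ℤ := ∑ j, v j * w j

theorem pairing_wt {N : ℕ} (v : Fin (N / 2) → ℤ) (m : Fin N) :
    pairing v (wt N m) = if h : (m : ℕ) < N / 2 then v ⟨m, h⟩
      else if h : (m.rev : ℕ) < N / 2 then -v ⟨m.rev, h⟩ else 0 := by
  have key : ∀ k : ℕ, ∑ j : Fin (N / 2), v j * (if k = j then 1 else 0) =
      if h : k < N / 2 then v ⟨k, h⟩ else 0 := by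
    intro k
    split_ifs with h
    · rw [Finset.sum_eq_single ⟨k, h⟩]
      · simp
      · intro b _ hb
        rw [if_neg, mul_zero]
        rintro rfl
        exact hb rfl
      · simp
    · apply Finset.sum_eq_zero
      intro b _
      rw [if_neg (by have := b.2; omega), mul_zero]
  simp only [pairing, wt, mul_sub, Finset.sum_sub_distrib, key]
  have := m.2
  have := m.val_rev
  split_ifs <;> omega

theorem wt_rev {N : ℕ} (m : Fin N) : wt N m.rev = -wt N m := by
  ext j; simp [wt]

theorem pairing_wt_rev {N : ℕ} (v : Fin (N / 2) → ℤ) (m : Fin N) :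
    pairing v (wt N m.rev) = -pairing v (wt N m) := by
  simp [wt_rev, pairing]

/-- `E_i` maps `x_{src i}` to a multiple of `x_{tgt i}`, and `x_{(tgt i)'}` to a multiple of
`x_{(src i)'}`; the root `α_i` is `ε_{tgt i} - ε_{src i}`. -/
def src (N : ℕ) (i : Fin (N / 2)) : Fin N := ⟨i + 1, by have := i.2; omega⟩

/-- See `src`. -/
def tgt (N : ℕ) (i : Fin (N / 2)) : Fin N :=
  ⟨if IsForkNode N i then i - 1 else i, by have := i.2; split_ifs <;> omega⟩

/-- The coefficient in `E_i x_{src i}`: it is `q ^ (1 / 2)` for the short root and `1` else. -/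
def coef (N : ℕ) (s : ℂ) (i : Fin (N / 2)) : ℂ := if src N i = (src N i).rev then s else 1

/-- The action of `E_i` on the coordinates. -/
noncomputable def eX (N : ℕ) (s : ℂ) (i : Fin (N / 2)) (m : Fin N) : Alg N s :=
  if m = src N i then coef N s i • x N s (tgt N i)
  else if m = (tgt N i).rev then -x N s (src N i).rev
  else 0

/-- The action of `F_i` on the coordinates. -/
noncomputable def fX (N : ℕ) (s : ℂ) (i : Fin (N / 2)) (m : Fin N) : Alg N s :=
  if m = tgt N i then (coef N s i)⁻¹ • x N s (src N i)
  else if m = (src N i).rev then -x N s (tgt N i).rev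
  else 0

/-- The operator `x_m ↦ q ^ ⟨v, ε_m⟩ x_m`. -/
noncomputable def torus {N : ℕ} {s : ℂ} (h : Generic s) (v : Fin (N / 2) → ℤ) :
    Alg N s →ₐ[ℂ] Alg N s :=
  diag h (fun m => pairing v (wt N m)) (pairing_wt_rev v)

theorem torus_x {N : ℕ} {s : ℂ} (h : Generic s) (v : Fin (N / 2) → ℤ) (m : Fin N) :
    torus h v (x N s m) = (s ^ 2) ^ pairing v (wt N m) • x N s m := diag_x h _ _ m

theorem src_val {N : ℕ} (i : Fin (N / 2)) : (src N i : ℕ) = i + 1 := rfl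

theorem tgt_val {N : ℕ} (i : Fin (N / 2)) :
    (tgt N i : ℕ) = if IsForkNode N i then (i : ℕ) - 1 else i := rfl

/-- The possible positions of `tgt i` and `src i`. -/
theorem node_cases {N : ℕ} (hN : 3 ≤ N) (i : Fin (N / 2)) :
    (¬IsForkNode N i ∧ (tgt N i : ℕ) = i ∧ (i : ℕ) + 1 < N / 2) ∨
    (¬IsForkNode N i ∧ (tgt N i : ℕ) = i ∧ (i : ℕ) + 1 = N / 2 ∧ N = 2 * i + 3) ∨
    (IsForkNode N i ∧ (tgt N i : ℕ) + 1 = i ∧ (i : ℕ) + 1 = N / 2 ∧ N = 2 * i + 2) := by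
  have := i.2
  have ht := tgt_val i
  by_cases hf : IsForkNode N i
  · rw [if_pos hf] at ht
    refine Or.inr (Or.inr ⟨hf, ?_⟩)
    obtain ⟨h1, h2⟩ := hf
    omega
  · rw [if_neg hf] at ht
    have hf' := hf
    unfold IsForkNode at hf'
    rcases Nat.lt_or_ge (i + 1) (N / 2) with h | h
    · exact Or.inl ⟨hf, ht, h⟩
    · exact Or.inr (Or.inl ⟨hf, ht, by omega, by omega⟩)

theorem root_eq {N : ℕ} (hN : 3 ≤ N) (i : Fin (N / 2)) :
    root N i = wt N (tgt N i) - wt N (src N i) := by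
  ext j
  have := i.2
  have := j.2
  have h1 := (tgt N i).val_rev
  have h2 := (src N i).val_rev
  have h3 := src_val i
  rcases node_cases hN i with h | h | h <;>
    simp only [root, h.1, if_true, if_false, Fin.ext_iff, wt, Pi.sub_apply]
    <;> split_ifs <;> omega

theorem pairing_wt_wt {N : ℕ} (b m : Fin N) :
    pairing (wt N b) (wt N m) =
      (if (m : ℕ) = b then 1 else 0) - (if (m : ℕ) = b.rev then 1 else 0) := by
  have hb := b.val_rev
  have hm := m.val_rev
  have hb2 := b.2
  have hm2 := m.2
  rw [pairing_wt]
  by_cases h1 : (m : ℕ) < N / 2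
  · rw [dif_pos h1]
    simp only [wt, eq_comm]
  by_cases h2 : (m.rev : ℕ) < N / 2
  · rw [dif_neg h1, dif_pos h2]
    simp only [wt]
    rw [neg_sub]
    congr 1
    · exact if_congr (by omega) rfl rfl
    · exact if_congr (by omega) rfl rfl
  · rw [dif_neg h1, dif_neg h2, eq_comm, sub_eq_zero]
    exact if_congr (by omega) rfl rfl

theorem pairing_root_wt {N : ℕ} (hN : 3 ≤ N) (i : Fin (N / 2)) (m : Fin N) :
    pairing (root N i) (wt N m) =
      (if (m : ℕ) = tgt N i then 1 else 0) - (if (m : ℕ) = (tgt N i).rev then 1 else 0)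
      - (if (m : ℕ) = src N i then 1 else 0) + (if (m : ℕ) = (src N i).rev then 1 else 0) := by
  have e : pairing (root N i) (wt N m) =
      pairing (wt N (tgt N i)) (wt N m) - pairing (wt N (src N i)) (wt N m) := by
    rw [root_eq hN]; simp [pairing, sub_mul]
  rw [e, pairing_wt_wt, pairing_wt_wt]
  ring

theorem pairing_root_root {N : ℕ} (hN : 3 ≤ N) (i j : Fin (N / 2)) :
    pairing (root N i) (root N j) =
      pairing (root N i) (wt N (tgt N j)) - pairing (root N i) (wt N (src N j)) := by
  rw [root_eq hN j]
  simp [pairing, mul_sub]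

/-- The index arithmetic behind the action of one simple root vector: `b = tgt i`, `a = src i`. -/
structure Pair (N : ℕ) (s c : ℂ) (b a : Fin N) (e : Fin N → ℤ) : Prop where
  lt : b < a
  ltr : a < b.rev
  ltb : b < a.rev
  e_eq : ∀ m, e m = (if m = b then 1 else 0) - (if m = b.rev then 1 else 0)
      - (if m = a then 1 else 0) + (if m = a.rev then 1 else 0)
  ord : ∀ m, m < a → m ≠ b → m ≠ a.rev → m < b
  short : a = a.rev → c = s ∧ qRho N s b = s
  long : a ≠ a.rev → c = 1 ∧ qRho N s b = s ^ 2 * qRho N s a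

theorem qRho_rev {N : ℕ} {s : ℂ} (i : Fin N) : qRho N s i.rev = (qRho N s i)⁻¹ := by
  unfold qRho twoRho
  rw [← zpow_neg]
  congr 1
  simp only [Fin.lt_def, Fin.val_rev, Fin.rev_rev]
  have := i.2
  split_ifs <;> omega

theorem pair_node {N : ℕ} {s : ℂ} (h : Generic s) (hN : 3 ≤ N) (i : Fin (N / 2)) :
    Pair N s (coef N s i) (tgt N i) (src N i) (fun m => pairing (root N i) (wt N m)) := by
  have hc := node_cases hN i
  have hi := i.2
  have hb := (tgt N i).val_rev
  have ha := (src N i).val_rev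
  have hs := src_val i
  refine ⟨?_, ?_, ?_, fun m => ?_, fun m h1 h2 h3 => ?_, fun h1 => ?_, fun h1 => ?_⟩
  · rw [Fin.lt_def]; omega
  · rw [Fin.lt_def]; omega
  · rw [Fin.lt_def]; omega
  · simp only [pairing_root_wt hN, Fin.ext_iff]
  · simp only [Fin.lt_def, ne_eq, Fin.ext_iff] at *
    omega
  · refine ⟨by rw [coef, if_pos h1], ?_⟩
    rw [Fin.ext_iff] at h1
    rw [qRho, twoRho, if_pos (by rw [Fin.lt_def]; omega),
      show (N : ℤ) - 2 - 2 * ((tgt N i : ℕ) : ℤ) = 1 by omega, zpow_one]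
  · refine ⟨by rw [coef, if_neg h1], ?_⟩
    rw [ne_eq, Fin.ext_iff] at h1
    rw [qRho, qRho, ← zpow_natCast, ← zpow_add₀ h.ne_zero]
    congr 1
    rw [twoRho, if_pos (by rw [Fin.lt_def]; omega), twoRho]
    simp only [Fin.lt_def]
    split_ifs <;> push_cast <;> omega


section Compat

theorem Pair.rev_lt {N : ℕ} {s c : ℂ} {b a : Fin N} {e : Fin N → ℤ} (p : Pair N s c b a e)
    (m : Fin N) (h1 : a.rev < m) (h2 : m ≠ b.rev) (h3 : m ≠ a) : b.rev < m := by
  have := p.ord m.rev (Fin.rev_lt_iff.mpr h1) (fun h => h2 (by rw [← h, Fin.rev_rev]))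
    (fun h => h3 (Fin.rev_injective h))
  exact Fin.rev_lt_iff.mp this

theorem Pair.key_short {N : ℕ} {s c : ℂ} {b a : Fin N} {e : Fin N → ℤ} (h : Generic s)
    (p : Pair N s c b a e) (ha : a = a.rev) :
    x N s b.rev * x N s b - x N s b * x N s b.rev = (s - s⁻¹) • (x N s a * x N s a) := by
  have h0 := h.ne_zero
  have hb : b < b.rev := p.lt.trans p.ltr
  have hd := h.denom_ne b hb
  rw [(sat_x h).radial b hb]
  have hl : lam N s b = s - s⁻¹ := by
    rw [(p.short ha).2] at hd
    rw [lam, (p.short ha).2, div_eq_iff hd]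
    field_simp
    ring
  rw [hl, show (Finset.univ.filter fun j : Fin N => b < j ∧ j < b.rev) = {a} by
    ext j
    simp only [Finset.mem_filter, Finset.mem_univ, true_and, Finset.mem_singleton]
    constructor
    · rintro ⟨h1, h2⟩
      by_contra hne
      rcases lt_or_gt_of_ne hne with h3 | h3
      · exact absurd (p.ord j h3 (ne_of_gt h1) (ha ▸ hne)) (not_lt.mpr h1.le)
      · exact absurd (p.rev_lt j (ha ▸ h3) (ne_of_lt h2) hne) (not_lt.mpr h2.le)
    · rintro rfl
      exact ⟨p.lt, p.ltr⟩]
  rw [Finset.sum_singleton, ← ha, qRho_mid a ha.symm, one_smul]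

theorem Pair.key_long {N : ℕ} {s c : ℂ} {b a : Fin N} {e : Fin N → ℤ} (h : Generic s)
    (p : Pair N s c b a e) (ha : a ≠ a.rev) :
    x N s b.rev * x N s b - x N s b * x N s b.rev =
      s ^ 2 • (x N s a.rev * x N s a) - (s ^ 2)⁻¹ • (x N s a * x N s a.rev) := by
  have h0 := h.ne_zero
  have hb : b < b.rev := p.lt.trans p.ltr
  have hd := h.denom_ne b hb
  have hr0 : qRho N s a ≠ 0 := zpow_ne_zero _ h0
  have hq := h.q_ne
  obtain ⟨S, hS, hS'⟩ : ∃ S, ∑ j : Fin N with b < j ∧ j < b.rev,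
      qRho N s j.rev • (x N s j * x N s j.rev) =
        (qRho N s a)⁻¹ • (x N s a * x N s a.rev) + (qRho N s a • (x N s a.rev * x N s a) + S) ∧
      (s ^ 2 - (s ^ 2)⁻¹) • S = (qRho N s a * (s ^ 2)⁻¹ + (qRho N s a)⁻¹ * s ^ 2) •
        (x N s a.rev * x N s a - x N s a * x N s a.rev) := by
    have hmem : ∀ j, b < j → j < b.rev → j ≠ a → j ≠ a.rev → a < j ∧ j < a.rev := by
      intro j h1 h2 h3 h4
      constructor
      · by_contra hne
        have h5 := lt_of_le_of_ne (not_lt.mp hne) h3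
        exact absurd (p.ord j h5 (ne_of_gt h1) h4) (not_lt.mpr h1.le)
      · by_contra hne
        have h5 := lt_of_le_of_ne (not_lt.mp hne) (Ne.symm h4)
        exact absurd (p.rev_lt j h5 (ne_of_lt h2) h3) (not_lt.mpr h2.le)
    have hset : (Finset.univ.filter fun j : Fin N => b < j ∧ j < b.rev) =
        insert a (insert a.rev (Finset.univ.filter fun j : Fin N => a < j ∧ j < a.rev)) := by
      ext j
      simp only [Finset.mem_filter, Finset.mem_univ, true_and, Finset.mem_insert]
      constructor
      · rintro ⟨h1, h2⟩
        by_cases h3 : j = a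
        · exact Or.inl h3
        by_cases h4 : j = a.rev
        · exact Or.inr (Or.inl h4)
        exact Or.inr (Or.inr (hmem j h1 h2 h3 h4))
      · rintro (rfl | rfl | ⟨h1, h2⟩)
        · exact ⟨p.lt, p.ltr⟩
        · exact ⟨p.ltb, Fin.rev_lt_rev.mpr p.lt⟩
        · exact ⟨p.lt.trans h1, h2.trans (Fin.rev_lt_rev.mpr p.lt)⟩
    refine ⟨∑ j : Fin N with a < j ∧ j < a.rev, qRho N s j.rev • (x N s j * x N s j.rev),
      ?_, ?_⟩
    · rw [hset, Finset.sum_insert, Finset.sum_insert, Fin.rev_rev, qRho_rev]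
      · simp
      · simp [ha]
    · rcases lt_or_gt_of_ne ha with hlt | hgt
      · have hr := (sat_x h).radial a hlt
        rw [hr, lam, smul_smul, mul_div_cancel₀ _ (h.denom_ne a hlt)]
      · have hr := (sat_x h).radial a.rev (by rwa [Fin.rev_rev])
        have he : (Finset.univ.filter fun j : Fin N => a.rev < j ∧ j < a) = ∅ := by
          ext j
          simp only [Finset.mem_filter, Finset.mem_univ, true_and, Finset.notMem_empty, iff_false]
          rintro ⟨h1, h2⟩
          have := hmem j (p.ltb.trans h1) (h2.trans p.ltr) (ne_of_lt h2) (ne_of_gt h1)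
          exact absurd this.1 (not_lt.mpr h2.le)
        rw [Fin.rev_rev, he, Finset.sum_empty, smul_zero,
          sub_eq_zero] at hr
        rw [hr, sub_self, smul_zero, Finset.sum_eq_zero, smul_zero]
        intro j hj
        simp only [Finset.mem_filter, Finset.mem_univ, true_and] at hj
        exact absurd (hj.1.trans hj.2) (not_lt.mpr hgt.le)
  have hd' : qRho N s a + (qRho N s a)⁻¹ ≠ 0 := by
    rw [(p.long ha).2] at hd
    convert hd using 1
    field_simp
  rw [(sat_x h).radial b hb, hS]
  have hl : lam N s b = (s ^ 2 - (s ^ 2)⁻¹) * (qRho N s a + (qRho N s a)⁻¹)⁻¹ := by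
    rw [lam, (p.long ha).2, div_eq_mul_inv]
    congr 2
    field_simp
  rw [hl, mul_comm, mul_smul, inv_smul_eq_iff₀ hd', smul_add, smul_add, hS']
  match_scalars
  · field_simp
    ring
  · field_simp
    ring

theorem compat_e {N : ℕ} {s c : ℂ} {b a : Fin N} {e : Fin N → ℤ} (h : Generic s)
    (p : Pair N s c b a e) (he : ∀ m, e m.rev = -e m) :
    Compat (diag h e he) (AlgHom.id ℂ (Alg N s)) (fun m => if m = a then c • x N s b
      else if m = b.rev then -x N s a.rev else 0) := by
  have h0 := h.ne_zero
  have hX := (sat_x (N := N) h).comm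
  have hab := p.lt
  have hab' := p.ltr
  have hba' := p.ltb
  have eb : e b = 1 := by
    rw [p.e_eq, if_pos rfl, if_neg (hab.trans hab').ne, if_neg hab.ne, if_neg hba'.ne]; rfl
  have eb' : e b.rev = -1 := by rw [he, eb]
  have hb'a' : a.rev < b.rev := Fin.rev_lt_rev.mpr hab
  have e0 : ∀ m, m ≠ a → m ≠ b → m ≠ a.rev → m ≠ b.rev → e m = 0 := by
    intro m h1 h2 h3 h4
    rw [p.e_eq]; simp [h1, h2, h3, h4]
  have ea0 : a = a.rev → e a = 0 := by
    intro ha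
    have := he a
    rw [← ha] at this
    omega
  have ea1 : a ≠ a.rev → e a = -1 := by
    intro ha
    rw [p.e_eq, if_neg hab.ne', if_neg hab'.ne, if_pos rfl, if_neg ha]; rfl
  have ea1' : a ≠ a.rev → e a.rev = 1 := by
    intro ha
    rw [he, ea1 ha]; rfl
  constructor
  · intro i j hij hne
    simp only [diag_x, AlgHom.id_apply]
    by_cases ia : i = a
    · subst ia
      by_cases jb : j = b.rev
      · subst jb
        rw [if_pos rfl, if_neg hab'.ne', if_pos rfl, eb']
        by_cases ha : i = i.rev
        · have hk := p.key_short h ha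
          rw [ea0 ha, ← ha, (p.short ha).1]
          rw [sub_eq_iff_eq_add] at hk
          simp only [zero_mul, mul_zero, add_zero, zero_add, smul_zero, zpow_zero, zpow_one, one_smul, smul_mul_assoc, mul_smul_comm, hk, mul_neg, neg_mul]
          match_scalars <;> field_simp
          ring
        · have hk := p.key_long h ha
          rw [ea1 ha, (p.long ha).1]
          rw [sub_eq_iff_eq_add] at hk
          simp only [zero_mul, mul_zero, add_zero, zero_add, smul_zero, zpow_zero, zpow_one, one_smul, smul_mul_assoc, mul_smul_comm, hk, mul_neg, neg_mul]
          match_scalars <;> field_simp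
          ring
      · rw [if_pos rfl, if_neg hij.ne', if_neg jb]
        have hja : j ≠ i.rev := fun hj => hne (by rw [hj, Fin.rev_rev])
        rw [e0 j hij.ne' (hab.trans hij).ne' hja jb]
        have := hX b j (hab.trans hij) (fun hj => jb (by rw [hj, Fin.rev_rev]))
        simp only [zero_mul, mul_zero, add_zero, zero_add, smul_zero, zpow_zero, zpow_one, one_smul, smul_mul_assoc, mul_smul_comm, this]
        all_goals match_scalars
        all_goals ring
    by_cases ja : j = a
    · subst ja
      have ib : i ≠ b.rev := (hij.trans hab').ne
      rw [if_neg ia, if_neg ib, if_pos rfl]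
      by_cases hib : i = b
      · subst hib
        rw [eb]
        simp only [zero_mul, mul_zero, add_zero, zero_add, smul_zero, zpow_zero, zpow_one, one_smul, smul_mul_assoc, mul_smul_comm]
        all_goals match_scalars
        all_goals ring
      · rw [e0 i ia hib hne ib]
        have := hX i b (p.ord i hij hib hne) ib
        simp only [zero_mul, mul_zero, add_zero, zero_add, smul_zero, zpow_zero, zpow_one, one_smul, smul_mul_assoc, mul_smul_comm, this]
        all_goals match_scalars
        all_goals ring
    rw [if_neg ia, if_neg ja]
    by_cases ib : i = b.rev
    · subst ib
      rw [if_pos rfl, if_neg hij.ne']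
      have hja' : j ≠ a.rev := (hb'a'.trans hij).ne'
      rw [e0 j ja ((hab.trans hab').trans hij).ne' hja' hij.ne']
      have := hX a.rev j (hb'a'.trans hij) (fun hj => ja (Fin.rev_injective hj).symm)
      simp only [zero_mul, mul_zero, add_zero, zero_add, smul_zero, zpow_zero, zpow_one, one_smul, smul_mul_assoc, mul_smul_comm, this, mul_neg, neg_mul]
      all_goals match_scalars
      all_goals ring
    rw [if_neg ib]
    by_cases jb : j = b.rev
    · subst jb
      rw [if_pos rfl]
      have hib : i ≠ b := fun hi => hne (by rw [hi, Fin.rev_rev])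
      by_cases hia : i = a.rev
      · subst hia
        rw [ea1' (Ne.symm ia)]
        simp only [zero_mul, mul_zero, add_zero, zero_add, smul_zero, zpow_zero, zpow_one, one_smul, smul_mul_assoc, mul_smul_comm, mul_neg, neg_mul]
        all_goals match_scalars
        all_goals ring
      · rw [e0 i ia hib hia ib]
        have hlt : i < a.rev := by
          by_contra hcon
          have h5 := lt_of_le_of_ne (not_lt.mp hcon) (Ne.symm hia)
          exact absurd (p.rev_lt i h5 ib ia) (not_lt.mpr hij.le)
        have := hX i a.rev hlt (by rw [Fin.rev_rev]; exact ia)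
        simp only [zero_mul, mul_zero, add_zero, zero_add, smul_zero, zpow_zero, zpow_one, one_smul, smul_mul_assoc, mul_smul_comm, this, mul_neg, neg_mul]
        all_goals match_scalars
        all_goals ring
    rw [if_neg jb]
    simp
  · intro i hi
    simp only [diag_x, AlgHom.id_apply]
    have hba : x N s b * x N s a.rev = s ^ 2 • (x N s a.rev * x N s b) :=
      hX b a.rev hba' (by rw [Fin.rev_rev]; exact hab.ne)
    have hbb' : b < b.rev := hab.trans hab'
    have inj : ∀ {u v : Fin N}, u.rev = v → u = v.rev := fun {u v} huv => by
      rw [← huv, Fin.rev_rev]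
    set d : Fin N → Alg N s := fun m => if m = a then c • x N s b
      else if m = b.rev then -x N s a.rev else 0 with hd
    have da : d a = c • x N s b := if_pos rfl
    have db : d b = 0 := by simp only [hd]; rw [if_neg hab.ne, if_neg hbb'.ne]
    have db' : d b.rev = -x N s a.rev := by rw [hd]; dsimp only; rw [if_neg hab'.ne', if_pos rfl]
    have da' : a ≠ a.rev → d a.rev = 0 := fun ha => by
      simp only [hd]; rw [if_neg ha.symm, if_neg hb'a'.ne]
    have d0 : ∀ m, m ≠ a → m ≠ b.rev → d m = 0 := fun m h1 h2 => by
      simp only [hd]; rw [if_neg h1, if_neg h2]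
    change (s ^ 2) ^ e i.rev • x N s i.rev * d i + d i.rev * x N s i -
      ((s ^ 2) ^ e i • x N s i * d i.rev + d i * x N s i.rev) = lam N s i •
        ∑ j : Fin N with i < j ∧ j < i.rev,
          qRho N s j.rev • ((s ^ 2) ^ e j • x N s j * d j.rev + d j * x N s j.rev)
    set T : Fin N → Alg N s := fun j =>
      qRho N s j.rev • ((s ^ 2) ^ e j • x N s j * d j.rev + d j * x N s j.rev) with hT
    have T0 : ∀ m, m ≠ a → m ≠ b → m ≠ a.rev → m ≠ b.rev → T m = 0 := by
      intro m h1 h2 h3 h4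
      simp only [hT]
      rw [d0 m h1 h4, d0 m.rev (fun hm => h3 (inj hm))
        (fun hm => h2 (Fin.rev_injective hm))]
      simp
    have hr0 : qRho N s a ≠ 0 := zpow_ne_zero _ h0
    have hrb0 : qRho N s b ≠ 0 := zpow_ne_zero _ h0
    rcases lt_trichotomy i b with hib | rfl | hib
    · have hib' : b.rev < i.rev := Fin.rev_lt_rev.mpr hib
      have hia := hib.trans hab
      have hia' := hib.trans hba'
      have e1 : d i = 0 := d0 i hia.ne (hib.trans hbb').ne
      have e2 : d i.rev = 0 := d0 i.rev (hab'.trans hib').ne' hib'.ne'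
      rw [e1, e2]
      suffices hsum : ∑ j : Fin N with i < j ∧ j < i.rev, T j = 0 by
        rw [hsum]; simp
      have hsub : ({b, b.rev, a, a.rev} : Finset (Fin N)) ⊆
          Finset.univ.filter fun j : Fin N => i < j ∧ j < i.rev := by
        intro j
        simp only [Finset.mem_filter, Finset.mem_univ, true_and, Finset.mem_insert,
          Finset.mem_singleton]
        rintro (rfl | rfl | rfl | rfl)
        · exact ⟨hib, hbb'.trans hib'⟩
        · exact ⟨hib.trans hbb', hib'⟩
        · exact ⟨hia, hab'.trans hib'⟩
        · exact ⟨hia', hb'a'.trans hib'⟩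
      rw [← Finset.sum_subset hsub (fun j _ hj => by
        simp only [Finset.mem_insert, Finset.mem_singleton, not_or] at hj
        exact T0 j hj.2.2.1 hj.1 hj.2.2.2 hj.2.1)]
      rw [Finset.sum_insert (by simp [hbb'.ne, hab.ne, hba'.ne]),
        Finset.sum_insert (by simp [hab'.ne', hb'a'.ne'])]
      by_cases ha : a = a.rev
      · rw [show ({a, a.rev} : Finset (Fin N)) = {a} by rw [← ha]; simp, Finset.sum_singleton]
        have hba2 : x N s b * x N s a = s ^ 2 • (x N s a * x N s b) := by
          rw [ha]; exact hba
        simp only [hT, Fin.rev_rev, db, db', eb, ← ha, da, ea0 ha, qRho_rev,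
          qRho_mid a ha.symm, (p.short ha).1, (p.short ha).2, smul_mul_assoc, mul_smul_comm,
          mul_neg, neg_mul, hba2, zero_mul, mul_zero]
        match_scalars
        field_simp
        ring
      · rw [Finset.sum_insert (by simp [ha]), Finset.sum_singleton]
        simp only [hT, Fin.rev_rev, db, db', eb, da, da' ha, ea1' ha, qRho_rev,
          (p.long ha).1, (p.long ha).2, smul_mul_assoc, mul_smul_comm,
          mul_neg, neg_mul, hba, zero_mul, mul_zero]
        match_scalars
        field_simp
        ring
    · rw [db, db', eb]
      have hsub : ({a, a.rev} : Finset (Fin N)) ⊆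
          Finset.univ.filter fun j : Fin N => i < j ∧ j < i.rev := by
        intro j
        simp only [Finset.mem_filter, Finset.mem_univ, true_and, Finset.mem_insert,
          Finset.mem_singleton]
        rintro (rfl | rfl)
        · exact ⟨hab, hab'⟩
        · exact ⟨hba', hb'a'⟩
      rw [← Finset.sum_subset hsub (fun j hj hj' => by
        simp only [Finset.mem_filter, Finset.mem_univ, true_and] at hj
        simp only [Finset.mem_insert, Finset.mem_singleton, not_or] at hj'
        exact T0 j hj'.1 hj.1.ne' hj'.2 hj.2.ne)]
      have hdn := h.denom_ne i hbb'
      by_cases ha : a = a.rev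
      · rw [show ({a, a.rev} : Finset (Fin N)) = {a} by rw [← ha]; simp, Finset.sum_singleton]
        have hba2 : x N s i * x N s a = s ^ 2 • (x N s a * x N s i) := by
          rw [ha]; exact hba
        rw [(p.short ha).2] at hdn
        have hl : lam N s i = (s ^ 2 - 1) * s⁻¹ := by
          rw [lam, (p.short ha).2, div_eq_iff hdn]
          field_simp
          ring
        simp only [hT, Fin.rev_rev, ← ha, da, ea0 ha,
          qRho_mid a ha.symm, (p.short ha).1, hl, smul_mul_assoc, mul_smul_comm,
          mul_neg, neg_mul, hba2, zero_mul, mul_zero]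
        match_scalars
        field_simp
        ring
      · rw [Finset.sum_insert (by simp [ha]), Finset.sum_singleton]
        have hd' : qRho N s a + (qRho N s a)⁻¹ ≠ 0 := by
          rw [(p.long ha).2] at hdn
          convert hdn using 1
          field_simp
        have hl : lam N s i = (s ^ 2 - (s ^ 2)⁻¹) * (qRho N s a + (qRho N s a)⁻¹)⁻¹ := by
          rw [lam, (p.long ha).2, div_eq_mul_inv]
          congr 2
          field_simp
        simp only [hT, Fin.rev_rev, da, da' ha, ea1' ha, qRho_rev, hl,
          (p.long ha).1, smul_mul_assoc, mul_smul_comm,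
          mul_neg, neg_mul, hba, zero_mul, mul_zero]
        have hd2 : qRho N s a ^ 2 + 1 ≠ 0 := by
          intro h2
          apply hd'
          field_simp
          rw [mul_zero]
          exact h2
        match_scalars
        field_simp
        ring
    · have hib' : i.rev < b.rev := Fin.rev_lt_rev.mpr hib
      have hnl : ∀ m, b < m → m < a → m = a.rev := fun m h1 h2 => by
        by_contra h3
        exact absurd (p.ord m h2 h1.ne' h3) (not_lt.mpr h1.le)
      have hnr : ∀ m, a.rev < m → m < b.rev → m = a := fun m h1 h2 => by
        by_contra h3
        exact absurd (p.rev_lt m h1 h2.ne h3) (not_lt.mpr h2.le)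
      rw [Finset.sum_eq_zero, smul_zero]
      · have e1 : ∀ m, m ≠ a → m < b.rev → d m = 0 := fun m h1 h2 => d0 m h1 h2.ne
        by_cases hia : i = a
        · subst hia
          have ha := hi.ne
          rw [da, da' ha, ea1' ha, (p.long ha).1]
          simp only [zero_mul, mul_zero, add_zero, zero_add, smul_zero, zpow_zero, zpow_one, one_smul, smul_mul_assoc, mul_smul_comm, hba]
          all_goals match_scalars
          all_goals ring
        by_cases hia' : i = a.rev
        · subst hia'
          have ha : a ≠ a.rev := fun hh => hia hh.symm
          rw [Fin.rev_rev, da, da' ha, ea1' ha, (p.long ha).1]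
          simp only [zero_mul, mul_zero, add_zero, zero_add, smul_zero, zpow_zero, zpow_one, one_smul, smul_mul_assoc, mul_smul_comm, hba]
          all_goals match_scalars
          all_goals ring
        rw [d0 i hia (hi.trans hib').ne, d0 i.rev (fun hh => hia' (inj hh)) hib'.ne]
        simp
      · intro j hj
        simp only [Finset.mem_filter, Finset.mem_univ, true_and] at hj
        apply T0
        · rintro rfl
          have := hnl i hib hj.1
          rw [this, Fin.rev_rev] at hj
          exact lt_irrefl _ hj.2
        · exact (hib.trans hj.1).ne'
        · rintro rfl
          have := hnr i.rev hj.2 hib'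
          rw [inj this] at hj
          exact lt_irrefl _ hj.1
        · exact (hj.2.trans hib').ne

/-- The anti-automorphism `x_m ↦ x_{m'}`. -/
noncomputable def flip {N : ℕ} {s : ℂ} (h : Generic s) : Alg N s →ₗ[ℂ] Alg N s :=
  (MulOpposite.opLinearEquiv ℂ).symm.toLinearMap.comp
    (lift (B := (Alg N s)ᵐᵒᵖ) h (fun m => MulOpposite.op (x N s m.rev))
      { comm := fun i j hij hne => by
          have := (sat_x h).comm j.rev i.rev (Fin.rev_lt_rev.mpr hij)
            (by rw [Fin.rev_rev]; exact fun hh => hne hh.symm)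
          apply MulOpposite.unop_injective
          simpa using this
        radial := fun i hi => by
          have := (sat_x h).radial i hi
          apply MulOpposite.unop_injective
          simpa [Finset.unop_sum] using this }).toLinearMap

theorem flip_x {N : ℕ} {s : ℂ} (h : Generic s) (m : Fin N) :
    flip h (x N s m) = x N s m.rev := by
  simp [flip, lift_x]

theorem flip_mul {N : ℕ} {s : ℂ} (h : Generic s) (a b : Alg N s) :
    flip h (a * b) = flip h b * flip h a := by
  simp [flip]

theorem flip_algebraMap {N : ℕ} {s : ℂ} (h : Generic s) (c : ℂ) :
    flip h (algebraMap ℂ (Alg N s) c) = algebraMap ℂ (Alg N s) c := by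
  simp [flip]

theorem flip_flip {N : ℕ} {s : ℂ} (h : Generic s) (a : Alg N s) : flip h (flip h a) = a := by
  induction a using Alg.induct with
  | hc c => simp [flip_algebraMap]
  | hx i => simp [flip_x]
  | hmul a b ha hb => simp [flip_mul, ha, hb]
  | hadd a b ha hb => simp [ha, hb]

theorem compat_f {N : ℕ} {s c : ℂ} {b a : Fin N} {e : Fin N → ℤ} (h : Generic s)
    (p : Pair N s c b a e) (he : ∀ m, e m.rev = -e m) (he' : ∀ m, -e m.rev = - -e m) :
    Compat (AlgHom.id ℂ (Alg N s)) (diag h (fun m => -e m) he') (fun m =>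
      if m = b then c⁻¹ • x N s a else if m = a.rev then -x N s b.rev else 0) := by
  have hE := compat_e h p he
  have hc : c ≠ 0 := by
    by_cases ha : a = a.rev
    · rw [(p.short ha).1]; exact h.ne_zero
    · rw [(p.long ha).1]; exact one_ne_zero
  obtain ⟨d, hd⟩ : ∃ d : Fin N → Alg N s, d = fun m => if m = a then c • x N s b
      else if m = b.rev then -x N s a.rev else 0 := ⟨_, rfl⟩
  rw [← hd] at hE
  have hf : (fun m => if m = b then c⁻¹ • x N s a else if m = a.rev then -x N s b.rev else 0) =
      fun m => -c⁻¹ • flip h (d m.rev) := by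
    funext m
    rw [hd]
    dsimp only
    by_cases hb : m = b
    · subst hb
      rw [if_pos rfl, if_neg p.ltr.ne', if_pos rfl, map_neg, flip_x, Fin.rev_rev]
      simp
    · rw [if_neg hb]
      by_cases ha : m = a.rev
      · rw [if_pos ha, ha, Fin.rev_rev, if_pos rfl, map_smul, flip_x, smul_smul, neg_mul,
          inv_mul_cancel₀ hc, neg_smul, one_smul]
      · rw [if_neg ha, if_neg (fun hh => ha (by rw [← hh, Fin.rev_rev])),
          if_neg (fun hh => hb (Fin.rev_injective hh)), map_zero, smul_zero]
  rw [hf]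
  constructor
  · intro i j hij hne
    have h1 := congrArg (flip h) (hE.comm j.rev i.rev (Fin.rev_lt_rev.mpr hij)
      (by rw [Fin.rev_rev]; exact fun hh => hne hh.symm))
    simp only [diag_x, AlgHom.id_apply, map_add, flip_mul, map_smul, flip_x, Fin.rev_rev,
      he, mul_smul_comm, smul_mul_assoc] at h1 ⊢
    have h2 := congrArg (fun z => -c⁻¹ • z) h1
    simp only [smul_add] at h2 ⊢
    rw [add_comm, smul_comm _ (-c⁻¹), h2]
    module
  · intro i hi
    have h1 := congrArg (flip h) (hE.radial i hi)
    simp only [diag_x, AlgHom.id_apply, map_add, map_sub, map_sum, flip_mul, map_smul, flip_x,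
      Fin.rev_rev, he, mul_smul_comm, smul_mul_assoc] at h1 ⊢
    have h2 := congrArg (fun z => -c⁻¹ • z) h1
    simp only [smul_add] at h2
    simp only [neg_neg, Fin.rev_rev]
    rw [smul_comm (-c⁻¹), Finset.smul_sum] at h2
    convert h2 using 1
    · simp only [smul_sub, smul_add]
      module
    · congr 1
      refine Finset.sum_congr rfl fun j _ => ?_
      module

end Compat


/-! The operators of the action of `U_q(so_N)` on `𝒜`. -/

theorem pairing_neg {N : ℕ} (v w : Fin (N / 2) → ℤ) : pairing (-v) w = -pairing v w := by
  simp [pairing]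

theorem compat_eX {N : ℕ} {s : ℂ} (h : Generic s) (hN : 3 ≤ N) (i : Fin (N / 2)) :
    Compat (torus h (root N i)) (AlgHom.id ℂ (Alg N s)) (eX N s i) :=
  compat_e h (pair_node h hN i) (pairing_wt_rev (root N i))

theorem compat_fX {N : ℕ} {s : ℂ} (h : Generic s) (hN : 3 ≤ N) (i : Fin (N / 2)) :
    Compat (AlgHom.id ℂ (Alg N s)) (torus h (-root N i)) (fX N s i) := by
  have := compat_f h (pair_node h hN i) (pairing_wt_rev (root N i))
    (fun m => by rw [pairing_wt_rev])
  simp only [torus, pairing_neg]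
  exact this

/-- The operator `E_i`: `E_i (a b) = K_i(a) E_i(b) + E_i(a) b`. -/
noncomputable def eOp {N : ℕ} {s : ℂ} (h : Generic s) (hN : 3 ≤ N) (i : Fin (N / 2)) :
    Module.End ℂ (Alg N s) := deriv h (compat_eX h hN i)

/-- The operator `F_i`: `F_i (a b) = a F_i(b) + F_i(a) K_i⁻¹(b)`. -/
noncomputable def fOp {N : ℕ} {s : ℂ} (h : Generic s) (hN : 3 ≤ N) (i : Fin (N / 2)) :
    Module.End ℂ (Alg N s) := deriv h (compat_fX h hN i)

/-- The operator of the torus element of weight `v`. -/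
noncomputable def kOp {N : ℕ} {s : ℂ} (h : Generic s) (v : Fin (N / 2) → ℤ) :
    Module.End ℂ (Alg N s) := (torus h v).toLinearMap

section Operators

variable {N : ℕ} {s : ℂ} (h : Generic s) (hN : 3 ≤ N)

theorem eOp_x (i : Fin (N / 2)) (m : Fin N) : eOp h hN i (x N s m) = eX N s i m :=
  deriv_x h _ m

theorem fOp_x (i : Fin (N / 2)) (m : Fin N) : fOp h hN i (x N s m) = fX N s i m :=
  deriv_x h _ m

theorem kOp_x (v : Fin (N / 2) → ℤ) (m : Fin N) :
    kOp h v (x N s m) = (s ^ 2) ^ pairing v (wt N m) • x N s m := torus_x h v m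

theorem eOp_mul (i : Fin (N / 2)) (a b : Alg N s) :
    eOp h hN i (a * b) = kOp h (root N i) a * eOp h hN i b + eOp h hN i a * b :=
  deriv_mul h _ a b

theorem fOp_mul (i : Fin (N / 2)) (a b : Alg N s) :
    fOp h hN i (a * b) = a * fOp h hN i b + fOp h hN i a * kOp h (-root N i) b :=
  deriv_mul h _ a b

theorem kOp_mul (v : Fin (N / 2) → ℤ) (a b : Alg N s) :
    kOp h v (a * b) = kOp h v a * kOp h v b := map_mul (torus h v) a b

theorem kOp_add (v w : Fin (N / 2) → ℤ) (a : Alg N s) :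
    kOp h v (kOp h w a) = kOp h (v + w) a := by
  have h0 : (s ^ 2 : ℂ) ≠ 0 := pow_ne_zero _ h.ne_zero
  have : (torus h v).comp (torus h w) = torus h (v + w) := Alg.hom_ext fun m => by
    simp only [AlgHom.comp_apply, torus_x, map_smul, smul_smul]
    rw [← zpow_add₀ h0]
    congr 2
    simp only [pairing, Pi.add_apply, add_mul, Finset.sum_add_distrib]
    ring
  exact DFunLike.congr_fun this a

theorem kOp_zero (a : Alg N s) : kOp h (0 : Fin (N / 2) → ℤ) a = a := by
  have : torus h (0 : Fin (N / 2) → ℤ) = AlgHom.id ℂ (Alg N s) := Alg.hom_ext fun m => by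
    simp [torus_x, pairing]
  exact DFunLike.congr_fun this a

theorem pairing_comm (v w : Fin (N / 2) → ℤ) : pairing v w = pairing w v := by
  simp [pairing, mul_comm]

theorem pairing_add (v w u : Fin (N / 2) → ℤ) : pairing v (w + u) = pairing v w + pairing v u := by
  simp [pairing, mul_add, Finset.sum_add_distrib]

theorem rev_eq_iff (m k : Fin N) : m = k.rev ↔ (m : ℕ) + k + 1 = N := by
  rw [Fin.ext_iff, Fin.val_rev]; omega

/-- `K_v E_i = q ^ ⟨v, α_i⟩ E_i K_v`. -/
theorem k_e (v : Fin (N / 2) → ℤ) (i : Fin (N / 2)) (a : Alg N s) :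
    kOp h v (eOp h hN i a) = (s ^ 2) ^ pairing v (root N i) • eOp h hN i (kOp h v a) := by
  have h0 : (s ^ 2 : ℂ) ≠ 0 := pow_ne_zero _ h.ne_zero
  have := twisted_zero (kOp h v * eOp h hN i - (s ^ 2) ^ pairing v (root N i) •
      (eOp h hN i * kOp h v)) (torus h (v + root N i)) (torus h v) ?_ ?_
  · rw [← sub_eq_zero]
    exact DFunLike.congr_fun this a
  · intro a b
    change _ = kOp h (v + root N i) a * _ + _ * kOp h v b
    simp only [LinearMap.sub_apply, LinearMap.smul_apply, Module.End.mul_apply, eOp_mul, kOp_mul,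
      map_add, kOp_add, add_comm (root N i) v]
    simp only [mul_sub, sub_mul, smul_add, mul_smul_comm, smul_mul_assoc]
    abel
  · intro m
    have e1 : pairing v (root N i) =
        pairing v (wt N (tgt N i)) - pairing v (wt N (src N i)) := by
      rw [root_eq hN]; simp [pairing, mul_sub]
    simp only [LinearMap.sub_apply, LinearMap.smul_apply, Module.End.mul_apply, eOp_x, kOp_x,
      map_smul, eX]
    split_ifs with h1 h2
    · rw [map_smul, kOp_x, h1, e1, zpow_sub₀ h0]
      match_scalars
      field_simp
      ring
    · rw [map_neg, kOp_x, h2, e1, zpow_sub₀ h0, pairing_wt_rev, pairing_wt_rev, zpow_neg, zpow_neg]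
      match_scalars
      field_simp
      ring
    · simp

theorem flip_k (v : Fin (N / 2) → ℤ) (a : Alg N s) :
    kOp h v (flip h a) = flip h (kOp h (-v) a) := by
  induction a using Alg.induct with
  | hc c =>
    have e : ∀ w : Fin (N / 2) → ℤ, kOp h w (algebraMap ℂ (Alg N s) c) = algebraMap ℂ _ c :=
      fun w => (torus h w).commutes c
    rw [e, flip_algebraMap, e]
  | hx i =>
    rw [flip_x, kOp_x, kOp_x, map_smul, flip_x, pairing_wt_rev, pairing_neg]
  | hmul a b ha hb => rw [flip_mul, kOp_mul, ha, hb, kOp_mul, flip_mul]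
  | hadd a b ha hb => rw [map_add, map_add, ha, hb, map_add, map_add]

theorem coef_ne {N : ℕ} {s : ℂ} (h : Generic s) (i : Fin (N / 2)) : coef N s i ≠ 0 := by
  rw [coef]
  split_ifs
  · exact h.ne_zero
  · exact one_ne_zero

theorem f_eq (i : Fin (N / 2)) (a : Alg N s) :
    fOp h hN i a = -(coef N s i)⁻¹ • flip h (eOp h hN i (flip h a)) := by
  have hc := coef_ne h i
  have p := pair_node h hN i
  have := twisted_zero (fOp h hN i - -(coef N s i)⁻¹ • (flip h ∘ₗ eOp h hN i ∘ₗ flip h))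
    (AlgHom.id ℂ _) (torus h (-root N i)) ?_ ?_
  · rw [← sub_eq_zero]
    exact DFunLike.congr_fun this a
  · intro a b
    change _ = a * _ + _ * kOp h (-root N i) b
    simp only [LinearMap.sub_apply, LinearMap.smul_apply, LinearMap.comp_apply, fOp_mul, flip_mul,
      eOp_mul, flip_k, map_add, flip_flip]
    simp only [mul_sub, sub_mul, smul_add, mul_smul_comm, smul_mul_assoc]
    abel
  · intro m
    simp only [LinearMap.sub_apply, LinearMap.smul_apply, LinearMap.comp_apply, fOp_x, flip_x,
      eOp_x, eX, fX]
    have e1 : m.rev = src N i ↔ m = (src N i).rev := by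
      rw [← Fin.rev_inj, Fin.rev_rev]
    have e2 : m.rev = (tgt N i).rev ↔ m = tgt N i := Fin.rev_inj
    simp only [e1, e2]
    by_cases hb : m = tgt N i
    · rw [if_pos hb, if_neg, if_pos hb]
      · simp [flip_x]
      · rw [hb]; exact p.ltb.ne
    · rw [if_neg hb, if_neg hb]
      split_ifs
      · rw [map_smul, flip_x, smul_smul]
        simp [hc]
      · simp

/-- `K_v F_i = q ^ (-⟨v, α_i⟩) F_i K_v`. -/
theorem k_f (v : Fin (N / 2) → ℤ) (i : Fin (N / 2)) (a : Alg N s) :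
    kOp h v (fOp h hN i a) = (s ^ 2) ^ (-pairing v (root N i)) • fOp h hN i (kOp h v a) := by
  rw [f_eq, map_smul, flip_k, k_e, f_eq, flip_k, neg_neg, pairing_neg, map_smul]
  rw [smul_comm]

theorem e_f_mul (i j : Fin (N / 2)) (a b : Alg N s) :
    eOp h hN i (fOp h hN j (a * b)) - fOp h hN j (eOp h hN i (a * b)) =
      kOp h (root N i) a * (eOp h hN i (fOp h hN j b) - fOp h hN j (eOp h hN i b)) +
      (eOp h hN i (fOp h hN j a) - fOp h hN j (eOp h hN i a)) * kOp h (-root N j) b := by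
  simp only [eOp_mul, fOp_mul, map_add, k_f, k_e, pairing_neg, pairing_comm (root N j) (root N i),
    smul_mul_assoc, mul_smul_comm, mul_sub, sub_mul]
  abel

/-- `[E_i, F_i] = (K_i - K_i⁻¹) / (q - q⁻¹)`. -/
theorem e_f_self (i : Fin (N / 2)) (a : Alg N s) :
    eOp h hN i (fOp h hN i a) - fOp h hN i (eOp h hN i a) =
      (s ^ 2 - (s ^ 2)⁻¹)⁻¹ • (kOp h (root N i) a - kOp h (-root N i) a) := by
  have hq := h.q_ne
  have h0 : s ≠ 0 := h.ne_zero
  have := twisted_zero (eOp h hN i * fOp h hN i - fOp h hN i * eOp h hN i -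
    (s ^ 2 - (s ^ 2)⁻¹)⁻¹ • (kOp h (root N i) - kOp h (-root N i)))
    (torus h (root N i)) (torus h (-root N i)) ?_ ?_
  · rw [← sub_eq_zero]
    exact DFunLike.congr_fun this a
  · intro a b
    change _ = kOp h (root N i) a * _ + _ * kOp h (-root N i) b
    simp only [LinearMap.sub_apply, LinearMap.smul_apply, Module.End.mul_apply, e_f_mul]
    simp only [kOp_mul, mul_sub, sub_mul, smul_add, smul_sub, mul_smul_comm, smul_mul_assoc]
    abel
  · intro m
    have p := pair_node h hN i
    have hc := coef_ne h i
    have hbb' : tgt N i < (tgt N i).rev := p.lt.trans p.ltr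
    have hb'a' : (src N i).rev < (tgt N i).rev := Fin.rev_lt_rev.mpr p.lt
    have ee := p.e_eq
    simp only [LinearMap.sub_apply, LinearMap.smul_apply, Module.End.mul_apply, kOp_x,
      pairing_neg, eOp_x, fOp_x]
    have eb : eX N s i (tgt N i) = 0 := by rw [eX, if_neg p.lt.ne, if_neg hbb'.ne]
    have ea : eX N s i (src N i) = coef N s i • x N s (tgt N i) := by rw [eX, if_pos rfl]
    have eb' : eX N s i (tgt N i).rev = -x N s (src N i).rev := by
      rw [eX, if_neg p.ltr.ne', if_pos rfl]
    have ea' : src N i ≠ (src N i).rev → eX N s i (src N i).rev = 0 := fun ha => by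
      rw [eX, if_neg ha.symm, if_neg hb'a'.ne]
    have fb : fX N s i (tgt N i) = (coef N s i)⁻¹ • x N s (src N i) := by rw [fX, if_pos rfl]
    have fa' : fX N s i (src N i).rev = -x N s (tgt N i).rev := by
      rw [fX, if_neg p.ltb.ne', if_pos rfl]
    have fb' : fX N s i (tgt N i).rev = 0 := by
      rw [fX, if_neg hbb'.ne', if_neg hb'a'.ne']
    have fa : src N i ≠ (src N i).rev → fX N s i (src N i) = 0 := fun ha => by
      rw [fX, if_neg p.lt.ne', if_neg ha]
    have qq : (s ^ 2 - (s ^ 2)⁻¹)⁻¹ * (s ^ 2 - (s ^ 2)⁻¹) = 1 := inv_mul_cancel₀ hq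
    have z1 : ∀ y : Alg N s, (s ^ 2 - (s ^ 2)⁻¹)⁻¹ • ((s ^ 2) ^ (1 : ℤ) • y -
        (s ^ 2) ^ (-1 : ℤ) • y) = y := by
      intro y
      rw [zpow_one, zpow_neg_one, ← sub_smul, smul_smul, qq, one_smul]
    have z2 : ∀ y : Alg N s, (s ^ 2 - (s ^ 2)⁻¹)⁻¹ • ((s ^ 2) ^ (-1 : ℤ) • y -
        (s ^ 2) ^ (- -1 : ℤ) • y) = -y := by
      intro y
      rw [neg_neg, zpow_one, zpow_neg_one, ← sub_smul, ← neg_sub (s ^ 2) (s ^ 2)⁻¹, smul_smul, mul_neg, qq, neg_smul,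
        one_smul]
    by_cases ha : src N i = (src N i).rev
    · have ha2 : (src N i).rev = src N i := ha.symm
      rw [ha2] at fa' eb'
      by_cases h1 : m = tgt N i
      · rw [h1, ee, if_pos rfl, if_neg hbb'.ne, if_neg p.lt.ne, if_neg p.ltb.ne]
        rw [fb, eb, map_smul, map_zero, eOp_x, ea, smul_smul, inv_mul_cancel₀ hc, one_smul]
        simp only [sub_zero, add_zero]
        rw [z1, sub_self]
      by_cases h2 : m = src N i
      · have e0 : pairing (root N i) (wt N (src N i)) = 0 := by
          have := pairing_wt_rev (root N i) (src N i)
          rw [ha2] at this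
          omega
        rw [h2, e0, fa', ea, map_neg, map_smul, eOp_x, fOp_x, fb, eb', smul_smul,
          mul_inv_cancel₀ hc]
        simp
      by_cases h3 : m = (tgt N i).rev
      · rw [h3, ee, if_neg hbb'.ne', if_pos rfl, if_neg p.ltr.ne', if_neg hb'a'.ne']
        rw [fb', eb', map_neg, map_zero, fOp_x, fa']
        simp only [zero_sub, sub_zero, add_zero]
        rw [z2]
        simp
      rw [ee, if_neg h1, if_neg h2, if_neg h3, ha2, if_neg h2, eX, if_neg h2, if_neg h3, fX,
        if_neg h1, ha2, if_neg h2]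
      simp
    · by_cases h1 : m = tgt N i
      · rw [h1, ee, if_pos rfl, if_neg hbb'.ne, if_neg p.lt.ne, if_neg p.ltb.ne]
        rw [fb, eb, map_smul, map_zero, eOp_x, ea, smul_smul, inv_mul_cancel₀ hc, one_smul]
        simp only [sub_zero, add_zero]
        rw [z1, sub_self]
      by_cases h2 : m = src N i
      · rw [h2, ee, if_neg p.lt.ne', if_neg p.ltr.ne, if_pos rfl, if_neg ha]
        rw [fa ha, ea, map_smul, map_zero, fOp_x, fb, smul_smul, mul_inv_cancel₀ hc, one_smul]
        simp only [zero_sub, sub_zero, add_zero]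
        rw [z2, sub_self]
      by_cases h3 : m = (tgt N i).rev
      · rw [h3, ee, if_neg hbb'.ne', if_pos rfl, if_neg p.ltr.ne', if_neg hb'a'.ne']
        rw [fb', eb', map_neg, map_zero, fOp_x, fa']
        simp only [zero_sub, sub_zero, add_zero]
        rw [z2]
        simp
      by_cases h4 : m = (src N i).rev
      · rw [h4, ee, if_neg p.ltb.ne', if_neg hb'a'.ne, if_neg (Ne.symm ha), if_pos rfl]
        rw [fa', ea' ha, map_neg, map_zero, eOp_x, eb']
        simp only [zero_sub, sub_zero, zero_add]
        rw [z1]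
        simp
      rw [ee, if_neg h1, if_neg h2, if_neg h3, if_neg h4, eX, if_neg h2, if_neg h3, fX,
        if_neg h1, if_neg h4]
      simp

theorem fin_simp (i : Fin (N / 2)) : (((src N i).rev : Fin N) : ℕ) + i + 2 = N ∧
    (((tgt N i).rev : Fin N) : ℕ) + tgt N i + 1 = N := by
  have := (src N i).val_rev
  have := (tgt N i).val_rev
  have := src_val i
  have := (src N i).2
  have := (tgt N i).2
  omega

theorem coef_one (i : Fin (N / 2)) (hi : N ≠ 2 * (i : ℕ) + 3) : coef N s i = 1 := by
  rw [coef, if_neg]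
  intro hh
  rw [Fin.ext_iff] at hh
  have := fin_simp i
  have := src_val i
  omega

theorem e_f_ne_x (i j : Fin (N / 2)) (hij : i ≠ j) (m : Fin N) :
    eOp h hN i (fOp h hN j (x N s m)) = fOp h hN j (eOp h hN i (x N s m)) := by
  have hi := node_cases hN i
  have hj := node_cases hN j
  have i1 := fin_simp i
  have j1 := fin_simp j
  have i2 := src_val i
  have j2 := src_val j
  rw [ne_eq, Fin.ext_iff] at hij
  have n1 : src N j ≠ src N i := by rw [ne_eq, Fin.ext_iff]; omega
  have n2 : src N j ≠ (tgt N i).rev := by rw [ne_eq, Fin.ext_iff]; omega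
  have n3 : src N i ≠ (tgt N j).rev := by rw [ne_eq, Fin.ext_iff]; omega
  have n4 : (src N i).rev ≠ tgt N j := fun hh => n3 (by rw [← hh, Fin.rev_rev])
  have n5 : (src N i).rev ≠ (src N j).rev := fun hh => n1 (Fin.rev_injective hh).symm
  have n6 : tgt N i ≠ (src N j).rev := fun hh => n2 (by rw [hh, Fin.rev_rev])
  have l1 : eOp h hN i (fOp h hN j (x N s m)) = if m = tgt N j then 0 else
      if m = (src N j).rev then (if tgt N j = tgt N i then x N s (src N i).rev else 0) else 0 := by
    rw [fOp_x, fX]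
    split_ifs with h1 h2 h3
    · rw [map_smul, eOp_x, eX, if_neg n1, if_neg n2, smul_zero]
    · rw [map_neg, eOp_x, eX, if_neg n3.symm, if_pos (by rw [h3]), neg_neg]
    · rw [map_neg, eOp_x, eX, if_neg n3.symm, if_neg (fun hh => h3 (Fin.rev_injective hh)),
        neg_zero]
    · rw [map_zero]
  have l2 : fOp h hN j (eOp h hN i (x N s m)) = if m = src N i then
      (if tgt N i = tgt N j then (coef N s i * (coef N s j)⁻¹) • x N s (src N j) else 0)
      else 0 := by
    rw [eOp_x, eX]
    split_ifs with h1 h2 h3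
    · rw [map_smul, fOp_x, fX, if_pos h2, smul_smul]
    · rw [map_smul, fOp_x, fX, if_neg h2, if_neg n6, smul_zero]
    · rw [map_neg, fOp_x, fX, if_neg n4, if_neg n5, neg_zero]
    · rw [map_zero]
  rw [l1, l2]
  by_cases ht : tgt N i = tgt N j
  · have ht2 := congrArg Fin.val ht
    have e1 : (src N j).rev = src N i := Fin.ext (by omega)
    have e2 : (src N i).rev = src N j := by rw [← e1, Fin.rev_rev]
    have e3 : src N i ≠ tgt N j := by rw [ne_eq, Fin.ext_iff]; omega
    rw [if_pos ht, if_pos ht.symm, e1, e2, coef_one i (by omega), coef_one j (by omega)]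
    by_cases hm : m = src N i
    · rw [hm, if_neg e3, if_pos rfl, if_pos rfl]
      simp
    · rw [if_neg hm, ite_self]
      simp [hm]
  · simp only [if_neg ht, if_neg (Ne.symm ht), ite_self]

/-- `[E_i, F_j] = 0` for `i ≠ j`. -/
theorem e_f_ne (i j : Fin (N / 2)) (hij : i ≠ j) (a : Alg N s) :
    eOp h hN i (fOp h hN j a) = fOp h hN j (eOp h hN i a) := by
  have := twisted_zero (eOp h hN i * fOp h hN j - fOp h hN j * eOp h hN i)
    (torus h (root N i)) (torus h (-root N j)) ?_ ?_
  · rw [← sub_eq_zero]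
    exact DFunLike.congr_fun this a
  · intro a b
    change _ = kOp h (root N i) a * _ + _ * kOp h (-root N j) b
    simp only [LinearMap.sub_apply, Module.End.mul_apply, e_f_mul]
  · intro m
    simp only [LinearMap.sub_apply, Module.End.mul_apply, e_f_ne_x h hN i j hij m, sub_self]

theorem adj {N : ℕ} (hN : 3 ≤ N) (i j : Fin (N / 2)) (hij : i ≠ j)
    (hp : pairing (root N i) (root N j) = 0) :
    (tgt N i : ℕ) ≠ src N j ∧ (tgt N j : ℕ) ≠ src N i := by
  rw [pairing_root_root hN, pairing_root_wt hN, pairing_root_wt hN] at hp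
  have i1 := fin_simp i
  have j1 := fin_simp j
  have i2 := src_val i
  have j2 := src_val j
  have hi := node_cases hN i
  have hj := node_cases hN j
  rw [ne_eq, Fin.ext_iff] at hij
  constructor <;> intro hc
  · rw [if_neg (by omega), if_neg (by omega), if_neg (by omega), if_neg (by omega),
      if_pos (by omega), if_neg (by omega), if_neg (by omega), if_neg (by omega)] at hp
    omega
  · rw [if_neg (by omega), if_neg (by omega), if_pos (by omega), if_neg (by omega),
      if_neg (by omega), if_neg (by omega), if_neg (by omega), if_neg (by omega)] at hp
    omega

theorem long {N : ℕ} (hN : 3 ≤ N) (i : Fin (N / 2)) :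
    (pairing (root N i) (root N i) = 2 → N ≠ 2 * (i : ℕ) + 3) ∧
    (pairing (root N i) (root N i) = 1 → N = 2 * (i : ℕ) + 3) := by
  rw [pairing_root_root hN, pairing_root_wt hN, pairing_root_wt hN]
  have i1 := fin_simp i
  have i2 := src_val i
  have hi := node_cases hN i
  rw [if_pos rfl, if_neg (by omega), if_neg (by omega), if_neg (by omega),
    if_neg (by omega), if_neg (by omega), if_pos rfl]
  constructor <;> intro hp <;> split_ifs at hp <;> omega

theorem e_x_smul (i : Fin (N / 2)) (m : Fin N) :
    ∃ (c : ℂ) (k : Fin N), eOp h hN i (x N s m) = c • x N s k := by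
  rw [eOp_x, eX]
  split_ifs
  · exact ⟨_, _, rfl⟩
  · exact ⟨-1, _, by rw [neg_one_smul]⟩
  · exact ⟨0, m, by rw [zero_smul]⟩

theorem e_e_x_eq (i j : Fin (N / 2)) (n1 : tgt N j ≠ src N i) (n2 : tgt N j ≠ (tgt N i).rev)
    (n3 : src N j ≠ tgt N i) (m : Fin N) :
    eOp h hN i (eOp h hN j (x N s m)) = if m = src N j then 0 else if m = (tgt N j).rev then
      (if (src N j).rev = src N i then -(coef N s i • x N s (tgt N i)) else 0) else 0 := by
  rw [eOp_x, eX]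
  split_ifs with h1 h2 h3
  · rw [map_smul, eOp_x, eX, if_neg n1, if_neg n2, smul_zero]
  · rw [map_neg, eOp_x, eX, if_pos h3]
  · rw [map_neg, eOp_x, eX, if_neg h3, if_neg (fun hh => n3 (Fin.rev_injective hh)), neg_zero]
  · rw [map_zero]

theorem e_e_x (i j : Fin (N / 2)) (hij : i ≠ j) (hp : pairing (root N i) (root N j) = 0)
    (m : Fin N) : eOp h hN i (eOp h hN j (x N s m)) = eOp h hN j (eOp h hN i (x N s m)) := by
  have hi := node_cases hN i
  have hj := node_cases hN j
  have i1 := fin_simp i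
  have j1 := fin_simp j
  have i2 := src_val i
  have j2 := src_val j
  have ha := adj hN i j hij hp
  rw [ne_eq, Fin.ext_iff] at hij
  have n1 : tgt N j ≠ src N i := fun hh => ha.2 (by rw [hh])
  have n2 : tgt N j ≠ (tgt N i).rev := by rw [ne_eq, Fin.ext_iff]; omega
  have n3 : tgt N i ≠ src N j := fun hh => ha.1 (by rw [hh])
  have n4 : tgt N i ≠ (tgt N j).rev := fun hh => n2 (by rw [hh, Fin.rev_rev])
  rw [e_e_x_eq h hN i j n1 n2 n3.symm, e_e_x_eq h hN j i n3 n4 n1.symm]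
  by_cases hk : (src N j).rev = src N i
  · have hk' : (src N i).rev = src N j := by rw [← hk, Fin.rev_rev]
    have hk2 := congrArg Fin.val hk
    have ht : tgt N i = tgt N j := Fin.ext (by omega)
    have e1 : (tgt N j).rev ≠ src N i := by rw [ne_eq, Fin.ext_iff]; omega
    have e2 : (tgt N j).rev ≠ src N j := by rw [ne_eq, Fin.ext_iff]; omega
    rw [if_pos hk, if_pos hk', ht, coef_one i (by omega), coef_one j (by omega)]
    by_cases hm : m = (tgt N j).rev
    · rw [hm, if_neg e1, if_neg e2]
    · simp only [if_neg hm, ite_self]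
  · have hk' : (src N i).rev ≠ src N j := fun hh => hk (by rw [← hh, Fin.rev_rev])
    simp only [if_neg hk, if_neg hk', ite_self]

theorem e_sq_x (i : Fin (N / 2)) (hi : N ≠ 2 * (i : ℕ) + 3) (m : Fin N) :
    eOp h hN i (eOp h hN i (x N s m)) = 0 := by
  have hi := node_cases hN i
  have i1 := fin_simp i
  have i2 := src_val i
  have hlt := m.2
  simp only [eOp_x, eX]
  split_ifs with h1 h2 <;>
    simp only [map_smul, map_neg, map_zero, eOp_x, eX, neg_zero, smul_zero] <;>
    simp only [Fin.ext_iff] at * <;> split_ifs <;>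
    first
    | omega
    | simp only [smul_zero, neg_zero]

theorem e_cube_x (i : Fin (N / 2)) (hi : N = 2 * (i : ℕ) + 3) (m : Fin N) :
    eOp h hN i (eOp h hN i (eOp h hN i (x N s m))) = 0 := by
  have hi := node_cases hN i
  have i1 := fin_simp i
  have i2 := src_val i
  have hlt := m.2
  simp only [eOp_x, eX]
  split_ifs with h1 h2 <;>
    simp only [map_smul, map_neg, map_zero, eOp_x, eX, neg_zero, smul_zero] <;>
    simp only [Fin.ext_iff] at * <;> split_ifs <;>
    simp only [map_smul, map_neg, map_zero, eOp_x, eX, neg_zero, smul_zero] <;>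
    simp only [Fin.ext_iff] at * <;> (try split_ifs) <;>
    first
    | omega
    | simp only [smul_zero, neg_zero]

theorem e_i_j_i_x (i j : Fin (N / 2)) (hij : i ≠ j) (hi : N ≠ 2 * (i : ℕ) + 3) (m : Fin N) :
    eOp h hN i (eOp h hN j (eOp h hN i (x N s m))) = 0 := by
  have hi := node_cases hN i
  have hj := node_cases hN j
  have i1 := fin_simp i
  have j1 := fin_simp j
  have i2 := src_val i
  have j2 := src_val j
  have hlt := m.2
  rw [ne_eq, Fin.ext_iff] at hij
  simp only [eOp_x, eX]
  split_ifs with h1 h2 <;>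
    simp only [map_smul, map_neg, map_zero, eOp_x, eX, neg_zero, smul_zero] <;>
    simp only [Fin.ext_iff] at * <;> split_ifs <;>
    simp only [map_smul, map_neg, map_zero, eOp_x, eX, neg_zero, smul_zero] <;>
    simp only [Fin.ext_iff] at * <;> (try split_ifs) <;>
    first
    | omega
    | simp only [smul_zero, neg_zero]

theorem e_i_j_i_i_x (i j : Fin (N / 2)) (hij : i ≠ j) (hi : N = 2 * (i : ℕ) + 3) (m : Fin N) :
    eOp h hN i (eOp h hN j (eOp h hN i (eOp h hN i (x N s m)))) = 0 ∧
    eOp h hN i (eOp h hN i (eOp h hN j (eOp h hN i (x N s m)))) = 0 := by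
  have hi := node_cases hN i
  have hj := node_cases hN j
  have i1 := fin_simp i
  have j1 := fin_simp j
  have i2 := src_val i
  have j2 := src_val j
  have hlt := m.2
  rw [ne_eq, Fin.ext_iff] at hij
  constructor <;> simp only [eOp_x, eX] <;>
  split_ifs with h1 h2 <;>
    simp only [map_smul, map_neg, map_zero, eOp_x, eX, neg_zero, smul_zero] <;>
    simp only [Fin.ext_iff] at * <;> split_ifs <;> (try omega) <;>
    simp only [map_smul, map_neg, map_zero, eOp_x, eX, neg_zero, smul_zero] <;>
    simp only [Fin.ext_iff] at * <;> (try split_ifs) <;> (try omega) <;>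
    simp only [map_smul, map_neg, map_zero, eOp_x, eX, neg_zero, smul_zero] <;>
    simp only [Fin.ext_iff] at * <;> (try split_ifs) <;>
    first
    | omega
    | simp only [smul_zero, neg_zero]

theorem e_e (i j : Fin (N / 2)) (hij : i ≠ j) (hp : pairing (root N i) (root N j) = 0)
    (a : Alg N s) : eOp h hN i (eOp h hN j a) = eOp h hN j (eOp h hN i a) := by
  have := twisted_zero (eOp h hN i * eOp h hN j - eOp h hN j * eOp h hN i)
    (torus h (root N i + root N j)) (AlgHom.id ℂ _) ?_ ?_
  · rw [← sub_eq_zero]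
    exact DFunLike.congr_fun this a
  · intro a b
    change _ = kOp h (root N i + root N j) a * _ + _ * b
    simp only [LinearMap.sub_apply, Module.End.mul_apply, eOp_mul, map_add, k_e, hp,
      pairing_comm (root N j) (root N i), zpow_zero, one_smul]
    simp only [kOp_add, add_comm (root N j) (root N i), mul_sub, sub_mul]
    abel
  · intro m
    simp only [LinearMap.sub_apply, Module.End.mul_apply, e_e_x h hN i j hij hp, sub_self]

theorem serre_two (i j : Fin (N / 2)) (hij : i ≠ j) (hii : pairing (root N i) (root N i) = 2)
    (hp : pairing (root N i) (root N j) = -1) (a : Alg N s) :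
    eOp h hN i (eOp h hN i (eOp h hN j a)) -
      (s ^ 2 + (s ^ 2)⁻¹) • eOp h hN i (eOp h hN j (eOp h hN i a)) +
      eOp h hN j (eOp h hN i (eOp h hN i a)) = 0 := by
  have h0 := h.ne_zero
  have := twisted_zero (eOp h hN i * (eOp h hN i * eOp h hN j) -
      (s ^ 2 + (s ^ 2)⁻¹) • (eOp h hN i * (eOp h hN j * eOp h hN i)) +
      eOp h hN j * (eOp h hN i * eOp h hN i))
    (torus h (root N i + root N i + root N j)) (AlgHom.id ℂ _) ?_ ?_
  · exact DFunLike.congr_fun this a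
  · intro a b
    change _ = kOp h (root N i + root N i + root N j) a * _ + _ * b
    have hs : ∀ y, kOp h (root N j) (kOp h (root N i) y) =
        kOp h (root N i) (kOp h (root N j) y) := fun y => by
      rw [kOp_add, kOp_add, add_comm]
    rw [← kOp_add, ← kOp_add]
    simp only [LinearMap.sub_apply, LinearMap.add_apply, LinearMap.smul_apply,
      Module.End.mul_apply, eOp_mul, map_add, map_smul, k_e, hp, hii, hs, zpow_neg, zpow_one,
      pairing_comm (root N j) (root N i), smul_mul_assoc, mul_smul_comm, smul_smul]
    simp only [mul_sub, sub_mul, smul_add, add_mul, mul_add, smul_mul_assoc, mul_smul_comm]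
    match_scalars <;> field_simp <;> ring
  · intro m
    have hl := (long hN i).1 hii
    obtain ⟨c, k, hk⟩ := e_x_smul h hN j m
    simp only [LinearMap.sub_apply, LinearMap.add_apply, LinearMap.smul_apply,
      Module.End.mul_apply, e_sq_x h hN i hl, e_i_j_i_x h hN i j hij hl, hk, map_smul, map_zero]
    simp

theorem serre_three (i j : Fin (N / 2)) (hij : i ≠ j) (hii : pairing (root N i) (root N i) = 1)
    (hp : pairing (root N i) (root N j) = -1) (a : Alg N s) :
    eOp h hN i (eOp h hN i (eOp h hN i (eOp h hN j a))) -
      (s ^ 2 + 1 + (s ^ 2)⁻¹) • eOp h hN i (eOp h hN i (eOp h hN j (eOp h hN i a))) +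
      (s ^ 2 + 1 + (s ^ 2)⁻¹) • eOp h hN i (eOp h hN j (eOp h hN i (eOp h hN i a))) -
      eOp h hN j (eOp h hN i (eOp h hN i (eOp h hN i a))) = 0 := by
  have h0 := h.ne_zero
  have := twisted_zero (eOp h hN i * (eOp h hN i * (eOp h hN i * eOp h hN j)) -
      (s ^ 2 + 1 + (s ^ 2)⁻¹) • (eOp h hN i * (eOp h hN i * (eOp h hN j * eOp h hN i))) +
      (s ^ 2 + 1 + (s ^ 2)⁻¹) • (eOp h hN i * (eOp h hN j * (eOp h hN i * eOp h hN i))) -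
      eOp h hN j * (eOp h hN i * (eOp h hN i * eOp h hN i)))
    (torus h (root N i + root N i + root N i + root N j)) (AlgHom.id ℂ _) ?_ ?_
  · exact DFunLike.congr_fun this a
  · intro a b
    change _ = kOp h (root N i + root N i + root N i + root N j) a * _ + _ * b
    have hs : ∀ y, kOp h (root N j) (kOp h (root N i) y) =
        kOp h (root N i) (kOp h (root N j) y) := fun y => by
      rw [kOp_add, kOp_add, add_comm]
    rw [← kOp_add, ← kOp_add, ← kOp_add]
    simp only [LinearMap.sub_apply, LinearMap.add_apply, LinearMap.smul_apply,
      Module.End.mul_apply, eOp_mul, map_add, map_smul, k_e, hp, hii, hs, zpow_neg, zpow_one,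
      pairing_comm (root N j) (root N i), smul_mul_assoc, mul_smul_comm, smul_smul]
    simp only [mul_sub, sub_mul, smul_add, add_mul, mul_add, smul_mul_assoc, mul_smul_comm]
    match_scalars <;> field_simp <;> ring
  · intro m
    have hl := (long hN i).2 hii
    obtain ⟨c, k, hk⟩ := e_x_smul h hN j m
    simp only [LinearMap.sub_apply, LinearMap.add_apply, LinearMap.smul_apply,
      Module.End.mul_apply, e_cube_x h hN i hl, (e_i_j_i_i_x h hN i j hij hl m).1,
      (e_i_j_i_i_x h hN i j hij hl m).2, hk, map_smul, map_zero]
    simp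

end Operators


section FSerre

variable {N : ℕ} {s : ℂ} (h : Generic s) (hN : 3 ≤ N)

theorem f_f (i j : Fin (N / 2)) (hij : i ≠ j) (hp : pairing (root N i) (root N j) = 0)
    (a : Alg N s) : fOp h hN i (fOp h hN j a) = fOp h hN j (fOp h hN i a) := by
  simp only [f_eq, map_smul, flip_flip]
  rw [e_e h hN i j hij hp, smul_comm]

theorem f_serre_two (i j : Fin (N / 2)) (hij : i ≠ j) (hii : pairing (root N i) (root N i) = 2)
    (hp : pairing (root N i) (root N j) = -1) (a : Alg N s) :
    fOp h hN i (fOp h hN i (fOp h hN j a)) -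
      (s ^ 2 + (s ^ 2)⁻¹) • fOp h hN i (fOp h hN j (fOp h hN i a)) +
      fOp h hN j (fOp h hN i (fOp h hN i a)) = 0 := by
  have := congrArg (fun y => (-(coef N s i)⁻¹ * -(coef N s i)⁻¹ * -(coef N s j)⁻¹) • flip h y)
    (serre_two h hN i j hij hii hp (flip h a))
  simp only [f_eq, map_smul, flip_flip, map_sub, map_add, map_zero, smul_zero] at this ⊢
  rw [← this]
  module

theorem f_serre_three (i j : Fin (N / 2)) (hij : i ≠ j)
    (hii : pairing (root N i) (root N i) = 1)
    (hp : pairing (root N i) (root N j) = -1) (a : Alg N s) :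
    fOp h hN i (fOp h hN i (fOp h hN i (fOp h hN j a))) -
      (s ^ 2 + 1 + (s ^ 2)⁻¹) • fOp h hN i (fOp h hN i (fOp h hN j (fOp h hN i a))) +
      (s ^ 2 + 1 + (s ^ 2)⁻¹) • fOp h hN i (fOp h hN j (fOp h hN i (fOp h hN i a))) -
      fOp h hN j (fOp h hN i (fOp h hN i (fOp h hN i a))) = 0 := by
  have := congrArg (fun y => (-(coef N s i)⁻¹ * -(coef N s i)⁻¹ * -(coef N s i)⁻¹ *
    -(coef N s j)⁻¹) • flip h y) (serre_three h hN i j hij hii hp (flip h a))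
  simp only [f_eq, map_smul, flip_flip, map_sub, map_add, map_zero, smul_zero] at this ⊢
  rw [← this]
  module

end FSerre

/-! The quantum algebra `U_q(so_N)` and its action on `𝒜`. -/

/-- The generators of `U_q(so_N)`; `k i` stands for `K̂_i`, and `kinv i` for its inverse. -/
inductive Gen (N : ℕ) : Type
  | k (i : Fin (N / 2))
  | kinv (i : Fin (N / 2))
  | e (i : Fin (N / 2))
  | f (i : Fin (N / 2))

/-- The free algebra on the generators of `U_q(so_N)`. -/
abbrev FreeU (N : ℕ) : Type := FreeAlgebra ℂ (Gen N)

/-- A generator as an element of the free algebra. -/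
noncomputable def gen {N : ℕ} (g : Gen N) : FreeU N := FreeAlgebra.ι ℂ g

/-- `K_i = ∏_j K̂_j ^ (α_i)_j`: this is `K̂_i K̂_{i+1}⁻¹`, but for the last node, where it is `K̂_n`
if `N = 2 n + 1` and `K̂_{n-1} K̂_n` if `N = 2 n`. -/
noncomputable def kRoot {N : ℕ} (i : Fin (N / 2)) : FreeU N :=
  if IsForkNode N i then gen (.k ⟨i - 1, by have := i.2; omega⟩) * gen (.k i)
  else if hi : (i : ℕ) + 1 < N / 2 then gen (.k i) * gen (.kinv ⟨i + 1, hi⟩)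
  else gen (.k i)

/-- `K_i⁻¹`. -/
noncomputable def kRootInv {N : ℕ} (i : Fin (N / 2)) : FreeU N :=
  if IsForkNode N i then gen (.kinv ⟨i - 1, by have := i.2; omega⟩) * gen (.kinv i)
  else if hi : (i : ℕ) + 1 < N / 2 then gen (.kinv i) * gen (.k ⟨i + 1, hi⟩)
  else gen (.kinv i)

/-- The defining relations of `U_q(so_N)`, for `q = s ^ 2`. The last six are the `q`-Serre
relations `∑_r (-1) ^ r [1 - a_ij, r]_{q_i} X_i ^ (1 - a_ij - r) X_j X_i ^ r = 0` for the values
`0`, `-1`, `-2` of the entry `a_ij = 2 ⟨α_i, α_j⟩ / ⟨α_i, α_i⟩` of the Cartan matrix. -/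
inductive URel (N : ℕ) (s : ℂ) : FreeU N → FreeU N → Prop
  | k_kinv (i) : URel N s (gen (.k i) * gen (.kinv i)) 1
  | kinv_k (i) : URel N s (gen (.kinv i) * gen (.k i)) 1
  | k_k (i j) : URel N s (gen (.k i) * gen (.k j)) (gen (.k j) * gen (.k i))
  | k_e (i j) : URel N s (gen (.k i) * gen (.e j))
      ((s ^ 2) ^ root N j i • (gen (.e j) * gen (.k i)))
  | k_f (i j) : URel N s (gen (.k i) * gen (.f j))
      ((s ^ 2) ^ (-root N j i) • (gen (.f j) * gen (.k i)))
  | e_f_self (i) : URel N s (gen (.e i) * gen (.f i) - gen (.f i) * gen (.e i))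
      ((s ^ 2 - (s ^ 2)⁻¹)⁻¹ • (kRoot i - kRootInv i))
  | e_f_ne (i j) (hij : i ≠ j) : URel N s (gen (.e i) * gen (.f j)) (gen (.f j) * gen (.e i))
  | serre_e_zero (i j) (hij : i ≠ j) (hp : pairing (root N i) (root N j) = 0) :
      URel N s (gen (.e i) * gen (.e j)) (gen (.e j) * gen (.e i))
  | serre_f_zero (i j) (hij : i ≠ j) (hp : pairing (root N i) (root N j) = 0) :
      URel N s (gen (.f i) * gen (.f j)) (gen (.f j) * gen (.f i))
  | serre_e_one (i j) (hij : i ≠ j) (hii : pairing (root N i) (root N i) = 2)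
      (hp : pairing (root N i) (root N j) = -1) :
      URel N s (gen (.e i) ^ 2 * gen (.e j) -
        (s ^ 2 + (s ^ 2)⁻¹) • (gen (.e i) * gen (.e j) * gen (.e i)) +
        gen (.e j) * gen (.e i) ^ 2) 0
  | serre_f_one (i j) (hij : i ≠ j) (hii : pairing (root N i) (root N i) = 2)
      (hp : pairing (root N i) (root N j) = -1) :
      URel N s (gen (.f i) ^ 2 * gen (.f j) -
        (s ^ 2 + (s ^ 2)⁻¹) • (gen (.f i) * gen (.f j) * gen (.f i)) +
        gen (.f j) * gen (.f i) ^ 2) 0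
  | serre_e_two (i j) (hij : i ≠ j) (hii : pairing (root N i) (root N i) = 1)
      (hp : pairing (root N i) (root N j) = -1) :
      URel N s (gen (.e i) ^ 3 * gen (.e j) -
        (s ^ 2 + 1 + (s ^ 2)⁻¹) • (gen (.e i) ^ 2 * gen (.e j) * gen (.e i)) +
        (s ^ 2 + 1 + (s ^ 2)⁻¹) • (gen (.e i) * gen (.e j) * gen (.e i) ^ 2) -
        gen (.e j) * gen (.e i) ^ 3) 0
  | serre_f_two (i j) (hij : i ≠ j) (hii : pairing (root N i) (root N i) = 1)
      (hp : pairing (root N i) (root N j) = -1) :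
      URel N s (gen (.f i) ^ 3 * gen (.f j) -
        (s ^ 2 + 1 + (s ^ 2)⁻¹) • (gen (.f i) ^ 2 * gen (.f j) * gen (.f i)) +
        (s ^ 2 + 1 + (s ^ 2)⁻¹) • (gen (.f i) * gen (.f j) * gen (.f i) ^ 2) -
        gen (.f j) * gen (.f i) ^ 3) 0

/-- The quantum algebra `U_q(so_N)`. -/
def U (N : ℕ) (s : ℂ) : Type := RingQuot (URel N s)

noncomputable instance (N : ℕ) (s : ℂ) : Ring (U N s) :=
  inferInstanceAs (Ring (RingQuot (URel N s)))

noncomputable instance (N : ℕ) (s : ℂ) : Algebra ℂ (U N s) :=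
  inferInstanceAs (Algebra ℂ (RingQuot (URel N s)))

/-- The projection of the free algebra to `U_q(so_N)`. -/
noncomputable def projU (N : ℕ) (s : ℂ) : FreeU N →ₐ[ℂ] U N s := RingQuot.mkAlgHom ℂ (URel N s)

/-- The counit on the generators. -/
def counitGen {N : ℕ} : Gen N → ℂ
  | .k _ => 1
  | .kinv _ => 1
  | .e _ => 0
  | .f _ => 0

theorem counit_rel {N : ℕ} {s : ℂ} {u v : FreeU N} (r : URel N s u v) :
    FreeAlgebra.lift ℂ counitGen u = FreeAlgebra.lift ℂ counitGen v := by
  have hk : ∀ g : Gen N, FreeAlgebra.lift ℂ counitGen (gen g) = counitGen g := fun g =>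
    FreeAlgebra.lift_ι_apply _ _
  have h1 : ∀ i : Fin (N / 2), FreeAlgebra.lift ℂ counitGen (kRoot i) = 1 := fun i => by
    rw [kRoot]; split_ifs <;> simp [hk, counitGen]
  have h2 : ∀ i : Fin (N / 2), FreeAlgebra.lift ℂ counitGen (kRootInv i) = 1 := fun i => by
    rw [kRootInv]; split_ifs <;> simp [hk, counitGen]
  cases r <;> simp [hk, counitGen, h1, h2]

/-- The counit of `U_q(so_N)`: `K̂_i ↦ 1`, `E_i ↦ 0`, `F_i ↦ 0`. -/
noncomputable def counit {N : ℕ} {s : ℂ} : U N s →ₐ[ℂ] ℂ :=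
  RingQuot.liftAlgHom ℂ ⟨FreeAlgebra.lift ℂ counitGen, fun _ _ r => counit_rel r⟩

/-- The operators by which the generators act. -/
noncomputable def actGen {N : ℕ} {s : ℂ} (h : Generic s) (hN : 3 ≤ N) :
    Gen N → Module.End ℂ (Alg N s)
  | .k i => kOp h (Pi.single i 1)
  | .kinv i => kOp h (-Pi.single i 1)
  | .e i => eOp h hN i
  | .f i => fOp h hN i

theorem act_rel {N : ℕ} {s : ℂ} (h : Generic s) (hN : 3 ≤ N) {u v : FreeU N}
    (r : URel N s u v) :
    FreeAlgebra.lift ℂ (actGen h hN) u = FreeAlgebra.lift ℂ (actGen h hN) v := by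
  have hk : ∀ g : Gen N, FreeAlgebra.lift ℂ (actGen h hN) (gen g) = actGen h hN g := fun g =>
    FreeAlgebra.lift_ι_apply _ _
  have hs : ∀ i j : Fin (N / 2), pairing (Pi.single i 1) (root N j) = root N j i := fun i j => by
    simp [pairing, Pi.single_apply]
  have hmm : ∀ v w : Fin (N / 2) → ℤ, kOp h v * kOp h w = kOp h (v + w) := fun v w =>
    LinearMap.ext fun a => kOp_add h v w a
  have h1 : ∀ i : Fin (N / 2),
      FreeAlgebra.lift ℂ (actGen h hN) (kRoot i) = kOp h (root N i) ∧
      FreeAlgebra.lift ℂ (actGen h hN) (kRootInv i) = kOp h (-root N i) := fun i => by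
    have hi := i.2
    rcases node_cases hN i with hc | hc | hc
    · have e : root N i = Pi.single i 1 - Pi.single ⟨i + 1, hc.2.2⟩ 1 := by
        ext j
        simp only [root, hc.1, if_false, Pi.sub_apply, Pi.single_apply, Fin.ext_iff]
      rw [kRoot, kRootInv, if_neg hc.1, if_neg hc.1, dif_pos hc.2.2, dif_pos hc.2.2, e]
      simp only [map_mul, hk, actGen, hmm]
      constructor <;> congr 1 <;> abel
    · have hn : ¬(i : ℕ) + 1 < N / 2 := by omega
      have e : root N i = Pi.single i 1 := by
        ext j
        have := j.2
        simp only [root, hc.1, if_false, Pi.single_apply]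
        rw [if_neg (show ¬(j : ℕ) = i + 1 by omega), sub_zero]
      rw [kRoot, kRootInv, if_neg hc.1, if_neg hc.1, dif_neg hn, dif_neg hn, e]
      simp only [hk, actGen, and_self]
    · have e : root N i = Pi.single ⟨i - 1, by omega⟩ 1 + Pi.single i 1 := by
        ext j
        simp only [root, hc.1, if_true, Pi.add_apply, Pi.single_apply, Fin.ext_iff]
        congr 1
        exact if_congr (by omega) rfl rfl
      rw [kRoot, kRootInv, if_pos hc.1, if_pos hc.1, e]
      simp only [map_mul, hk, actGen, hmm, true_and]
      congr 1
      abel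
  ext a
  cases r with
  | k_kinv i => simp [hk, actGen, kOp_add, kOp_zero]
  | kinv_k i => simp [hk, actGen, kOp_add, kOp_zero]
  | k_k i j => simp [hk, actGen, kOp_add, add_comm]
  | k_e i j => simp [hk, actGen, k_e, hs]
  | k_f i j => simp [hk, actGen, k_f, hs]
  | e_f_self i => simpa [hk, actGen, h1] using e_f_self h hN i a
  | e_f_ne i j hij => simpa [hk, actGen] using e_f_ne h hN i j hij a
  | serre_e_zero i j hij hp => simpa [hk, actGen] using e_e h hN i j hij hp a
  | serre_f_zero i j hij hp => simpa [hk, actGen] using f_f h hN i j hij hp a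
  | serre_e_one i j hij hii hp =>
    simpa [hk, actGen, pow_succ] using serre_two h hN i j hij hii hp a
  | serre_f_one i j hij hii hp =>
    simpa [hk, actGen, pow_succ] using f_serre_two h hN i j hij hii hp a
  | serre_e_two i j hij hii hp =>
    simpa [hk, actGen, pow_succ] using serre_three h hN i j hij hii hp a
  | serre_f_two i j hij hii hp =>
    simpa [hk, actGen, pow_succ] using f_serre_three h hN i j hij hii hp a

/-- The action `X ▷ a` of `U_q(so_N)` on `𝒜`. -/
noncomputable def action {N : ℕ} {s : ℂ} (h : Generic s) (hN : 3 ≤ N) :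
    U N s →ₐ[ℂ] Module.End ℂ (Alg N s) :=
  RingQuot.liftAlgHom ℂ ⟨FreeAlgebra.lift ℂ (actGen h hN), fun _ _ r => act_rel h hN r⟩

/-- The subalgebra `U_q(so_{N-2})` of `U_q(so_N)`: for `N ≥ 5`, it is generated by
`K_i, K_i⁻¹, E_i, F_i` with `i = 2, …, n` (here: the nodes but for node `0`). For `N = 4`, it is the
torus `U_q(so_2)` generated by `K̂_2` and its inverse. -/
noncomputable def subU (N : ℕ) (s : ℂ) : Subalgebra ℂ (U N s) :=
  if N = 4 then
    Algebra.adjoin ℂ {X | ∃ i : Fin (N / 2), (i : ℕ) = 1 ∧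
      (X = projU N s (gen (.k i)) ∨ X = projU N s (gen (.kinv i)))}
  else
    Algebra.adjoin ℂ {X | ∃ i : Fin (N / 2), 1 ≤ (i : ℕ) ∧
      (X = projU N s (kRoot i) ∨ X = projU N s (kRootInv i) ∨
        X = projU N s (gen (.e i)) ∨ X = projU N s (gen (.f i)))}

/-- The space of the `U_q(so_{N-2})`-invariant elements of `𝒜`. -/
noncomputable def invariants {N : ℕ} {s : ℂ} (h : Generic s) (hN : 3 ≤ N) :
    Submodule ℂ (Alg N s) where
  carrier := {a | ∀ X ∈ subU N s, action h hN X a = counit X • a}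
  add_mem' {a b} ha hb X hX := by rw [map_add, ha X hX, hb X hX, smul_add]
  zero_mem' X _ := by rw [map_zero, smul_zero]
  smul_mem' c a ha X hX := by rw [map_smul, ha X hX, smul_comm]

/-- The squared `q`-radius `Q_{j+1} = ∑ q ^ ρ_{i'} x_i x_{i'}` of the subalgebra generated by
`x_{j+1}, …, x_{(j+1)'}` in the numbering from `1`; thus `Q = qRadius N s 0`, and
`Q_2 = qRadius N s 1`. -/
noncomputable def qRadius (N : ℕ) (s : ℂ) (j : ℕ) : Alg N s :=
  ∑ i ∈ Finset.univ.filter (fun i : Fin N => j ≤ (i : ℕ) ∧ j ≤ (i.rev : ℕ)), qRho N s i.rev • (x N s i * x N s i.rev)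

/-- The map `ℂ[t] → 𝒜`, `f ↦ f(z) x_1 ^ k x_{1'} ^ l`. -/
noncomputable def polyMap {N : ℕ} {s : ℂ} (hN : 3 ≤ N) (z : Alg N s) (kl : ℕ × ℕ) :
    Polynomial ℂ →ₗ[ℂ] Alg N s :=
  (LinearMap.mulRight ℂ (x N s ⟨0, by omega⟩ ^ kl.1 * x N s (Fin.rev ⟨0, by omega⟩) ^ kl.2)).comp
    (Polynomial.aeval z).toLinearMap

/-- The space `ℂ[z] x_1 ^ k x_{1'} ^ l`. -/
noncomputable def polySpace {N : ℕ} {s : ℂ} (hN : 3 ≤ N) (z : Alg N s) (kl : ℕ × ℕ) :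
    Submodule ℂ (Alg N s) := LinearMap.range (polyMap hN z kl)

end QEuclid

/-!
The algebra `𝒜` in dimension `N = M + 2` is an iterated Ore extension of the algebra `B` generated
by the inner coordinates `x_2, …, x_{2'}`, which is `𝒜` in dimension `M`: the coordinates `x_1` and
`x_{1'}` `q`-commute with `B`, and their commutator is a nonzero multiple of `Q_2`. Hence
`𝒜 = ⨁ B x_1 ^ k x_{1'} ^ l` (`assemble_injective`, `assemble_surjective`); freeness is seen on an
explicit representation, which exists since `Q` is central (`qRadius_comm`).

The quantum algebra `U_q(so_{N-2})` acts on the components in `B` and fixes `x_1` and `x_{1'}`, so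
that the claim amounts to `B ^ U_q(so_M) = ℂ[Q]` in dimension `M` (`mem_adjoin_of_weaklyInvariant`).
This is proved by induction in steps of two. An element of weight zero that the nodes other than the
first one kill is, by induction, a combination of `f(Q_2) x_1 ^ k x_{1'} ^ k`. Since `Q` is a
combination of `x_1 x_{1'}` and `Q_2` with nonzero coefficients, it is also a polynomial in the
central element `Q` and in `Q_2`, and these two are algebraically independent. Now `E_1` kills `Q`,
while it maps `Q_2 ^ j` to a nonzero multiple of `x_1 Q_2 ^ (j - 1) x_{2'}`, because `q` is not a
root of unity; so only the powers of `Q` remain (`mem_adjoin_of_twisted_derivation`). If there is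
only one inner coordinate, it plays the role of `Q_2`.

This gives the sum over `ℂ[Q_2]`, with the `Q_2 ^ m x_1 ^ k x_{1'} ^ l` linearly independent. The
elements `Q ^ m x_1 ^ k x_{1'} ^ l` are triangular in these with respect to `m`
(`triangular_qRadius`), whence the same for `ℂ[Q]`.
-/

namespace QEuclid

/-! ### Shifting indices -/

/-- The shift `j ↦ j + 1` of indices, under which `𝒜` in dimension `M` becomes the subalgebra of `𝒜`
in dimension `M + 2` that is generated by all coordinates but the first and the last one. -/
def sh {M : ℕ} (j : Fin M) : Fin (M + 2) := j.castSucc.succ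

theorem sh_val {M : ℕ} (j : Fin M) : (sh j : ℕ) = j + 1 := rfl

theorem rev_sh {M : ℕ} (j : Fin M) : (sh j).rev = sh j.rev := by
  ext; simp only [sh_val, Fin.val_rev]; omega

theorem sh_injective {M : ℕ} : Function.Injective (sh : Fin M → Fin (M + 2)) := fun a b hab => by
  rw [Fin.ext_iff, sh_val, sh_val] at hab
  exact Fin.ext (by omega)

theorem sh_lt {M : ℕ} {i j : Fin M} : sh i < sh j ↔ i < j := by
  simp only [Fin.lt_def, sh_val]; omega

theorem sh_ne_zero {M : ℕ} (j : Fin M) : sh j ≠ 0 := by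
  rw [ne_eq, Fin.ext_iff, sh_val]; simp

theorem sh_ne_rev_zero {M : ℕ} (j : Fin M) : sh j ≠ Fin.rev 0 := by
  have := j.2
  rw [ne_eq, Fin.ext_iff, sh_val, Fin.val_rev, Fin.val_zero]; omega

theorem zero_ne_rev {M : ℕ} : (0 : Fin (M + 2)) ≠ Fin.rev 0 := by
  rw [ne_eq, Fin.ext_iff, Fin.val_rev, Fin.val_zero]; omega

theorem zero_lt_rev {M : ℕ} : (0 : Fin (M + 2)) < Fin.rev 0 := by
  rw [Fin.lt_def, Fin.val_rev, Fin.val_zero]; omega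

theorem fin_cases_sh {M : ℕ} (i : Fin (M + 2)) :
    i = 0 ∨ (∃ j : Fin M, i = sh j) ∨ i = Fin.rev 0 := by
  have := i.2
  by_cases h0 : (i : ℕ) = 0
  · exact Or.inl (Fin.ext h0)
  by_cases h1 : (i : ℕ) = M + 1
  · exact Or.inr (Or.inr (Fin.ext (by rw [h1, Fin.val_rev, Fin.val_zero]; omega)))
  · exact Or.inr (Or.inl ⟨⟨i - 1, by omega⟩, Fin.ext (by rw [sh_val]; simp only; omega)⟩)

theorem sum_sh {B : Type} [AddCommMonoid B] {M : ℕ} (f : Fin (M + 2) → B) :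
    ∑ i, f i = f 0 + ∑ j, f (sh j) + f (Fin.rev 0) := by
  have e : (Fin.rev 0 : Fin (M + 2)) = (Fin.last M).succ := rfl
  rw [Fin.sum_univ_succ, Fin.sum_univ_castSucc, e]
  exact (add_assoc _ _ _).symm

theorem sum_between_zero {B : Type} [AddCommMonoid B] {M : ℕ} (f : Fin (M + 2) → B) :
    ∑ j : Fin (M + 2) with 0 < j ∧ j < Fin.rev 0, f j = ∑ j : Fin M, f (sh j) := by
  rw [Finset.sum_filter, sum_sh]
  simp only [lt_self_iff_false, false_and, and_false, if_false, zero_add, add_zero]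
  refine Finset.sum_congr rfl fun j _ => if_pos ⟨?_, ?_⟩
  · rw [Fin.lt_def, sh_val]; simp
  · rw [Fin.lt_def, sh_val, Fin.val_rev, Fin.val_zero]; omega

theorem sum_between_sh {B : Type} [AddCommMonoid B] {M : ℕ} (i : Fin M) (f : Fin (M + 2) → B) :
    ∑ j : Fin (M + 2) with sh i < j ∧ j < (sh i).rev, f j =
      ∑ j : Fin M with i < j ∧ j < i.rev, f (sh j) := by
  rw [Finset.sum_filter, sum_sh, Finset.sum_filter, rev_sh, if_neg, if_neg]
  · simp only [sh_lt, zero_add, add_zero]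
  · rintro ⟨-, h2⟩
    rw [Fin.lt_def, sh_val, Fin.val_rev, Fin.val_zero] at h2
    omega
  · rintro ⟨h1, -⟩
    rw [Fin.lt_def, Fin.val_zero] at h1
    omega

theorem qRho_sh {M : ℕ} (s : ℂ) (j : Fin M) : qRho (M + 2) s (sh j) = qRho M s j := by
  rw [qRho, qRho]
  congr 1
  simp only [twoRho, rev_sh, sh_lt, sh_val]
  push_cast
  split_ifs <;> ring

theorem lam_sh {M : ℕ} (s : ℂ) (j : Fin M) : lam (M + 2) s (sh j) = lam M s j := by
  rw [lam, lam, qRho_sh]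

section Shift

variable {M : ℕ} {s : ℂ} (h : Generic s)

/-- The embedding of `𝒜` in dimension `M` into `𝒜` in dimension `M + 2` that shifts the indices. -/
noncomputable def incl : Alg M s →ₐ[ℂ] Alg (M + 2) s :=
  lift h (fun j => x (M + 2) s (sh j))
    { comm := fun i j hij hne => (sat_x h).comm _ _ (sh_lt.mpr hij) fun e =>
        hne (sh_injective (by rw [e, rev_sh]))
      radial := fun i hi => by
        have := (sat_x h).radial (sh i) (by rwa [rev_sh, sh_lt])
        rw [sum_between_sh, lam_sh] at this
        simpa only [rev_sh, qRho_sh] using this }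

theorem incl_x (j : Fin M) : incl h (x M s j) = x (M + 2) s (sh j) := lift_x h _ _ j

/-- The endomorphism of `𝒜` that multiplies every coordinate by `c`. -/
noncomputable def scale (c : ℂ) : Alg M s →ₐ[ℂ] Alg M s :=
  lift h (fun j => c • x M s j)
    { comm := fun i j hij hne => by
        simp only [smul_mul_smul_comm, (sat_x h).comm i j hij hne]
        rw [smul_comm]
      radial := fun i hi => by
        simp only [smul_mul_smul_comm, ← smul_sub, (sat_x h).radial i hi]
        rw [smul_comm, Finset.smul_sum]
        congr 1
        exact Finset.sum_congr rfl fun j _ => smul_comm _ _ _ }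

theorem scale_x (c : ℂ) (j : Fin M) : scale h c (x M s j) = c • x M s j := lift_x h _ _ j

theorem scale_scale (c d : ℂ) (hcd : c * d = 1) (a : Alg M s) :
    scale h c (scale h d a) = a := by
  have : (scale h c).comp (scale h d) = AlgHom.id ℂ (Alg M s) := Alg.hom_ext fun i => by
    simp [scale_x, smul_smul, mul_comm d c, hcd]
  exact DFunLike.congr_fun this a

theorem qRadius_zero : qRadius M s 0 = ∑ j, qRho M s j.rev • (x M s j * x M s j.rev) := by
  simp [qRadius]

theorem scale_qRadius (c : ℂ) : scale h c (qRadius M s 0) = c ^ 2 • qRadius M s 0 := by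
  rw [qRadius_zero, map_sum, Finset.smul_sum]
  refine Finset.sum_congr rfl fun j _ => ?_
  rw [map_smul, map_mul, scale_x, scale_x, smul_mul_smul_comm, smul_comm, sq]

theorem incl_qRadius : incl h (qRadius M s 0) = qRadius (M + 2) s 1 := by
  have e : (Finset.univ.filter fun i : Fin (M + 2) => 1 ≤ (i : ℕ) ∧ 1 ≤ (i.rev : ℕ)) =
      Finset.univ.filter fun i => 0 < i ∧ i < Fin.rev 0 := by
    ext i
    simp only [Finset.mem_filter, Finset.mem_univ, true_and, Fin.lt_def, Fin.val_rev, Fin.val_zero]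
    omega
  rw [qRadius_zero, map_sum, qRadius, e, sum_between_zero]
  refine Finset.sum_congr rfl fun j _ => ?_
  rw [map_smul, map_mul, incl_x, incl_x, rev_sh, qRho_sh]

/-! ### The first and the last coordinate -/

/-- The denominator of `lam` at the first index. -/
noncomputable def den (M : ℕ) (s : ℂ) : ℂ :=
  qRho (M + 2) s 0 * (s ^ 2)⁻¹ + (qRho (M + 2) s 0)⁻¹ * s ^ 2

include h in
theorem den_ne : den M s ≠ 0 := h.denom_ne 0 zero_lt_rev

theorem lam_zero : lam (M + 2) s 0 = (s ^ 2 - (s ^ 2)⁻¹) / den M s := rfl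

include h in
theorem lam_zero_ne : lam (M + 2) s 0 ≠ 0 := div_ne_zero h.q_ne (den_ne h)

/-- The coefficient `q ^ ρ_1 + q ^ (-ρ_1)` of `x_1 x_{1'}` in `Q`. -/
noncomputable def bet (M : ℕ) (s : ℂ) : ℂ := qRho (M + 2) s 0 + (qRho (M + 2) s 0)⁻¹

include h in
theorem bet_ne : bet M s ≠ 0 := by
  have h0 := h.ne_zero
  have e : qRho (M + 2) s 0 = s ^ M := by
    rw [qRho, twoRho, if_pos zero_lt_rev, ← zpow_natCast]
    congr 1
    simp
  rw [bet, e]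
  intro h1
  have hs : s ^ M ≠ 0 := pow_ne_zero _ h0
  have h2 : (s ^ 2) ^ M = -1 := by
    field_simp at h1
    rw [← pow_mul, mul_comm 2 M, pow_mul]
    linear_combination h1
  rcases Nat.eq_zero_or_pos M with rfl | hM
  · norm_num at h2
  · exact h.not_root (M + M) (by omega) (by rw [pow_add, h2]; norm_num)

theorem first_incl (b : Alg M s) :
    x (M + 2) s 0 * incl h b = incl h (scale h (s ^ 2) b) * x (M + 2) s 0 := by
  induction b using Alg.induct with
  | hc c =>
    rw [AlgHom.commutes, AlgHom.commutes, AlgHom.commutes]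
    exact (Algebra.commutes c _).symm
  | hx i =>
    rw [incl_x, scale_x, map_smul, incl_x, smul_mul_assoc]
    refine (sat_x h).comm _ _ ?_ ?_
    · rw [Fin.lt_def, sh_val]; simp
    · rw [rev_sh]; exact (sh_ne_zero _).symm
  | hmul a b ha hb => rw [map_mul, ← mul_assoc, ha, mul_assoc, hb, map_mul, map_mul, mul_assoc]
  | hadd a b ha hb => rw [map_add, mul_add, ha, hb, map_add, map_add, add_mul]

theorem incl_last (b : Alg M s) : incl h b * x (M + 2) s (Fin.rev 0) =
    x (M + 2) s (Fin.rev 0) * incl h (scale h (s ^ 2) b) := by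
  induction b using Alg.induct with
  | hc c =>
    rw [AlgHom.commutes, AlgHom.commutes, AlgHom.commutes]
    exact Algebra.commutes c _
  | hx i =>
    rw [incl_x, scale_x, map_smul, incl_x, mul_smul_comm]
    refine (sat_x h).comm _ _ ?_ ?_
    · rw [Fin.lt_def, sh_val, Fin.val_rev, Fin.val_zero]; omega
    · rw [Fin.rev_rev]; exact sh_ne_zero _
  | hmul a b ha hb => rw [map_mul, mul_assoc, hb, ← mul_assoc, ha, map_mul, map_mul, mul_assoc]
  | hadd a b ha hb => rw [map_add, add_mul, ha, hb, map_add, map_add, mul_add]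

theorem last_incl (b : Alg M s) : x (M + 2) s (Fin.rev 0) * incl h b =
    incl h (scale h (s ^ 2)⁻¹ b) * x (M + 2) s (Fin.rev 0) := by
  rw [incl_last, scale_scale h _ _ (mul_inv_cancel₀ (pow_ne_zero 2 h.ne_zero))]

theorem incl_first (b : Alg M s) : incl h b * x (M + 2) s 0 =
    x (M + 2) s 0 * incl h (scale h (s ^ 2)⁻¹ b) := by
  rw [first_incl, scale_scale h _ _ (mul_inv_cancel₀ (pow_ne_zero 2 h.ne_zero))]

theorem last_first : x (M + 2) s (Fin.rev 0) * x (M + 2) s 0 =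
    x (M + 2) s 0 * x (M + 2) s (Fin.rev 0) + lam (M + 2) s 0 • incl h (qRadius M s 0) := by
  have := (sat_x (N := M + 2) h).radial 0 zero_lt_rev
  rw [sub_eq_iff_eq_add', sum_between_zero] at this
  rw [this, qRadius_zero, map_sum]
  congr 2
  refine Finset.sum_congr rfl fun j _ => ?_
  rw [map_smul, map_mul, incl_x, incl_x, rev_sh, qRho_sh]

/-- `x_1 x_{1'}` plus the multiple of `Q_2` that makes it proportional to `Q`. -/
noncomputable def radial : Alg (M + 2) s :=
  x (M + 2) s 0 * x (M + 2) s (Fin.rev 0) + (s ^ 2 / den M s) • incl h (qRadius M s 0)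

/-- With `x_{1'} x_1` expressed by `x_1 x_{1'}` and `Q_2`, the element `Q` is a nonzero multiple
of `radial`. -/
theorem qRadius_eq : qRadius (M + 2) s 0 = bet M s • radial h := by
  have hd := den_ne h (M := M)
  have h0 := h.ne_zero
  have hr : qRho (M + 2) s 0 ≠ 0 := zpow_ne_zero _ h0
  have e : qRadius (M + 2) s 0 = (qRho (M + 2) s 0)⁻¹ •
      (x (M + 2) s 0 * x (M + 2) s (Fin.rev 0)) + incl h (qRadius M s 0) +
      qRho (M + 2) s 0 • (x (M + 2) s (Fin.rev 0) * x (M + 2) s 0) := by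
    rw [qRadius_zero, sum_sh, Fin.rev_rev, qRho_rev, qRadius_zero, map_sum]
    congr 2
    refine Finset.sum_congr rfl fun j _ => ?_
    rw [map_smul, map_mul, incl_x, incl_x, rev_sh, qRho_sh]
  rw [e, last_first h, radial, lam_zero, bet]
  have hd' := hd
  rw [den] at hd' ⊢
  match_scalars
  · ring
  · field_simp
    have hd2 : qRho (M + 2) s 0 ^ 2 + s ^ 4 ≠ 0 := fun e => hd' (by field_simp; rw [e, mul_zero])
    field_simp
    ring

end Shift

/-- `Q` is central: by induction `Q_2` commutes with the inner coordinates, and `x_1` and `x_{1'}`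
are dealt with by their commutator. -/
theorem qRadius_comm_x {s : ℂ} (h : Generic s) (M : ℕ) :
    ∀ i, Commute (qRadius M s 0) (x M s i) := by
  induction M using Nat.twoStepInduction with
  | zero => exact fun i => i.elim0
  | one =>
    intro i
    rw [qRadius_zero, Fin.sum_univ_one, Subsingleton.elim i 0,
      Subsingleton.elim (Fin.rev (0 : Fin 1)) 0]
    exact (((Commute.refl _).mul_left (Commute.refl _))).smul_left _
  | more M ih _ =>
    have h0 := h.ne_zero
    have hd := den_ne h (M := M)
    have hQ : ∀ a, Commute (incl h (qRadius M s 0)) (incl h (x M s a)) := fun a =>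
      (ih a).map (incl h)
    have e1 := first_incl h (qRadius M s 0)
    have e2 := incl_last h (qRadius M s 0)
    rw [scale_qRadius, map_smul, smul_mul_assoc] at e1
    rw [scale_qRadius, map_smul, mul_smul_comm] at e2
    intro i
    rw [qRadius_eq h]
    refine Commute.smul_left ?_ _
    rcases fin_cases_sh i with rfl | ⟨j, rfl⟩ | rfl
    · rw [Commute, SemiconjBy, radial, add_mul, mul_add, mul_assoc, last_first h, mul_add]
      simp only [smul_mul_assoc, mul_smul_comm, e1, smul_smul]
      rw [lam_zero]
      match_scalars
      · ring
      · field_simp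
        ring
    · rw [radial]
      refine Commute.add_left ?_ ((incl_x h j ▸ hQ j).smul_left _)
      have f1 := first_incl h (x M s j)
      have f2 := incl_last h (x M s j)
      rw [scale_x, map_smul, incl_x, smul_mul_assoc] at f1
      rw [scale_x, map_smul, incl_x, mul_smul_comm] at f2
      have f3 : x (M + 2) s (Fin.rev 0) * x (M + 2) s (sh j) =
          (s ^ 2)⁻¹ • (x (M + 2) s (sh j) * x (M + 2) s (Fin.rev 0)) := by
        rw [f2, smul_smul, inv_mul_cancel₀ (pow_ne_zero 2 h0), one_smul]
      rw [Commute, SemiconjBy, mul_assoc, f3, mul_smul_comm, ← mul_assoc, f1, smul_mul_assoc,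
        smul_smul, inv_mul_cancel₀ (pow_ne_zero 2 h0), one_smul, mul_assoc]
    · have e3 : x (M + 2) s (Fin.rev 0) * incl h (qRadius M s 0) =
          ((s ^ 2) ^ 2)⁻¹ • (incl h (qRadius M s 0) * x (M + 2) s (Fin.rev 0)) := by
        rw [e2, smul_smul, inv_mul_cancel₀ (pow_ne_zero 2 (pow_ne_zero 2 h0)), one_smul]
      rw [Commute, SemiconjBy, radial, add_mul, mul_add, ← mul_assoc, last_first h, add_mul]
      simp only [smul_mul_assoc, mul_smul_comm, e3, smul_smul]
      rw [lam_zero]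
      match_scalars
      · ring
      · field_simp
        ring

theorem qRadius_comm {s : ℂ} (h : Generic s) {M : ℕ} (a : Alg M s) :
    Commute (qRadius M s 0) a := by
  induction a using Alg.induct with
  | hc c => exact (Algebra.commutes c _).symm
  | hx i => exact qRadius_comm_x h M i
  | hmul a b ha hb => exact ha.mul_right hb
  | hadd a b ha hb => exact ha.add_right hb

/-! ### Freeness over the subalgebra of the inner coordinates -/

section Model

variable {M : ℕ} {s : ℂ} (h : Generic s)

/-- The number `1 + q ^ 2 + ⋯ + q ^ (2 (k - 1))`, for `q = s ^ 2`. -/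
noncomputable def geom (s : ℂ) (k : ℕ) : ℂ := ∑ i ∈ Finset.range k, ((s ^ 2) ^ 2) ^ i

theorem geom_zero : geom s 0 = 0 := Finset.sum_range_zero _

theorem geom_succ (k : ℕ) : geom s (k + 1) = geom s k * (s ^ 2) ^ 2 + 1 := by
  rw [geom, Finset.sum_range_succ', geom, Finset.sum_mul]
  simp [pow_succ]

/-- Moving `x_{1'}` past a power of `x_1`. The exponent `k - 1` is harmless at `k = 0`, where
`geom s 0 = 0`. -/
theorem last_first_pow (k : ℕ) : x (M + 2) s (Fin.rev 0) * x (M + 2) s 0 ^ k =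
    x (M + 2) s 0 ^ k * x (M + 2) s (Fin.rev 0) +
      (lam (M + 2) s 0 * geom s k) • (incl h (qRadius M s 0) * x (M + 2) s 0 ^ (k - 1)) := by
  have e1 := first_incl h (qRadius M s 0)
  rw [scale_qRadius, map_smul, smul_mul_assoc] at e1
  induction k with
  | zero => simp [geom_zero]
  | succ k ih =>
    rw [pow_succ', ← mul_assoc, last_first h, add_mul, mul_assoc, ih, mul_add, geom_succ,
      Nat.add_sub_cancel, mul_smul_comm, ← mul_assoc (x (M + 2) s 0) (incl h _), e1]
    rcases k with _ | k
    · simp [geom_zero]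
    · rw [Nat.add_sub_cancel, smul_mul_assoc, mul_assoc (incl h _), ← pow_succ', smul_mul_assoc,
        ← mul_assoc (x (M + 2) s 0)]
      module

/-- The linear map `⨁ 𝒜 → 𝒜` with values in dimension `M + 2` that maps `b` in the component
`(k, l)` to `b x_1 ^ k x_{1'} ^ l`. -/
noncomputable def assemble : (ℕ × ℕ →₀ Alg M s) →ₗ[ℂ] Alg (M + 2) s :=
  Finsupp.lsum ℂ fun kl => (LinearMap.mulRight ℂ
    (x (M + 2) s 0 ^ kl.1 * x (M + 2) s (Fin.rev 0) ^ kl.2)).comp (incl h).toLinearMap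

theorem assemble_single (kl : ℕ × ℕ) (b : Alg M s) : assemble h (Finsupp.single kl b) =
    incl h b * (x (M + 2) s 0 ^ kl.1 * x (M + 2) s (Fin.rev 0) ^ kl.2) := by
  rw [assemble, Finsupp.lsum_single]; rfl

/-- The operator on `⨁ 𝒜` that corresponds to the left multiplication by `x_1`. -/
noncomputable def modelFirst : Module.End ℂ (ℕ × ℕ →₀ Alg M s) :=
  Finsupp.lsum ℂ fun kl =>
    (Finsupp.lsingle (kl.1 + 1, kl.2)).comp (scale h (s ^ 2)).toLinearMap

theorem modelFirst_single (kl : ℕ × ℕ) (b : Alg M s) :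
    modelFirst h (Finsupp.single kl b) =
      Finsupp.single (kl.1 + 1, kl.2) (scale h (s ^ 2) b) := by
  simp [modelFirst]

/-- The operator on `⨁ 𝒜` that corresponds to the left multiplication by `x_{1'}`. At `kl.1 = 0` the
second summand vanishes, since `geom s 0 = 0`. -/
noncomputable def modelLast : Module.End ℂ (ℕ × ℕ →₀ Alg M s) :=
  Finsupp.lsum ℂ fun kl =>
    ((Finsupp.lsingle (kl.1, kl.2 + 1)) +
      (lam (M + 2) s 0 * geom s kl.1) • (Finsupp.lsingle (kl.1 - 1, kl.2)).comp
        (LinearMap.mulRight ℂ (qRadius M s 0))).comp (scale h (s ^ 2)⁻¹).toLinearMap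

theorem modelLast_single (kl : ℕ × ℕ) (b : Alg M s) :
    modelLast h (Finsupp.single kl b) =
      Finsupp.single (kl.1, kl.2 + 1) (scale h (s ^ 2)⁻¹ b) +
      (lam (M + 2) s 0 * geom s kl.1) •
        Finsupp.single (kl.1 - 1, kl.2) (scale h (s ^ 2)⁻¹ b * qRadius M s 0) := by
  simp [modelLast]

/-- The operator on `⨁ 𝒜` that corresponds to the left multiplication by an inner element. -/
noncomputable def modelInner : Alg M s →ₐ[ℂ] Module.End ℂ (ℕ × ℕ →₀ Alg M s) :=
  Algebra.lsmul ℂ ℂ (ℕ × ℕ →₀ Alg M s)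

theorem modelInner_single (a : Alg M s) (kl : ℕ × ℕ) (b : Alg M s) :
    modelInner a (Finsupp.single kl b) = Finsupp.single kl (a * b) := by
  simp [modelInner, Finsupp.smul_single]

/-- The operators that correspond to the left multiplications by the coordinates. -/
noncomputable def modelX (i : Fin (M + 2)) : Module.End ℂ (ℕ × ℕ →₀ Alg M s) :=
  if hi : i = 0 then modelFirst h
  else if hi' : i = Fin.rev 0 then modelLast h
  else modelInner (x M s ⟨i - 1, by
    have := i.2
    rw [Fin.ext_iff, Fin.val_zero] at hi
    rw [Fin.ext_iff, Fin.val_rev, Fin.val_zero] at hi'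
    omega⟩)

theorem modelX_first : modelX (M := M) h 0 = modelFirst h := dif_pos rfl

theorem modelX_last : modelX (M := M) h (Fin.rev 0) = modelLast h := by
  rw [modelX, dif_neg zero_ne_rev.symm, dif_pos rfl]

theorem modelX_sh (j : Fin M) : modelX h (sh j) = modelInner (x M s j) := by
  rw [modelX, dif_neg (sh_ne_zero j), dif_neg (sh_ne_rev_zero j)]
  rfl

/-- The model operators satisfy the defining relations; the relation between the first and the last
one uses that `Q` is central. -/
theorem modelX_sat : Sat (M + 2) s (modelX (M := M) h) where
  comm i j hij hne := by
    have h0 : s ^ 2 ≠ 0 := pow_ne_zero 2 h.ne_zero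
    rcases fin_cases_sh i with rfl | ⟨a, rfl⟩ | rfl
    · rcases fin_cases_sh j with rfl | ⟨b, rfl⟩ | rfl
      · exact absurd hij (lt_irrefl _)
      · rw [modelX_first, modelX_sh]
        refine Finsupp.lhom_ext fun kl b => ?_
        simp only [Module.End.mul_apply, LinearMap.smul_apply, modelFirst_single,
          modelInner_single, map_mul, scale_x, smul_mul_assoc, Finsupp.smul_single]
      · exact absurd (Fin.rev_rev _).symm hne
    · rcases fin_cases_sh j with rfl | ⟨b, rfl⟩ | rfl
      · exact absurd hij (Fin.not_lt_zero _)
      · rw [modelX_sh, modelX_sh, ← map_mul, (sat_x h).comm a b (sh_lt.mp hij)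
          (fun e => hne (by rw [e, rev_sh])), map_smul, map_mul]
      · rw [modelX_last, modelX_sh]
        refine Finsupp.lhom_ext fun kl b => ?_
        simp only [Module.End.mul_apply, LinearMap.smul_apply, modelLast_single, map_add,
          map_smul, modelInner_single, map_mul, scale_x, smul_mul_assoc, ← Finsupp.smul_single,
          smul_add, smul_comm (s ^ 2) _ _, mul_assoc]
        simp only [inv_smul_smul₀ h0]
    · have := j.2
      rw [Fin.lt_def, Fin.val_rev, Fin.val_zero] at hij
      omega
  radial i hi := by
    have h0 : s ^ 2 ≠ 0 := pow_ne_zero 2 h.ne_zero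
    rcases fin_cases_sh i with rfl | ⟨a, rfl⟩ | rfl
    · rw [sum_between_zero]
      have e : ∑ j : Fin M, qRho (M + 2) s (sh j).rev • (modelX h (sh j) * modelX h (sh j).rev) =
          modelInner (qRadius M s 0) := by
        rw [qRadius_zero, map_sum]
        refine Finset.sum_congr rfl fun j _ => ?_
        rw [map_smul, map_mul, rev_sh, modelX_sh, modelX_sh, qRho_sh]
      rw [e, modelX_first, modelX_last]
      refine Finsupp.lhom_ext fun kl b => ?_
      have hQ : qRadius M s 0 * b = b * qRadius M s 0 := qRadius_comm h b
      simp only [LinearMap.sub_apply, Module.End.mul_apply, LinearMap.smul_apply,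
        modelLast_single, modelFirst_single, modelInner_single, map_add, map_smul, map_mul,
        scale_scale h _ _ (mul_inv_cancel₀ h0), scale_scale h _ _ (inv_mul_cancel₀ h0),
        scale_qRadius, Nat.add_sub_cancel, geom_succ, hQ, mul_smul_comm]
      obtain ⟨k, l⟩ := kl
      rcases Nat.eq_zero_or_pos k with rfl | hk
      · simp [geom_zero]
      · rw [Nat.sub_add_cancel hk]
        simp only [← Finsupp.smul_single]
        module
    · rw [rev_sh] at hi
      rw [sum_between_sh, rev_sh, lam_sh]
      have := congrArg modelInner ((sat_x h).radial a (sh_lt.mp hi))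
      simp only [rev_sh, modelX_sh, qRho_sh]
      simpa only [map_sub, map_mul, map_smul, map_sum] using this
    · rw [Fin.rev_rev] at hi
      exact absurd hi (Fin.not_lt_zero _)

/-- The representation of `𝒜` on `⨁ 𝒜` that `assemble` identifies with the left regular one. -/
noncomputable def model : Alg (M + 2) s →ₐ[ℂ] Module.End ℂ (ℕ × ℕ →₀ Alg M s) :=
  lift h (modelX h) (modelX_sat h)

theorem model_incl (b : Alg M s) : model h (incl h b) = modelInner b := by
  have : (model (M := M) h).comp (incl h) = modelInner := by
    refine Alg.hom_ext (B := Module.End ℂ (ℕ × ℕ →₀ Alg M s)) fun i => ?_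
    rw [AlgHom.comp_apply, incl_x h, model, lift_x, modelX_sh]
  exact DFunLike.congr_fun this b

/-- The vacuum vector `1` in the component `(0, 0)` recovers the coordinates of an element. -/
theorem model_assemble (f : ℕ × ℕ →₀ Alg M s) :
    model h (assemble h f) (Finsupp.single (0, 0) 1) = f := by
  have h2 : ∀ l, (modelLast h ^ l) (Finsupp.single (0, 0) (1 : Alg M s)) =
      Finsupp.single (0, l) 1 := by
    intro l
    induction l with
    | zero => simp
    | succ l ih => rw [pow_succ', Module.End.mul_apply, ih, modelLast_single]; simp [geom_zero]
  have h1 : ∀ k l, (modelFirst h ^ k) (Finsupp.single (0, l) (1 : Alg M s)) =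
      Finsupp.single (k, l) 1 := by
    intro k l
    induction k with
    | zero => simp
    | succ k ih => rw [pow_succ', Module.End.mul_apply, ih, modelFirst_single]; simp
  have e0 : model (M := M) h (x (M + 2) s 0) = modelFirst h := by
    rw [model, lift_x, modelX_first]
  have e1 : model (M := M) h (x (M + 2) s (Fin.rev 0)) = modelLast h := by
    rw [model, lift_x, modelX_last]
  induction f using Finsupp.induction_linear with
  | zero => simp
  | add f g hf hg => rw [map_add, map_add, LinearMap.add_apply, hf, hg]
  | single kl b =>
    rw [assemble_single, map_mul, map_mul, map_pow, map_pow, e0, e1, model_incl,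
      Module.End.mul_apply, Module.End.mul_apply, h2, h1, modelInner_single, mul_one]

theorem assemble_injective : Function.Injective (assemble (M := M) h) :=
  fun f g hfg => by rw [← model_assemble h f, hfg, model_assemble]

theorem first_assemble (f : ℕ × ℕ →₀ Alg M s) :
    x (M + 2) s 0 * assemble h f = assemble h (modelFirst h f) := by
  induction f using Finsupp.induction_linear with
  | zero => simp
  | add f g hf hg => rw [map_add, mul_add, hf, hg, map_add, map_add]
  | single kl b =>
    rw [modelFirst_single, assemble_single, assemble_single, ← mul_assoc, first_incl h,
      pow_succ' (x (M + 2) s 0), mul_assoc, mul_assoc]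

theorem last_assemble (f : ℕ × ℕ →₀ Alg M s) :
    x (M + 2) s (Fin.rev 0) * assemble h f = assemble h (modelLast h f) := by
  induction f using Finsupp.induction_linear with
  | zero => simp
  | add f g hf hg => rw [map_add, mul_add, hf, hg, map_add, map_add]
  | single kl b =>
    rw [modelLast_single, map_add, map_smul, assemble_single, assemble_single, assemble_single,
      ← mul_assoc, last_incl h, mul_assoc, ← mul_assoc (x (M + 2) s (Fin.rev 0)),
      last_first_pow h, add_mul, mul_add, mul_assoc (_ ^ _), ← pow_succ', smul_mul_assoc,
      mul_smul_comm, map_mul]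
    simp only [mul_assoc]

theorem incl_assemble (b : Alg M s) (f : ℕ × ℕ →₀ Alg M s) :
    incl h b * assemble h f = assemble h (modelInner b f) := by
  induction f using Finsupp.induction_linear with
  | zero => simp
  | add f g hf hg => rw [map_add, mul_add, hf, hg, map_add, map_add]
  | single kl c =>
    rw [modelInner_single, assemble_single, assemble_single, map_mul, mul_assoc]

/-- The image of `assemble` is a left ideal that contains `1`. -/
theorem assemble_surjective : Function.Surjective (assemble (M := M) h) := by
  suffices H : ∀ a : Alg (M + 2) s, ∀ f, ∃ g, a * assemble h f = assemble h g by
    intro a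
    obtain ⟨g, hg⟩ := H a (Finsupp.single (0, 0) 1)
    refine ⟨g, ?_⟩
    rw [← hg, assemble_single]
    simp
  intro a
  induction a using Alg.induct with
  | hc c =>
    intro f
    exact ⟨c • f, by rw [map_smul, Algebra.smul_def]⟩
  | hx i =>
    intro f
    rcases fin_cases_sh i with rfl | ⟨j, rfl⟩ | rfl
    · exact ⟨_, first_assemble h f⟩
    · exact ⟨_, by rw [← incl_x h, incl_assemble]⟩
    · exact ⟨_, last_assemble h f⟩
  | hmul a b ha hb =>
    intro f
    obtain ⟨g, hg⟩ := hb f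
    obtain ⟨k, hk⟩ := ha g
    exact ⟨k, by rw [mul_assoc, hg, hk]⟩
  | hadd a b ha hb =>
    intro f
    obtain ⟨g, hg⟩ := ha f
    obtain ⟨k, hk⟩ := hb f
    exact ⟨g + k, by rw [add_mul, hg, hk, map_add]⟩

/-- A linear operator that permutes the components `(k, l)` injectively can be evaluated component
by component. -/
theorem component_eq_zero (L : Module.End ℂ (Alg (M + 2) s)) (g : ℕ × ℕ → ℕ × ℕ)
    (hg : Function.Injective g) (L' : ℕ × ℕ → Module.End ℂ (Alg M s))
    (hL : ∀ kl b, L (assemble h (Finsupp.single kl b)) =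
      assemble h (Finsupp.single (g kl) (L' kl b)))
    (f : ℕ × ℕ →₀ Alg M s) (hf : L (assemble h f) = 0) (kl : ℕ × ℕ) : L' kl (f kl) = 0 := by
  let D : (ℕ × ℕ →₀ Alg M s) →ₗ[ℂ] (ℕ × ℕ →₀ Alg M s) :=
    Finsupp.lsum ℂ fun kl => (Finsupp.lsingle (g kl)).comp (L' kl)
  have hDs : ∀ kl b, D (Finsupp.single kl b) = Finsupp.single (g kl) (L' kl b) := by
    intro kl b
    simp [D]
  have hD : ∀ f, L (assemble h f) = assemble h (D f) := by
    intro f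
    induction f using Finsupp.induction_linear with
    | zero => simp
    | add f g hf hg => simp only [map_add, hf, hg]
    | single kl b => rw [hL, hDs]
  have hval : ∀ f, D f (g kl) = L' kl (f kl) := by
    intro f
    induction f using Finsupp.induction_linear with
    | zero => simp
    | add f g hf hg => simp only [map_add, Finsupp.add_apply, hf, hg]
    | single a b =>
      rw [hDs]
      by_cases ha : a = kl
      · rw [ha, Finsupp.single_eq_same, Finsupp.single_eq_same]
      · rw [Finsupp.single_eq_of_ne (fun e => ha (hg e).symm),
          Finsupp.single_eq_of_ne (Ne.symm ha), map_zero]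
  rw [hD] at hf
  rw [← hval, assemble_injective h (hf.trans (map_zero _).symm), Finsupp.zero_apply]

include h in
theorem first_mul_injective (a : Alg (M + 2) s) (ha : x (M + 2) s 0 * a = 0) : a = 0 := by
  obtain ⟨f, rfl⟩ := assemble_surjective h a
  suffices hf : f = 0 by rw [hf, map_zero]
  ext kl
  have := component_eq_zero h (LinearMap.mulLeft ℂ (x (M + 2) s 0)) (fun kl => (kl.1 + 1, kl.2))
    (fun a b hab => by simpa [Prod.ext_iff] using hab) (fun _ => (scale h (s ^ 2)).toLinearMap)
    (fun kl b => by rw [LinearMap.mulLeft_apply, first_assemble, modelFirst_single]; rfl) f ha kl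
  have h2 := congrArg (scale h (s ^ 2)⁻¹) this
  rw [map_zero, AlgHom.toLinearMap_apply,
    scale_scale h _ _ (inv_mul_cancel₀ (pow_ne_zero 2 h.ne_zero))] at h2
  rw [h2, Finsupp.zero_apply]

include h in
theorem mul_last_injective (a : Alg (M + 2) s) (ha : a * x (M + 2) s (Fin.rev 0) = 0) : a = 0 := by
  obtain ⟨f, rfl⟩ := assemble_surjective h a
  suffices hf : f = 0 by rw [hf, map_zero]
  ext kl
  have := component_eq_zero h (LinearMap.mulRight ℂ (x (M + 2) s (Fin.rev 0)))
    (fun kl => (kl.1, kl.2 + 1))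
    (fun a b hab => by simpa [Prod.ext_iff] using hab) (fun _ => LinearMap.id)
    (fun kl b => by
      rw [LinearMap.mulRight_apply, assemble_single, assemble_single, pow_succ]
      simp only [mul_assoc, LinearMap.id_apply]) f ha kl
  simpa using this

/-- An inner element `w` on which `scale` acts by scalars is a right non-zero-divisor if it is one
among the inner elements. -/
theorem mul_incl_injective (w : Alg M s) (hw : scale h (s ^ 2) w = s ^ 2 • w)
    (hinj : ∀ b : Alg M s, b * w = 0 → b = 0) (a : Alg (M + 2) s) (ha : a * incl h w = 0) :
    a = 0 := by
  have h0 : s ^ 2 ≠ 0 := pow_ne_zero 2 h.ne_zero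
  obtain ⟨f, rfl⟩ := assemble_surjective h a
  suffices hf : f = 0 by rw [hf, map_zero]
  have e1 : x (M + 2) s 0 * incl h w = s ^ 2 • (incl h w * x (M + 2) s 0) := by
    rw [first_incl h, hw, map_smul, smul_mul_assoc]
  have e2 : x (M + 2) s (Fin.rev 0) * incl h w =
      (s ^ 2)⁻¹ • (incl h w * x (M + 2) s (Fin.rev 0)) := by
    rw [incl_last h, hw, map_smul, mul_smul_comm, smul_smul, inv_mul_cancel₀ h0, one_smul]
  have e1' : ∀ k, x (M + 2) s 0 ^ k * incl h w = (s ^ 2) ^ k • (incl h w * x (M + 2) s 0 ^ k) := by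
    intro k
    induction k with
    | zero => simp
    | succ k ih =>
      rw [pow_succ (x (M + 2) s 0), mul_assoc, e1, mul_smul_comm, ← mul_assoc, ih, smul_mul_assoc,
        smul_smul, mul_assoc, pow_succ' (s ^ 2)]
  have e2' : ∀ k, x (M + 2) s (Fin.rev 0) ^ k * incl h w =
      (s ^ 2)⁻¹ ^ k • (incl h w * x (M + 2) s (Fin.rev 0) ^ k) := by
    intro k
    induction k with
    | zero => simp
    | succ k ih =>
      rw [pow_succ (x (M + 2) s (Fin.rev 0)), mul_assoc, e2, mul_smul_comm, ← mul_assoc, ih,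
        smul_mul_assoc, smul_smul, mul_assoc, pow_succ' (s ^ 2)⁻¹]
  ext kl
  have := component_eq_zero h (LinearMap.mulRight ℂ (incl h w)) id Function.injective_id
    (fun kl => ((s ^ 2)⁻¹ ^ kl.2 * (s ^ 2) ^ kl.1) • LinearMap.mulRight ℂ w)
    (fun kl b => by
      rw [LinearMap.mulRight_apply, assemble_single, mul_assoc, mul_assoc, e2', mul_smul_comm,
        ← mul_assoc (_ ^ _), e1', smul_mul_assoc, smul_smul, mul_smul_comm, id,
        LinearMap.smul_apply, LinearMap.mulRight_apply, ← Finsupp.smul_single, map_smul,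
        assemble_single, map_mul]
      simp only [mul_assoc]) f ha kl
  rw [LinearMap.smul_apply, smul_eq_zero_iff_right
    (mul_ne_zero (pow_ne_zero _ (inv_ne_zero h0)) (pow_ne_zero _ h0))] at this
  exact hinj _ this

end Model

/-! ### The operators in the coordinates of the free module -/

section Ops

variable {M : ℕ} {s : ℂ} (h : Generic s)

theorem eOp_algebraMap (hN : 3 ≤ M) (i : Fin (M / 2)) (c : ℂ) :
    eOp h hN i (algebraMap ℂ (Alg M s) c) = 0 := by
  have := eOp_mul h hN i 1 1
  rw [mul_one, mul_one, show kOp h (root M i) 1 = 1 from map_one (torus h _), one_mul,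
    left_eq_add] at this
  rw [Algebra.algebraMap_eq_smul_one, map_smul, this, smul_zero]

theorem fOp_algebraMap (hN : 3 ≤ M) (i : Fin (M / 2)) (c : ℂ) :
    fOp h hN i (algebraMap ℂ (Alg M s) c) = 0 := by
  rw [f_eq, flip_algebraMap, eOp_algebraMap, map_zero, smul_zero]

theorem eOp_mul_zero (hN : 3 ≤ M) (i : Fin (M / 2)) (a b : Alg M s) (hb : eOp h hN i b = 0) :
    eOp h hN i (a * b) = eOp h hN i a * b := by
  rw [eOp_mul, hb, mul_zero, zero_add]

theorem eOp_pow_zero (hN : 3 ≤ M) (i : Fin (M / 2)) (a : Alg M s) (ha : eOp h hN i a = 0)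
    (k : ℕ) : eOp h hN i (a ^ k) = 0 := by
  induction k with
  | zero => simpa using eOp_algebraMap h hN i 1
  | succ k ih => rw [pow_succ, eOp_mul_zero h hN i _ _ ha, ih, zero_mul]

/-- The node `i` of the diagram in dimension `M` as a node of the diagram in dimension `M + 2`. -/
def nodeSucc {M : ℕ} (i : Fin (M / 2)) : Fin ((M + 2) / 2) := ⟨i + 1, by have := i.2; omega⟩

/-- The first node of the diagram. -/
def nodeZero (M : ℕ) : Fin ((M + 2) / 2) := ⟨0, by omega⟩

theorem node_cases_succ (i : Fin ((M + 2) / 2)) :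
    i = nodeZero M ∨ ∃ j : Fin (M / 2), i = nodeSucc j := by
  have := i.2
  by_cases h0 : (i : ℕ) = 0
  · exact Or.inl (Fin.ext h0)
  · exact Or.inr ⟨⟨i - 1, by omega⟩, Fin.ext (by simp only [nodeSucc]; omega)⟩

theorem isForkNode_nodeSucc (i : Fin (M / 2)) :
    IsForkNode (M + 2) (nodeSucc i) ↔ IsForkNode M i := by
  simp only [IsForkNode, nodeSucc]
  omega

theorem src_nodeSucc (i : Fin (M / 2)) : src (M + 2) (nodeSucc i) = sh (src M i) := rfl

theorem tgt_nodeSucc (hM : 3 ≤ M) (i : Fin (M / 2)) :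
    tgt (M + 2) (nodeSucc i) = sh (tgt M i) := by
  ext
  rw [sh_val, tgt_val, tgt_val]
  have hi : ((nodeSucc i : Fin ((M + 2) / 2)) : ℕ) = i + 1 := rfl
  by_cases hf : IsForkNode M i
  · rw [if_pos ((isForkNode_nodeSucc i).mpr hf), if_pos hf, hi]
    obtain ⟨h1, h2⟩ := hf
    omega
  · rw [if_neg (mt (isForkNode_nodeSucc i).mp hf), if_neg hf, hi]

theorem coef_nodeSucc (i : Fin (M / 2)) : coef (M + 2) s (nodeSucc i) = coef M s i := by
  rw [coef, coef, src_nodeSucc, rev_sh]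
  exact if_congr sh_injective.eq_iff rfl rfl

theorem pairing_root_sh (hM : 3 ≤ M) (i : Fin (M / 2)) (m : Fin M) :
    pairing (root (M + 2) (nodeSucc i)) (wt (M + 2) (sh m)) =
      pairing (root M i) (wt M m) := by
  rw [pairing_root_wt (by omega), pairing_root_wt hM, src_nodeSucc, tgt_nodeSucc hM, rev_sh,
    rev_sh]
  simp only [sh_val, Nat.add_right_cancel_iff]

theorem pairing_root_first (hM : 3 ≤ M) (i : Fin (M / 2)) :
    pairing (root (M + 2) (nodeSucc i)) (wt (M + 2) 0) = 0 := by
  rw [pairing_root_wt (by omega), src_nodeSucc, tgt_nodeSucc hM, rev_sh, rev_sh]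
  simp [sh_val]

theorem pairing_single (i : Fin (M / 2)) (c : ℤ) (w : Fin (M / 2) → ℤ) :
    pairing (Pi.single i c) w = c * w i := by
  simp [pairing, Pi.single_apply]

theorem wt_sh_nodeSucc (m : Fin M) (i : Fin (M / 2)) :
    wt (M + 2) (sh m) (nodeSucc i) = wt M m i := by
  rw [wt, wt, rev_sh]
  simp only [sh_val, nodeSucc, Nat.add_right_cancel_iff]

theorem wt_sh_nodeZero (m : Fin M) : wt (M + 2) (sh m) (nodeZero M) = 0 := by
  rw [wt, rev_sh]
  simp [sh_val, nodeZero]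

theorem wt_first_nodeSucc (i : Fin (M / 2)) : wt (M + 2) 0 (nodeSucc i) = 0 := by
  have := i.2
  rw [wt, Fin.val_rev, nodeSucc, Fin.val_zero, if_neg (by simp), if_neg (by simp only; omega)]
  rfl

theorem wt_first_nodeZero : wt (M + 2) 0 (nodeZero M) = 1 := by
  rw [wt, Fin.val_rev, nodeZero, Fin.val_zero, if_pos rfl, if_neg (by simp)]
  rfl

theorem torus_incl (v : Fin ((M + 2) / 2) → ℤ) (v' : Fin (M / 2) → ℤ)
    (hv : ∀ m, pairing v (wt (M + 2) (sh m)) = pairing v' (wt M m)) (b : Alg M s) :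
    torus h v (incl h b) = incl h (torus h v' b) := by
  have : (torus h v).comp (incl h) = (incl h).comp (torus h v') := Alg.hom_ext fun m => by
    rw [AlgHom.comp_apply, AlgHom.comp_apply, incl_x, torus_x, torus_x, hv, map_smul, incl_x]
  exact DFunLike.congr_fun this b

theorem torus_first (v : Fin ((M + 2) / 2) → ℤ) : torus h v (x (M + 2) s 0) =
    (s ^ 2) ^ pairing v (wt (M + 2) 0) • x (M + 2) s 0 := torus_x h v 0

theorem torus_last (v : Fin ((M + 2) / 2) → ℤ) : torus h v (x (M + 2) s (Fin.rev 0)) =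
    (s ^ 2) ^ (-pairing v (wt (M + 2) 0)) • x (M + 2) s (Fin.rev 0) := by
  rw [torus_x, pairing_wt_rev]

theorem torus_assemble (v : Fin ((M + 2) / 2) → ℤ) (v' : Fin (M / 2) → ℤ)
    (hv : ∀ m, pairing v (wt (M + 2) (sh m)) = pairing v' (wt M m)) (kl : ℕ × ℕ) (b : Alg M s) :
    torus h v (assemble h (Finsupp.single kl b)) = (s ^ 2) ^
      (pairing v (wt (M + 2) 0) * ((kl.1 : ℤ) - kl.2)) •
        assemble h (Finsupp.single kl (torus h v' b)) := by
  rw [assemble_single, assemble_single, map_mul, map_mul, map_pow, map_pow, torus_first,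
    torus_last, torus_incl h v v' hv, smul_pow, smul_pow, smul_mul_smul_comm, mul_smul_comm]
  congr 1
  rw [← zpow_natCast (_ ^ pairing _ _), ← zpow_natCast (_ ^ (-pairing _ _)), ← zpow_mul,
    ← zpow_mul, ← zpow_add₀ (pow_ne_zero 2 h.ne_zero)]
  congr 1
  ring

/-- The torus fixes `Q_2`, which is proportional to a commutator of `x_1` and `x_{1'}`. -/
theorem torus_incl_qRadius (v : Fin ((M + 2) / 2) → ℤ) :
    torus h v (incl h (qRadius M s 0)) = incl h (qRadius M s 0) := by
  have e := last_first (M := M) h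
  have e2 := congrArg (torus h v) e
  have h1 : (s ^ 2) ^ (-pairing v (wt (M + 2) 0)) * (s ^ 2) ^ pairing v (wt (M + 2) 0) = 1 := by
    rw [← zpow_add₀ (pow_ne_zero 2 h.ne_zero), neg_add_cancel, zpow_zero]
  rw [map_add, map_mul, map_mul, map_smul, torus_first, torus_last, smul_mul_smul_comm,
    smul_mul_smul_comm, mul_comm ((s ^ 2) ^ pairing v (wt (M + 2) 0)), h1, one_smul, one_smul, e,
    add_right_inj] at e2
  exact (smul_right_injective _ (lam_zero_ne h) e2).symm

theorem eOp_incl (hM : 3 ≤ M) (hM' : 3 ≤ M + 2) (i : Fin (M / 2)) (b : Alg M s) :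
    eOp h hM' (nodeSucc i) (incl h b) = incl h (eOp h hM i b) := by
  have hk : ∀ a : Alg M s, kOp h (root (M + 2) (nodeSucc i)) (incl h a) =
      incl h (kOp h (root M i) a) := torus_incl h _ _ (pairing_root_sh hM i)
  induction b using Alg.induct with
  | hc c => rw [AlgHom.commutes, eOp_algebraMap, eOp_algebraMap, map_zero]
  | hx m =>
    rw [incl_x, eOp_x, eOp_x, eX, eX, src_nodeSucc, tgt_nodeSucc hM, rev_sh, rev_sh, coef_nodeSucc]
    simp only [sh_injective.eq_iff]
    split_ifs
    · rw [map_smul, incl_x]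
    · rw [map_neg, incl_x]
    · rw [map_zero]
  | hmul a b ha hb => rw [map_mul, eOp_mul, ha, hb, hk, eOp_mul, map_add, map_mul, map_mul]
  | hadd a b ha hb => simp only [map_add, ha, hb]

theorem eOp_first (hN : 3 ≤ M + 2) (i : Fin ((M + 2) / 2)) : eOp h hN i (x (M + 2) s 0) = 0 := by
  have p := pair_node h hN i
  have h1 : (0 : Fin (M + 2)) ≠ src (M + 2) i := by
    rw [ne_eq, Fin.ext_iff, src_val]; simp
  have h2 : (0 : Fin (M + 2)) ≠ (tgt (M + 2) i).rev := fun e => by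
    have := p.lt.trans p.ltr
    rw [← e] at this
    exact Fin.not_lt_zero _ this
  rw [eOp_x, eX, if_neg h1, if_neg h2]

theorem eOp_last (hM : 3 ≤ M) (hN : 3 ≤ M + 2) (i : Fin (M / 2)) :
    eOp h hN (nodeSucc i) (x (M + 2) s (Fin.rev 0)) = 0 := by
  rw [eOp_x, eX, src_nodeSucc, tgt_nodeSucc hM, rev_sh, if_neg (sh_ne_rev_zero _).symm,
    if_neg (sh_ne_rev_zero _).symm]

theorem eOp_assemble (hM : 3 ≤ M) (hN : 3 ≤ M + 2) (i : Fin (M / 2)) (kl : ℕ × ℕ) (b : Alg M s) :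
    eOp h hN (nodeSucc i) (assemble h (Finsupp.single kl b)) =
      assemble h (Finsupp.single kl (eOp h hM i b)) := by
  rw [assemble_single, assemble_single, eOp_mul_zero, eOp_incl h hM]
  rw [eOp_mul_zero _ _ _ _ _ (eOp_pow_zero _ _ _ _ (eOp_last h hM hN i) _),
    eOp_pow_zero _ _ _ _ (eOp_first h hN _), zero_mul]

theorem tgt_nodeZero (hM : 1 ≤ M) : tgt (M + 2) (nodeZero M) = 0 := by
  ext
  rw [tgt_val, if_neg]
  · rfl
  · rintro ⟨h1, h2⟩
    simp only [nodeZero] at h2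
    omega

theorem src_nodeZero : src (M + 3) (nodeZero (M + 1)) = sh 0 := rfl

theorem pairing_root_nodeZero (hM : 1 ≤ M) :
    pairing (root (M + 2) (nodeZero M)) (wt (M + 2) 0) = 1 := by
  have h1 := (src (M + 2) (nodeZero M)).val_rev
  have h2 : (src (M + 2) (nodeZero M) : ℕ) = 1 := rfl
  have h3 := (0 : Fin (M + 2)).val_rev
  rw [Fin.val_zero] at h3
  rw [pairing_root_wt (by omega), tgt_nodeZero hM, Fin.val_zero, if_pos rfl, if_neg (by omega),
    if_neg (by omega), if_neg (by omega)]
  rfl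

theorem eOp_nodeZero_last (hN : 3 ≤ M + 3) :
    eOp h hN (nodeZero (M + 1)) (x (M + 3) s (Fin.rev 0)) =
      -incl h (x (M + 1) s (Fin.rev 0)) := by
  rw [eOp_x, eX, src_nodeZero, if_neg (sh_ne_rev_zero _).symm, tgt_nodeZero (by omega), if_pos rfl,
    rev_sh, incl_x]

/-- `E_1 Q_2` is the commutator of `E_1 x_{1'} = -x_{2'}` with `x_1`, up to a factor. -/
theorem eOp_nodeZero_incl (hN : 3 ≤ M + 3) :
    eOp h hN (nodeZero (M + 1)) (incl h (qRadius (M + 1) s 0)) =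
      den (M + 1) s • (x (M + 3) s 0 * incl h (x (M + 1) s (Fin.rev 0))) := by
  have h0 : s ^ 2 ≠ 0 := pow_ne_zero 2 h.ne_zero
  have e := congrArg (eOp h hN (nodeZero (M + 1))) (last_first (M := M + 1) h)
  have e1 := first_incl h (x (M + 1) s (Fin.rev 0))
  rw [scale_x, map_smul, smul_mul_assoc] at e1
  rw [map_add, map_smul, eOp_mul, eOp_mul, eOp_first, mul_zero, zero_add, eOp_nodeZero_last,
    zero_mul, add_zero, kOp, AlgHom.toLinearMap_apply, torus_first,
    pairing_root_nodeZero (by omega), zpow_one, mul_neg, smul_mul_assoc, neg_mul, e1] at e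
  rw [e1]
  have hd := den_ne h (M := M + 1)
  rw [← sub_eq_iff_eq_add'] at e
  rw [← inv_smul_smul₀ (lam_zero_ne h (M := M + 1)) (eOp h hN _ _), ← e, lam_zero]
  have hq : s ^ 4 - 1 ≠ 0 := fun e => h.not_root 2 (by norm_num) (by linear_combination e)
  match_scalars
  field_simp
  ring

/-- `E_1` kills `Q`: its values on `x_1 x_{1'}` and on the multiple of `Q_2` in `radial` cancel. -/
theorem eOp_nodeZero_qRadius (hN : 3 ≤ M + 3) :
    eOp h hN (nodeZero (M + 1)) (qRadius (M + 3) s 0) = 0 := by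
  have hd := den_ne h (M := M + 1)
  rw [qRadius_eq h, map_smul, radial, map_add, map_smul, eOp_nodeZero_incl, eOp_mul, eOp_first,
    eOp_nodeZero_last, zero_mul, add_zero, kOp, AlgHom.toLinearMap_apply, torus_first,
    pairing_root_nodeZero (by omega), zpow_one, mul_neg, smul_mul_assoc]
  match_scalars
  field_simp
  ring

end Ops

/-! ### Triangular families -/

section Triangular

variable {ι V : Type} [AddCommGroup V] [Module ℂ V]

/-- A family `v` that is triangular in a linearly independent family `u`, with nonzero diagonal
entries, is linearly independent: in a relation, compare the coefficients of greatest height. -/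
theorem linearIndependent_of_triangular {u v : ι → V} {c : ι → ℂ} {ht : ι → ℕ}
    (hc : ∀ i, c i ≠ 0)
    (hv : ∀ i, v i - c i • u i ∈ Submodule.span ℂ (u '' {j | ht j < ht i}))
    (hu : LinearIndependent ℂ u) : LinearIndependent ℂ v := by
  have hw : ∀ i, ∃ w : ι →₀ ℂ, (∀ j, ¬ht j < ht i → w j = 0) ∧
      Finsupp.linearCombination ℂ u w = v i - c i • u i := by
    intro i
    obtain ⟨w, hw, hw'⟩ := (Finsupp.mem_span_image_iff_linearCombination ℂ).mp (hv i)
    refine ⟨w, fun j hj => ?_, hw'⟩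
    by_contra hne
    exact hj ((Finsupp.mem_supported ℂ w).mp hw (Finsupp.mem_support_iff.mpr hne))
  choose w hw hw' using hw
  rw [linearIndependent_iff]
  intro l hl
  have e : Finsupp.linearCombination ℂ u (l.sum fun i a => a • (Finsupp.single i (c i) + w i)) =
      0 := by
    rw [← hl, map_finsuppSum, Finsupp.linearCombination_apply]
    refine Finsupp.sum_congr fun i _ => ?_
    rw [map_smul, map_add, hw', Finsupp.linearCombination_single, add_sub_cancel]
  have e2 := linearIndependent_iff.mp hu _ e
  by_contra hne
  obtain ⟨i, hi, hmax⟩ := Finset.exists_max_image l.support ht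
    (Finsupp.support_nonempty_iff.mpr hne)
  have e3 := DFunLike.congr_fun e2 i
  rw [Finsupp.sum, Finsupp.finsetSum_apply, Finset.sum_eq_single i] at e3
  · simp only [Finsupp.smul_apply, Finsupp.add_apply, Finsupp.single_eq_same,
      hw i i (lt_irrefl _), add_zero, smul_eq_mul, Finsupp.zero_apply] at e3
    exact (Finsupp.mem_support_iff.mp hi) ((mul_eq_zero.mp e3).resolve_right (hc i))
  · intro j hj hji
    rw [Finsupp.smul_apply, Finsupp.add_apply, Finsupp.single_eq_of_ne hji.symm,
      hw j i (not_lt.mpr (hmax j hj)), add_zero, smul_zero]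
  · exact fun hn => absurd hi hn

theorem span_eq_of_triangular {u v : ι → V} {c : ι → ℂ} {ht : ι → ℕ}
    (hc : ∀ i, c i ≠ 0)
    (hv : ∀ i, v i - c i • u i ∈ Submodule.span ℂ (u '' {j | ht j < ht i})) :
    Submodule.span ℂ (Set.range v) = Submodule.span ℂ (Set.range u) := by
  apply le_antisymm
  · rw [Submodule.span_le]
    rintro _ ⟨i, rfl⟩
    have h1 := Submodule.span_mono (Set.image_subset_range u _) (hv i)
    have h2 := Submodule.add_mem _ h1 (Submodule.smul_mem _ (c i)
      (Submodule.subset_span (Set.mem_range_self i)))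
    rwa [sub_add_cancel] at h2
  · rw [Submodule.span_le]
    rintro _ ⟨i, rfl⟩
    induction hn : ht i using Nat.strong_induction_on generalizing i with
    | _ n ih =>
      have h1 : v i - c i • u i ∈ Submodule.span ℂ (Set.range v) := by
        refine (Submodule.span_le.mpr ?_) (hv i)
        rintro _ ⟨j, hj, rfl⟩
        exact ih (ht j) (hn ▸ hj) j rfl
      have h2 := Submodule.sub_mem _ (Submodule.subset_span (Set.mem_range_self i)) h1
      rw [sub_sub_cancel] at h2
      exact (Submodule.smul_mem_iff _ (hc i)).mp h2

/-- If `L` maps `u i` to a nonzero multiple of `u (g i)` up to terms of smaller height, then the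
iterates of `L` on the members `u (b i)` of height `0` are triangular in the `u i`. -/
theorem triangular_iterate {u : ι → V} {ht : ι → ℕ} (L : Module.End ℂ V) {g b : ι → ι}
    {c : ι → ℂ} (hg : ∀ i, ht (g i) = ht i + 1) (hc : ∀ i, c i ≠ 0)
    (hL : ∀ i, L (u i) - c i • u (g i) ∈ Submodule.span ℂ (u '' {j | ht j < ht i + 1}))
    (hb0 : ∀ i, ht (b i) = 0) (hb : ∀ i, g^[ht i] (b i) = i) :
    (LinearIndependent ℂ u → LinearIndependent ℂ fun i => (L ^ ht i) (u (b i))) ∧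
      Submodule.span ℂ (Set.range fun i => (L ^ ht i) (u (b i))) =
        Submodule.span ℂ (Set.range u) := by
  have hS : ∀ n, ∀ a ∈ Submodule.span ℂ (u '' {j | ht j < n}),
      L a ∈ Submodule.span ℂ (u '' {j | ht j < n + 1}) := by
    intro n a ha
    induction ha using Submodule.span_induction with
    | mem a ha =>
      obtain ⟨i, hi, rfl⟩ := ha
      simp only [Set.mem_ofPred_eq] at hi
      rw [← sub_add_cancel (L (u i)) (c i • u (g i))]
      refine Submodule.add_mem _ ?_ (Submodule.smul_mem _ _ (Submodule.subset_span
        ⟨g i, by simp only [Set.mem_ofPred_eq, hg]; omega, rfl⟩))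
      refine Submodule.span_mono (Set.image_mono fun j hj => ?_) (hL i)
      simp only [Set.mem_ofPred_eq] at hj ⊢
      omega
    | zero => rw [map_zero]; exact Submodule.zero_mem _
    | add a b _ _ ha hb => rw [map_add]; exact Submodule.add_mem _ ha hb
    | smul r a _ ha => rw [map_smul]; exact Submodule.smul_mem _ _ ha
  have hpow : ∀ m i, ht (g^[m] i) = ht i + m ∧ ∃ d : ℂ, d ≠ 0 ∧
      (L ^ m) (u i) - d • u (g^[m] i) ∈ Submodule.span ℂ (u '' {j | ht j < ht i + m}) := by
    intro m i
    induction m with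
    | zero => exact ⟨rfl, 1, one_ne_zero, by simp⟩
    | succ m ih =>
      obtain ⟨h1, d, hd, h2⟩ := ih
      rw [Function.iterate_succ_apply']
      refine ⟨by rw [hg, h1]; rfl, d * c (g^[m] i), mul_ne_zero hd (hc _), ?_⟩
      have h3 := hS _ _ h2
      have h4 := hL (g^[m] i)
      rw [h1] at h4
      have h5 := Submodule.add_mem _ h3 (Submodule.smul_mem _ d h4)
      rw [map_sub, map_smul, smul_sub, sub_add_sub_cancel, smul_smul] at h5
      rwa [pow_succ', Module.End.mul_apply]
  have key : ∀ i, ∃ d : ℂ, d ≠ 0 ∧ (L ^ ht i) (u (b i)) - d • u i ∈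
      Submodule.span ℂ (u '' {j | ht j < ht i}) := by
    intro i
    obtain ⟨-, d, hd, h2⟩ := hpow (ht i) (b i)
    rw [hb, hb0, zero_add] at h2
    exact ⟨d, hd, h2⟩
  choose d hd hd' using key
  exact ⟨linearIndependent_of_triangular hd hd', span_eq_of_triangular hd hd'⟩

end Triangular

/-! ### Powers of `Q` -/

open Polynomial in
/-- `𝒜` maps onto `ℂ[t]` such that `Q` goes to `t`, so that the powers of `Q` are linearly
independent. -/
theorem aeval_qRadius_injective {M : ℕ} {s : ℂ} (h : Generic s) :
    Function.Injective (aeval (R := ℂ) (qRadius (M + 2) s 0)) := by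
  let y : Fin (M + 2) → ℂ[X] := fun i =>
    if i = 0 then X else if i = Fin.rev 0 then C (bet M s)⁻¹ else 0
  have y0 : y 0 = X := if_pos rfl
  have y1 : y (Fin.rev 0) = C (bet M s)⁻¹ := (if_neg zero_ne_rev.symm).trans (if_pos rfl)
  have y2 : ∀ j : Fin M, y (sh j) = 0 := fun j =>
    (if_neg (sh_ne_zero j)).trans (if_neg (sh_ne_rev_zero j))
  have hy : Sat (M + 2) s y :=
    { comm := fun i j hij hne => by
        rcases fin_cases_sh i with rfl | ⟨a, rfl⟩ | rfl
        · rcases fin_cases_sh j with rfl | ⟨b, rfl⟩ | rfl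
          · exact absurd hij (lt_irrefl _)
          · rw [y2, mul_zero, zero_mul, smul_zero]
          · exact absurd (Fin.rev_rev _).symm hne
        · rw [y2, mul_zero, zero_mul, smul_zero]
        · have := j.2
          rw [Fin.lt_def, Fin.val_rev, Fin.val_zero] at hij
          omega
      radial := fun i hi => by
        rw [mul_comm, sub_self, Finset.sum_eq_zero, smul_zero]
        intro j hj
        simp only [Finset.mem_filter, Finset.mem_univ, true_and] at hj
        rcases fin_cases_sh j with rfl | ⟨b, rfl⟩ | rfl
        · exact absurd hj.1 (Fin.not_lt_zero _)
        · rw [y2, zero_mul, smul_zero]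
        · have h1 := hj.2
          have := i.2
          rw [Fin.lt_def, Fin.val_rev, Fin.val_rev, Fin.val_zero] at h1
          omega }
  let φ : Alg (M + 2) s →ₐ[ℂ] ℂ[X] := lift h y hy
  have e0 : φ (incl h (qRadius M s 0)) = 0 := by
    rw [qRadius_zero, map_sum, map_sum]
    refine Finset.sum_eq_zero fun j _ => ?_
    rw [map_smul, map_mul, map_smul, map_mul, incl_x, lift_x h y hy, y2, zero_mul, smul_zero]
  have e1 : φ (qRadius (M + 2) s 0) = X := by
    rw [qRadius_eq h, map_smul, radial, map_add, map_smul, e0, map_mul, lift_x h y hy,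
      lift_x h y hy, y0, y1, smul_zero, add_zero, mul_comm, ← smul_eq_C_mul, smul_smul,
      mul_inv_cancel₀ (bet_ne h), one_smul]
  intro p r hpr
  have e2 : ∀ p : ℂ[X], φ (aeval (qRadius (M + 2) s 0) p) = p := fun p => by
    rw [← aeval_algHom_apply, e1, aeval_X_left_apply]
  rw [← e2 p, hpr, e2]

open Polynomial in
/-- In dimension `1`, `𝒜` is the polynomial ring in one variable. -/
theorem aeval_x_injective {s : ℂ} (h : Generic s) :
    Function.Injective (aeval (R := ℂ) (x 1 s 0)) := by
  have hy : Sat 1 s (fun _ : Fin 1 => (X : ℂ[X])) :=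
    { comm := fun i j hij _ => absurd hij (by omega)
      radial := fun i hi => absurd hi (by omega) }
  let φ : Alg 1 s →ₐ[ℂ] ℂ[X] := lift h _ hy
  intro p r hpr
  have e2 : ∀ p : ℂ[X], φ (aeval (x 1 s 0) p) = p := fun p => by
    rw [← aeval_algHom_apply, lift_x h _ hy, aeval_X_left_apply]
  rw [← e2 p, hpr, e2]

theorem linearIndependent_pow_of_aeval_injective {A : Type} [Ring A] [Algebra ℂ A] {z : A}
    (hz : Function.Injective (Polynomial.aeval (R := ℂ) z)) :
    LinearIndependent ℂ (fun n : ℕ => z ^ n) := by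
  have := (Polynomial.basisMonomials ℂ).linearIndependent.map'
    (Polynomial.aeval (R := ℂ) z).toLinearMap (LinearMap.ker_eq_bot.mpr hz)
  have e : (fun n : ℕ => z ^ n) =
      (Polynomial.aeval (R := ℂ) z).toLinearMap ∘ Polynomial.basisMonomials ℂ := by
    funext n
    simp [Polynomial.aeval_monomial]
  rw [e]
  exact this

theorem adjoin_eq_span_pow {A : Type} [Ring A] [Algebra ℂ A] (z : A) :
    Subalgebra.toSubmodule (Algebra.adjoin ℂ {z}) =
      Submodule.span ℂ (Set.range fun n : ℕ => z ^ n) := by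
  rw [Algebra.adjoin_singleton_eq_range_aeval]
  apply le_antisymm
  · rintro _ ⟨p, rfl⟩
    change Polynomial.aeval z p ∈ _
    rw [Polynomial.aeval_eq_sum_range]
    exact Submodule.sum_mem _ fun i _ =>
      Submodule.smul_mem _ _ (Submodule.subset_span ⟨i, rfl⟩)
  · rw [Submodule.span_le]
    rintro _ ⟨n, rfl⟩
    exact ⟨Polynomial.X ^ n, by simp⟩

/-! ### Monomials in `Q` and in `Q_2` -/

section Families

variable {M : ℕ} {s : ℂ} (h : Generic s)

/-- The elements `z ^ j x_1 ^ k x_{1'} ^ l`, for an inner element `z`. -/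
noncomputable def mono (z : Alg M s) (i : (ℕ × ℕ) × ℕ) : Alg (M + 2) s :=
  assemble h (Finsupp.single i.1 (z ^ i.2))

theorem linearIndependent_mono {z : Alg M s} (hz : LinearIndependent ℂ (fun n : ℕ => z ^ n)) :
    LinearIndependent ℂ (mono h z) := by
  have h1 := Finsupp.linearIndependent_single (ι := ℕ × ℕ) (fun _ (n : ℕ) => z ^ n) (fun _ => hz)
  have h2 := h1.map' (assemble h) (LinearMap.ker_eq_bot.mpr (assemble_injective h))
  exact h2.comp (fun i : (ℕ × ℕ) × ℕ => (⟨i.1, i.2⟩ : Σ _ : ℕ × ℕ, ℕ))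
    fun a b hab => by simpa [Prod.ext_iff] using hab

theorem assemble_mem_span_mono {z : Alg M s} {f : ℕ × ℕ →₀ Alg M s}
    (hf : ∀ kl, f kl ∈ Submodule.span ℂ (Set.range fun n : ℕ => z ^ n)) :
    assemble h f ∈ Submodule.span ℂ (mono h z '' {i | f i.1 ≠ 0}) := by
  have e : assemble h f = f.sum fun kl b => assemble h (Finsupp.single kl b) := by
    rw [← map_finsuppSum, Finsupp.sum_single]
  rw [e]
  refine Submodule.sum_mem _ fun kl hkl => ?_
  have hm : Submodule.map (assemble h ∘ₗ Finsupp.lsingle kl)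
      (Submodule.span ℂ (Set.range fun n : ℕ => z ^ n)) ≤
        Submodule.span ℂ (mono h z '' {i | f i.1 ≠ 0}) := by
    rw [Submodule.map_span, Submodule.span_le]
    rintro _ ⟨_, ⟨n, rfl⟩, rfl⟩
    exact Submodule.subset_span ⟨(kl, n), Finsupp.mem_support_iff.mp hkl, rfl⟩
  exact hm ⟨f kl, hf kl, rfl⟩

theorem first_pow_incl_qRadius (k : ℕ) : x (M + 2) s 0 ^ k * incl h (qRadius M s 0) =
    ((s ^ 2) ^ 2) ^ k • (incl h (qRadius M s 0) * x (M + 2) s 0 ^ k) := by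
  have e1 := first_incl h (qRadius M s 0)
  rw [scale_qRadius, map_smul, smul_mul_assoc] at e1
  induction k with
  | zero => simp
  | succ k ih =>
    rw [pow_succ (x (M + 2) s 0), mul_assoc, e1, mul_smul_comm, ← mul_assoc, ih, smul_mul_assoc,
      smul_smul, mul_assoc, pow_succ' ((s ^ 2) ^ 2)]

/-- The multiplication by `Q` in the coordinates of the free module. -/
theorem qRadius_mul_mono {z : Alg M s} {e : ℕ} (hz : z ^ e = qRadius M s 0) (k l j : ℕ) :
    qRadius (M + 2) s 0 * mono h z ((k, l), j) = bet M s • mono h z ((k + 1, l + 1), j) +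
      (bet M s * (s ^ 2 / den M s * ((s ^ 2) ^ 2) ^ k)) • mono h z ((k, l), j + e) := by
  have hQ : ∀ a b, qRadius (M + 2) s 0 * (a * b) = a * (qRadius (M + 2) s 0 * b) := fun a b => by
    rw [← mul_assoc, qRadius_comm h a, mul_assoc]
  have e1 : x (M + 2) s 0 ^ k * (incl h (qRadius M s 0) * x (M + 2) s (Fin.rev 0) ^ l) =
      ((s ^ 2) ^ 2) ^ k • (incl h (qRadius M s 0) *
        (x (M + 2) s 0 ^ k * x (M + 2) s (Fin.rev 0) ^ l)) := by
    rw [← mul_assoc, first_pow_incl_qRadius, smul_mul_assoc, mul_assoc]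
  have e2 : x (M + 2) s 0 ^ k * (x (M + 2) s 0 * x (M + 2) s (Fin.rev 0) *
      x (M + 2) s (Fin.rev 0) ^ l) =
        x (M + 2) s 0 ^ (k + 1) * x (M + 2) s (Fin.rev 0) ^ (l + 1) := by
    rw [pow_succ, pow_succ' (x (M + 2) s (Fin.rev 0))]
    simp only [mul_assoc]
  simp only [mono, assemble_single]
  rw [hQ, hQ, qRadius_eq h, radial]
  simp only [mul_smul_comm, smul_mul_assoc, mul_add, add_mul, smul_add, e1, e2]
  simp only [← hz, pow_add _ j, map_mul, mul_assoc]
  module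

/-- The elements `Q ^ m x_1 ^ k x_{1'} ^ l` are triangular in the elements
`Q_2 ^ m x_1 ^ k x_{1'} ^ l`, with respect to `m`. -/
theorem triangular_qRadius :
    (LinearIndependent ℂ (mono h (qRadius M s 0)) → LinearIndependent ℂ fun i : (ℕ × ℕ) × ℕ =>
      qRadius (M + 2) s 0 ^ i.2 * (x (M + 2) s 0 ^ i.1.1 * x (M + 2) s (Fin.rev 0) ^ i.1.2)) ∧
    Submodule.span ℂ (Set.range fun i : (ℕ × ℕ) × ℕ => qRadius (M + 2) s 0 ^ i.2 *
      (x (M + 2) s 0 ^ i.1.1 * x (M + 2) s (Fin.rev 0) ^ i.1.2)) =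
        Submodule.span ℂ (Set.range (mono h (qRadius M s 0))) := by
  have h0 := h.ne_zero
  have key := triangular_iterate (u := mono h (qRadius M s 0)) (ht := Prod.snd)
    (LinearMap.mulLeft ℂ (qRadius (M + 2) s 0)) (g := fun i => (i.1, i.2 + 1))
    (b := fun i => (i.1, 0))
    (c := fun i => bet M s * (s ^ 2 / den M s * ((s ^ 2) ^ 2) ^ i.1.1))
    (fun _ => rfl)
    (fun _ => mul_ne_zero (bet_ne h) (mul_ne_zero (div_ne_zero (pow_ne_zero 2 h0) (den_ne h))
      (pow_ne_zero _ (pow_ne_zero 2 (pow_ne_zero 2 h0)))))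
    (fun i => by
      obtain ⟨⟨k, l⟩, j⟩ := i
      rw [LinearMap.mulLeft_apply, qRadius_mul_mono h (pow_one _), add_sub_cancel_right]
      exact Submodule.smul_mem _ _ (Submodule.subset_span ⟨_, Nat.lt_succ_self j, rfl⟩))
    (fun _ => rfl)
    (fun i => by
      obtain ⟨kl, j⟩ := i
      dsimp only
      induction j with
      | zero => rfl
      | succ j ih => rw [Function.iterate_succ_apply', ih])
  simpa only [LinearMap.pow_mulLeft, LinearMap.mulLeft_apply, mono, assemble_single, pow_zero,
    map_one, one_mul] using key

/-- The elements `Q ^ k z ^ j` are triangular in the elements `z ^ j x_1 ^ k x_{1'} ^ k`, with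
respect to `k`, if `Q_2` is a power of `z`. -/
theorem triangular_qRadius_inner {z : Alg M s} {e : ℕ} (hz : z ^ e = qRadius M s 0) :
    (LinearIndependent ℂ (fun i : ℕ × ℕ => mono h z ((i.1, i.1), i.2)) →
      LinearIndependent ℂ fun i : ℕ × ℕ => qRadius (M + 2) s 0 ^ i.1 * incl h z ^ i.2) ∧
    Submodule.span ℂ (Set.range fun i : ℕ × ℕ => qRadius (M + 2) s 0 ^ i.1 * incl h z ^ i.2) =
      Submodule.span ℂ (Set.range fun i : ℕ × ℕ => mono h z ((i.1, i.1), i.2)) := by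
  have key := triangular_iterate (u := fun i : ℕ × ℕ => mono h z ((i.1, i.1), i.2))
    (ht := Prod.fst) (LinearMap.mulLeft ℂ (qRadius (M + 2) s 0)) (g := fun i => (i.1 + 1, i.2))
    (b := fun i => (0, i.2)) (c := fun _ => bet M s) (fun _ => rfl) (fun _ => bet_ne h)
    (fun i => by
      obtain ⟨k, j⟩ := i
      rw [LinearMap.mulLeft_apply, qRadius_mul_mono h hz, add_sub_cancel_left]
      exact Submodule.smul_mem _ _ (Submodule.subset_span ⟨(k, j + e), Nat.lt_succ_self k, rfl⟩))
    (fun _ => rfl)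
    (fun i => by
      obtain ⟨k, j⟩ := i
      dsimp only
      induction k with
      | zero => rfl
      | succ k ih => rw [Function.iterate_succ_apply', ih])
  simpa only [LinearMap.pow_mulLeft, LinearMap.mulLeft_apply, mono, assemble_single, pow_zero,
    mul_one, map_pow] using key

/-! ### The invariants of the whole quantum algebra -/

/-- If the twisted derivation `E` kills `Q` and lowers the degree in `z`, then the polynomials in
`Q` and `z` that it kills are the polynomials in `Q`. The reason is that
`E (z ^ j) = κ (1 + t + ⋯ + t ^ (j - 1)) x_1 z ^ (j - 1) w`, where the sum does not vanish for
`j ≥ 1`, while `x_1` and `w` can be cancelled and the `Q ^ k z ^ j` are linearly independent. -/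
theorem mem_adjoin_of_twisted_derivation {z : Alg M s} {e : ℕ} (hz : z ^ e = qRadius M s 0)
    (hzi : LinearIndependent ℂ (fun n : ℕ => z ^ n)) (E : Module.End ℂ (Alg (M + 2) s))
    (K : Alg (M + 2) s →ₐ[ℂ] Alg (M + 2) s) (hE : ∀ a b, E (a * b) = K a * E b + E a * b)
    (hEQ : E (qRadius (M + 2) s 0) = 0) (hKz : K (incl h z) = incl h z)
    {w : Alg (M + 2) s} {t κ : ℂ} (hEz : E (incl h z) = κ • (x (M + 2) s 0 * w)) (hκ : κ ≠ 0)
    (hzw : Commute (incl h z) w)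
    (hzx : incl h z * x (M + 2) s 0 = t • (x (M + 2) s 0 * incl h z))
    (ht : ∀ n : ℕ, 0 < n → t ^ n ≠ 1) (hw : ∀ a, a * w = 0 → a = 0) {a : Alg (M + 2) s}
    (ha : a ∈ Submodule.span ℂ (Set.range fun i : ℕ × ℕ => mono h z ((i.1, i.1), i.2)))
    (hEa : E a = 0) : a ∈ Algebra.adjoin ℂ {qRadius (M + 2) s 0} := by
  have hE1 : E 1 = 0 := by
    have := hE 1 1
    rwa [mul_one, mul_one, map_one K, one_mul, left_eq_add] at this
  have hEQ' : ∀ m, E (qRadius (M + 2) s 0 ^ m) = 0 := by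
    intro m
    induction m with
    | zero => rw [pow_zero, hE1]
    | succ m ih => rw [pow_succ, hE, hEQ, ih, mul_zero, zero_mul, add_zero]
  let g : ℕ → ℂ := fun j => κ * ∑ i ∈ Finset.range j, t ^ i
  have hg : ∀ j, g (j + 1) ≠ 0 := fun j => by
    refine mul_ne_zero hκ fun e => ht (j + 1) (by omega) ?_
    have := geom_sum_mul t (j + 1)
    rw [e, zero_mul] at this
    exact (sub_eq_zero.mp this.symm)
  have hEz' : ∀ j, E (incl h z ^ j) = g j • (x (M + 2) s 0 * incl h z ^ (j - 1) * w) := by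
    intro j
    induction j with
    | zero => simp [g, hE1]
    | succ j ih =>
      have e1 : incl h z ^ j * w = w * incl h z ^ j := hzw.pow_left j
      rw [pow_succ', hE, hKz, ih, hEz, Nat.add_sub_cancel]
      simp only [g]
      rw [geom_sum_succ]
      rcases j with _ | j
      · simp
      · rw [Nat.add_sub_cancel, mul_smul_comm, ← mul_assoc, ← mul_assoc, hzx, smul_mul_assoc,
          smul_mul_assoc, mul_assoc (x (M + 2) s 0) (incl h z), ← pow_succ', smul_mul_assoc,
          mul_assoc (x (M + 2) s 0) w, ← e1, ← mul_assoc]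
        module
  obtain ⟨hv, hspan⟩ := triangular_qRadius_inner h hz
  have hv' := hv ((linearIndependent_mono h hzi).comp (fun i : ℕ × ℕ => ((i.1, i.1), i.2))
    fun a b hab => by simpa [Prod.ext_iff] using hab)
  rw [← hspan] at ha
  obtain ⟨l, rfl⟩ := (Finsupp.mem_span_range_iff_exists_finsupp).mp ha
  rw [← Finsupp.linearCombination_apply] at hEa ⊢
  set v : ℕ × ℕ → Alg (M + 2) s := fun i => qRadius (M + 2) s 0 ^ i.1 * incl h z ^ i.2 with hvdef
  -- `E` acts on the coefficients with respect to `Q ^ k z ^ j` as the `t`-derivative `D`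
  let D : (ℕ × ℕ →₀ ℂ) →ₗ[ℂ] (ℕ × ℕ →₀ ℂ) :=
    Finsupp.lsum ℂ fun i => g i.2 • Finsupp.lsingle (i.1, i.2 - 1)
  have hDs : ∀ i c, D (Finsupp.single i c) = g i.2 • Finsupp.single (i.1, i.2 - 1) c := by
    intro i c
    simp [D]
  have hED : ∀ l, E (Finsupp.linearCombination ℂ v l) =
      x (M + 2) s 0 * Finsupp.linearCombination ℂ v (D l) * w := by
    intro l
    induction l using Finsupp.induction_linear with
    | zero => simp
    | add f g hf hg => simp only [map_add, hf, hg, mul_add, add_mul]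
    | single i c =>
      have hQ : ∀ b, Commute (qRadius (M + 2) s 0 ^ i.1) b := fun b => (qRadius_comm h b).pow_left _
      rw [hDs, Finsupp.linearCombination_single, map_smul, map_smul,
        Finsupp.linearCombination_single]
      simp only [hvdef]
      rw [hQ (incl h z ^ i.2), hE, hEQ', mul_zero, zero_add, hEz', hQ (incl h z ^ (i.2 - 1)),
        smul_mul_assoc, mul_assoc _ w, ← hQ w, ← mul_assoc]
      simp only [mul_smul_comm, smul_mul_assoc, mul_assoc]
      rw [smul_comm]
  have hDval : ∀ l k j, D l (k, j) = g (j + 1) * l (k, j + 1) := by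
    intro l k j
    induction l using Finsupp.induction_linear with
    | zero => simp
    | add f g hf hg => rw [map_add, Finsupp.add_apply, hf, hg, Finsupp.add_apply, mul_add]
    | single i c =>
      obtain ⟨k', j'⟩ := i
      rw [hDs, Finsupp.smul_apply, Finsupp.single_apply, Finsupp.single_apply]
      rcases j' with _ | j'
      · simp [g]
      · simp only [Nat.add_sub_cancel, Prod.mk.injEq, Nat.add_right_cancel_iff, smul_eq_mul]
        split_ifs with hc
        · rw [hc.2]
        · rw [mul_zero, mul_zero]
  have hD0 : D l = 0 := by
    refine linearIndependent_iff.mp hv' _ ?_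
    rw [hED] at hEa
    exact first_mul_injective h _ (hw _ hEa)
  rw [Finsupp.linearCombination_apply]
  refine Subalgebra.sum_mem _ fun i _ => ?_
  obtain ⟨k, j⟩ := i
  rcases j with _ | j
  · simp only [hvdef, pow_zero, mul_one]
    exact Subalgebra.smul_mem _ (Subalgebra.pow_mem _ (Algebra.self_mem_adjoin_singleton ℂ _) _) _
  · have := hDval l k j
    rw [hD0, Finsupp.zero_apply, eq_comm, mul_eq_zero] at this
    dsimp only
    rw [this.resolve_left (hg j), zero_smul]
    exact Subalgebra.zero_mem _

end Families

section Invariants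

variable {M : ℕ} {s : ℂ} (h : Generic s)

/-- Weight zero, and killed by the `E_i`. The torus enters through the weights `2 ε_i`, which,
unlike the `ε_i`, always lie in the root lattice. In the even case the last node is left out, since
its root is not of the form `ε_i - ε_{i+1}`; in weight zero the other nodes suffice to single out
`ℂ[Q]`. -/
structure WeaklyInvariant (a : Alg M s) : Prop where
  torus : ∀ i : Fin (M / 2), torus h (Pi.single i 2) a = a
  e : ∀ (hM : 3 ≤ M) (i : Fin (M / 2)), ¬IsForkNode M i → eOp h hM i a = 0

/-- The components of an element that is invariant with respect to the nodes other than the first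
one are invariant in dimension `M`. -/
theorem weaklyInvariant_component (f : ℕ × ℕ →₀ Alg M s)
    (h1 : ∀ i : Fin (M / 2), torus h (Pi.single (nodeSucc i) 2) (assemble h f) = assemble h f)
    (h2 : ∀ (hM : 3 ≤ M + 2) (i : Fin (M / 2)), ¬IsForkNode M i →
      eOp h hM (nodeSucc i) (assemble h f) = 0) (kl : ℕ × ℕ) : WeaklyInvariant h (f kl) where
  torus i := by
    have := component_eq_zero h ((torus h (Pi.single (nodeSucc i) 2)).toLinearMap - LinearMap.id) id
      Function.injective_id (fun _ => (torus h (Pi.single i 2)).toLinearMap - LinearMap.id)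
      (fun kl b => by
        rw [LinearMap.sub_apply, AlgHom.toLinearMap_apply, torus_assemble h _ (Pi.single i 2)
          (fun m => by rw [pairing_single, pairing_single, wt_sh_nodeSucc]), pairing_single,
          wt_first_nodeSucc, mul_zero, zero_mul, zpow_zero, one_smul]
        simp [Finsupp.single_sub])
      f (by simpa [sub_eq_zero] using h1 i) kl
    simpa [sub_eq_zero] using this
  e hM i hi := component_eq_zero h (eOp h (by omega) (nodeSucc i)) id Function.injective_id
    (fun _ => eOp h hM i) (fun kl b => eOp_assemble h hM (by omega) i kl b) f
    (h2 (by omega) i hi) kl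

theorem Generic.zpow_ne_one {s : ℂ} (h : Generic s) {n : ℤ} (hn : n ≠ 0) : (s ^ 2) ^ n ≠ 1 := by
  intro e
  rcases Int.natAbs_eq n with hc | hc
  · rw [hc, zpow_natCast] at e
    exact h.not_root _ (Int.natAbs_pos.mpr hn) e
  · rw [hc, zpow_neg, zpow_natCast, inv_eq_one] at e
    exact h.not_root _ (Int.natAbs_pos.mpr hn) e

/-- An element of weight zero with respect to `2 ε_1` has components in degrees `(k, k)` only. -/
theorem component_eq_zero_of_torus (f : ℕ × ℕ →₀ Alg M s)
    (h1 : torus h (Pi.single (nodeZero M) 2) (assemble h f) = assemble h f) {k l : ℕ}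
    (hkl : k ≠ l) : f (k, l) = 0 := by
  have := component_eq_zero h ((torus h (Pi.single (nodeZero M) 2)).toLinearMap - LinearMap.id) id
    Function.injective_id
    (fun kl => ((s ^ 2) ^ (2 * ((kl.1 : ℤ) - kl.2)) - 1) • LinearMap.id)
    (fun kl b => by
      rw [LinearMap.sub_apply, AlgHom.toLinearMap_apply, torus_assemble h _ 0
        (fun m => by rw [pairing_single, wt_sh_nodeZero]; simp [pairing]), pairing_single,
        wt_first_nodeZero, mul_one, show torus h 0 b = b from kOp_zero h b, LinearMap.smul_apply,
        ← Finsupp.smul_single, map_smul, sub_smul, one_smul]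
      rfl)
    f (by simpa [sub_eq_zero] using h1) (k, l)
  rw [LinearMap.smul_apply, smul_eq_zero] at this
  exact this.resolve_left (sub_ne_zero.mpr (h.zpow_ne_one (by omega)))

/-- A generator of the algebra of invariants: `Q`, or the only coordinate if there is only one. In
that case all of `𝒜` is invariant, and `Q` is the square of the coordinate. -/
noncomputable def invariantGen (s : ℂ) : (M : ℕ) → Alg M s
  | 0 => qRadius 0 s 0
  | 1 => x 1 s 0
  | M + 2 => qRadius (M + 2) s 0

theorem dim_zero_mem (a : Alg 0 s) :
    a ∈ Submodule.span ℂ (Set.range fun n : ℕ => (1 : Alg 0 s) ^ n) := by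
  rw [← adjoin_eq_span_pow, Subalgebra.mem_toSubmodule]
  induction a using Alg.induct with
  | hc c => exact Subalgebra.algebraMap_mem _ c
  | hx i => exact i.elim0
  | hmul a b ha hb => exact Subalgebra.mul_mem _ ha hb
  | hadd a b ha hb => exact Subalgebra.add_mem _ ha hb

theorem dim_one_mem (a : Alg 1 s) : a ∈ Algebra.adjoin ℂ {x 1 s 0} := by
  induction a using Alg.induct with
  | hc c => exact Subalgebra.algebraMap_mem _ c
  | hx i => rw [Subsingleton.elim i 0]; exact Algebra.self_mem_adjoin_singleton ℂ _
  | hmul a b ha hb => exact Subalgebra.mul_mem _ ha hb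
  | hadd a b ha hb => exact Subalgebra.add_mem _ ha hb

include h in
/-- In dimension `2`, `Q` is a multiple of `x_1 x_{1'}`. -/
theorem dim_two_mem (k : ℕ) : x 2 s 0 ^ k * x 2 s (Fin.rev 0) ^ k ∈
    Algebra.adjoin ℂ {qRadius 2 s 0} := by
  have e : x 2 s 0 * x 2 s (Fin.rev 0) = (bet 0 s)⁻¹ • qRadius 2 s 0 := by
    have h0 : qRadius 0 s 0 = 0 := by rw [qRadius_zero]; rfl
    rw [qRadius_eq h, inv_smul_smul₀ (bet_ne h), radial, h0, map_zero, smul_zero, add_zero]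
  induction k with
  | zero => simp
  | succ k ih =>
    have e2 : x 2 s 0 ^ (k + 1) * x 2 s (Fin.rev 0) ^ (k + 1) =
        (bet 0 s)⁻¹ • (qRadius 2 s 0 * (x 2 s 0 ^ k * x 2 s (Fin.rev 0) ^ k)) := by
      rw [pow_succ, pow_succ' (x 2 s (Fin.rev 0)), mul_assoc, ← mul_assoc (x 2 s 0), e,
        smul_mul_assoc, mul_smul_comm, ← mul_assoc, ← mul_assoc, (qRadius_comm h _).eq]
    rw [e2]
    exact Subalgebra.smul_mem _
      (Subalgebra.mul_mem _ (Algebra.self_mem_adjoin_singleton ℂ _) ih) _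

include h in
theorem linearIndependent_pow_qRadius :
    LinearIndependent ℂ (fun n : ℕ => qRadius (M + 2) s 0 ^ n) :=
  linearIndependent_pow_of_aeval_injective (aeval_qRadius_injective h)

theorem not_isForkNode_nodeZero (hM : 1 ≤ M) : ¬IsForkNode (M + 2) (nodeZero M) := by
  rintro ⟨h1, h2⟩
  simp only [nodeZero] at h2
  omega

/-- An invariant in dimension `M + 3` that is a polynomial in the invariant of dimension `M + 1` and
in `x_1 x_{1'}` is a polynomial in `Q`, since `E_1` kills it. -/
theorem mem_adjoin_qRadius (f : ℕ × ℕ →₀ Alg (M + 1) s)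
    (hf : ∀ kl, f kl ∈ Algebra.adjoin ℂ {invariantGen s (M + 1)})
    (hf' : ∀ k l, k ≠ l → f (k, l) = 0)
    (hE : eOp h (by omega) (nodeZero (M + 1)) (assemble h f) = 0) :
    assemble h f ∈ Algebra.adjoin ℂ {qRadius (M + 3) s 0} := by
  have h0 : s ^ 2 ≠ 0 := pow_ne_zero 2 h.ne_zero
  have hq : ∀ n : ℕ, 0 < n → (s ^ 2)⁻¹ ^ n ≠ 1 := fun n hn e =>
    h.not_root n hn (by rwa [inv_pow, inv_eq_one] at e)
  have hspan : assemble h f ∈ Submodule.span ℂ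
      (Set.range fun i : ℕ × ℕ => mono h (invariantGen s (M + 1)) ((i.1, i.1), i.2)) := by
    refine Submodule.span_mono ?_ (assemble_mem_span_mono h fun kl => by
      rw [← adjoin_eq_span_pow]; exact hf kl)
    rintro _ ⟨⟨⟨k, l⟩, j⟩, hne, rfl⟩
    by_cases hkl : k = l
    · exact ⟨(k, j), by rw [hkl]⟩
    · exact absurd (hf' k l hkl) hne
  -- with one inner coordinate `z` is that coordinate, which `E_1` maps to a multiple of `x_1`;
  -- otherwise `z` is `Q_2`, which `E_1` maps to a multiple of `x_1 x_{2'}`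
  rcases M with _ | M
  · have hz : x 1 s 0 ^ 2 = qRadius 1 s 0 := by
      rw [qRadius_zero, Fin.sum_univ_one, show Fin.rev (0 : Fin 1) = 0 from rfl,
        qRho_mid 0 rfl, one_smul, sq]
    refine mem_adjoin_of_twisted_derivation h hz
      (linearIndependent_pow_of_aeval_injective (aeval_x_injective h)) (eOp h _ _)
      (torus h (root _ _)) (eOp_mul h _ _) (eOp_nodeZero_qRadius h _) ?_ (w := 1)
      (t := (s ^ 2)⁻¹) (κ := coef 3 s (nodeZero 1)) ?_ (coef_ne h _) (Commute.one_right _) ?_ hq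
      (fun a ha => by rwa [mul_one] at ha) hspan hE
    · have := pairing_wt_rev (root 3 (nodeZero 1)) (sh 0)
      rw [show (sh (0 : Fin 1)).rev = sh 0 from rfl] at this
      rw [incl_x, torus_x, show pairing (root 3 (nodeZero 1)) (wt 3 (sh 0)) = 0 by omega, zpow_zero,
        one_smul]
    · rw [incl_x, eOp_x, eX, if_pos src_nodeZero.symm, tgt_nodeZero le_rfl, mul_one]
    · rw [incl_first, scale_x, map_smul, mul_smul_comm]
  · refine mem_adjoin_of_twisted_derivation h (pow_one _)
      (linearIndependent_pow_qRadius h) (eOp h _ _)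
      (torus h (root _ _)) (eOp_mul h _ _) (eOp_nodeZero_qRadius h _) (torus_incl_qRadius h _)
      (t := (s ^ 2)⁻¹ ^ 2) (eOp_nodeZero_incl h _) (den_ne h) ((qRadius_comm h _).map _) ?_ ?_
      (mul_incl_injective h _ (scale_x h _ _) (mul_last_injective h)) hspan hE
    · rw [incl_first, scale_qRadius, map_smul, mul_smul_comm]
    · intro n hn
      rw [← pow_mul]
      exact hq _ (by omega)

/-- The first fundamental theorem for one vector: the invariants are the polynomials in `Q`. The
induction removes the first and the last coordinate. -/
theorem mem_adjoin_of_weaklyInvariant (M : ℕ) :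
    ∀ a : Alg M s, WeaklyInvariant h a → a ∈ Algebra.adjoin ℂ {invariantGen s M} := by
  induction M using Nat.twoStepInduction with
  | zero =>
    intro a _
    have := dim_zero_mem a
    rw [← adjoin_eq_span_pow] at this
    exact Algebra.adjoin_le (by simp) this
  | one => exact fun a _ => dim_one_mem a
  | more M ih _ =>
    intro a ha
    obtain ⟨f, rfl⟩ := assemble_surjective h a
    have hf := fun kl => ih _ (weaklyInvariant_component h f (fun i => ha.torus (nodeSucc i))
      (fun hM i hi => ha.e hM _ (mt (isForkNode_nodeSucc i).mp hi)) kl)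
    have hf' := fun k l (hkl : k ≠ l) =>
      component_eq_zero_of_torus h f (ha.torus (nodeZero M)) hkl
    rcases M with _ | M
    · change assemble h f ∈ Subalgebra.toSubmodule (Algebra.adjoin ℂ {qRadius 2 s 0})
      have h2 := assemble_mem_span_mono h (z := 1) (fun kl => dim_zero_mem (f kl))
      refine Submodule.span_le.mpr ?_ h2
      rintro _ ⟨⟨⟨k, l⟩, j⟩, hne, rfl⟩
      have hkl : k = l := by
        by_contra hkl
        exact hne (hf' k l hkl)
      subst hkl
      rw [mono, assemble_single, one_pow, map_one, one_mul]
      exact dim_two_mem h k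
    · exact mem_adjoin_qRadius h f hf hf' (ha.e _ _ (not_isForkNode_nodeZero (by omega)))

end Invariants

/-! ### The invariants of the subalgebra `U_q(so_{N-2})` -/

section SubInvariants

variable {N : ℕ} {s : ℂ} (h : Generic s)

theorem action_projU (hN : 3 ≤ N) (u : FreeU N) :
    action h hN (projU N s u) = FreeAlgebra.lift ℂ (actGen h hN) u :=
  RingQuot.liftAlgHom_mkAlgHom_apply ℂ _ _ _

theorem counit_projU (u : FreeU N) :
    counit (projU N s u) = FreeAlgebra.lift ℂ counitGen u :=
  RingQuot.liftAlgHom_mkAlgHom_apply ℂ _ _ _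

theorem lift_actGen_gen (hN : 3 ≤ N) (g : Gen N) :
    FreeAlgebra.lift ℂ (actGen h hN) (gen g) = actGen h hN g :=
  FreeAlgebra.lift_ι_apply _ _

theorem lift_counitGen_gen (g : Gen N) : FreeAlgebra.lift ℂ counitGen (gen g) = counitGen g :=
  FreeAlgebra.lift_ι_apply _ _

theorem lift_counitGen_kRoot (i : Fin (N / 2)) :
    FreeAlgebra.lift ℂ counitGen (kRoot i) = 1 ∧
      FreeAlgebra.lift ℂ counitGen (kRootInv i) = 1 := by
  rw [kRoot, kRootInv]
  split_ifs <;> simp [lift_counitGen_gen, counitGen]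

theorem root_of_lt {i : Fin (N / 2)} (hi : (i : ℕ) + 1 < N / 2) :
    root N i = Pi.single i 1 - Pi.single ⟨i + 1, hi⟩ 1 := by
  ext j
  have hf : ¬IsForkNode N i := fun hf => by
    have := hf.2
    omega
  simp only [root, hf, if_false, Pi.sub_apply, Pi.single_apply, Fin.ext_iff]

theorem root_last {i : Fin (N / 2)} (hf : ¬IsForkNode N i) (hi : (i : ℕ) + 1 = N / 2) :
    root N i = Pi.single i 1 := by
  ext j
  have := j.2
  simp only [root, hf, if_false, Pi.single_apply]
  rw [if_neg (show ¬(j : ℕ) = i + 1 by omega), sub_zero]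

theorem root_fork {i : Fin (N / 2)} (hN : 3 ≤ N) (hf : IsForkNode N i) :
    root N i = Pi.single ⟨i - 1, by have := i.2; omega⟩ 1 + Pi.single i 1 := by
  ext j
  obtain ⟨h1, h2⟩ := id hf
  simp only [root, hf, if_true, Pi.add_apply, Pi.single_apply, Fin.ext_iff]
  congr 1
  exact if_congr (by omega) rfl rfl

theorem lift_actGen_kRoot (hN : 3 ≤ N) (i : Fin (N / 2)) :
    FreeAlgebra.lift ℂ (actGen h hN) (kRoot i) = kOp h (root N i) ∧
      FreeAlgebra.lift ℂ (actGen h hN) (kRootInv i) = kOp h (-root N i) := by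
  have hmm : ∀ v w : Fin (N / 2) → ℤ, kOp h v * kOp h w = kOp h (v + w) := fun v w =>
    LinearMap.ext fun a => kOp_add h v w a
  rcases node_cases hN i with hc | hc | hc
  · rw [kRoot, kRootInv, if_neg hc.1, if_neg hc.1, dif_pos hc.2.2, dif_pos hc.2.2,
      root_of_lt hc.2.2]
    simp only [map_mul, lift_actGen_gen, actGen, hmm]
    constructor <;> congr 1
    abel
  · have hn : ¬(i : ℕ) + 1 < N / 2 := by omega
    rw [kRoot, kRootInv, if_neg hc.1, if_neg hc.1, dif_neg hn, dif_neg hn,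
      root_last hc.1 hc.2.2.1]
    simp only [lift_actGen_gen, actGen, and_self]
  · rw [kRoot, kRootInv, if_pos hc.1, if_pos hc.1, root_fork hN hc.1]
    simp only [map_mul, lift_actGen_gen, actGen, hmm, true_and]
    congr 1
    abel

/-- The weights of the torus elements that fix `a`. -/
def fixingWeights (a : Alg N s) : AddSubgroup (Fin (N / 2) → ℤ) where
  carrier := {v | kOp h v a = a}
  zero_mem' := kOp_zero h a
  add_mem' {v w} hv hw := by
    change kOp h (v + w) a = a
    rw [← kOp_add, hw, hv]
  neg_mem' {v} hv := by
    change kOp h (-v) a = a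
    conv_lhs => rw [← hv, kOp_add, neg_add_cancel, kOp_zero]

/-- The roots other than the first one generate the weights `2 ε_i` with `i ≠ 1`. -/
theorem two_mem_of_root_mem (hN : 5 ≤ N) (S : AddSubgroup (Fin (N / 2) → ℤ))
    (hS : ∀ i : Fin (N / 2), 1 ≤ (i : ℕ) → root N i ∈ S) (i : Fin (N / 2)) (hi : 1 ≤ (i : ℕ)) :
    Pi.single i 2 ∈ S := by
  have h2 : ∀ j : Fin (N / 2), (Pi.single j 2 : Fin (N / 2) → ℤ) =
      Pi.single j 1 + Pi.single j 1 := fun j => by rw [← Pi.single_add]; rfl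
  obtain ⟨d, hd⟩ : ∃ d, (i : ℕ) + 1 + d = N / 2 := ⟨N / 2 - (i + 1), by omega⟩
  induction d generalizing i with
  | zero =>
    by_cases hf : IsForkNode N i
    -- `2 ε_n = (ε_{n-1} + ε_n) - (ε_{n-1} - ε_n)`
    · have hlt : ((⟨i - 1, by omega⟩ : Fin (N / 2)) : ℕ) + 1 < N / 2 := by
        simp only
        omega
      obtain ⟨h3, h4⟩ := id hf
      have e1 := root_fork (by omega) hf
      have e2 := root_of_lt hlt
      have e3 : (⟨((⟨i - 1, by omega⟩ : Fin (N / 2)) : ℕ) + 1, hlt⟩ : Fin (N / 2)) = i :=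
        Fin.ext (by simp only; omega)
      rw [e3] at e2
      have := S.sub_mem (hS i hi) (hS ⟨i - 1, by omega⟩ (by simp only; omega))
      rw [e1, e2] at this
      rw [h2]
      convert this using 1
      abel
    · have := hS i hi
      rw [root_last hf hd] at this
      rw [h2]
      exact S.add_mem this this
  | succ d ih =>
    have hlt : (i : ℕ) + 1 < N / 2 := by omega
    have h3 := ih ⟨i + 1, hlt⟩ (by simp) (by simp only; omega)
    -- `2 ε_i = 2 (ε_i - ε_{i+1}) + 2 ε_{i+1}`
    have h4 := hS i hi
    have := S.add_mem (S.add_mem h4 h4) h3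
    rw [root_of_lt hlt, h2] at this
    rw [h2]
    convert this using 1
    abel

theorem counit_act_of_adjoin (hN : 3 ≤ N) {T : Set (U N s)} {a : Alg N s}
    (hT : ∀ X ∈ T, action h hN X a = counit X • a) :
    ∀ X ∈ Algebra.adjoin ℂ T, action h hN X a = counit X • a := by
  intro X hX
  induction hX using Algebra.adjoin_induction with
  | mem X hX => exact hT X hX
  | algebraMap c =>
    rw [AlgHom.commutes, AlgHom.commutes]
    rfl
  | add X Y _ _ hX hY => rw [map_add, LinearMap.add_apply, hX, hY, map_add, add_smul]
  | mul X Y _ _ hX hY =>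
    rw [map_mul, Module.End.mul_apply, hY, map_smul, hX, map_mul, smul_smul, mul_comm]

/-- A linear operator whose kernel is closed under products and contains `1`, `x_1` and `x_{1'}`
kills the elements `Q_2 ^ j x_1 ^ k x_{1'} ^ l`. -/
theorem map_mono_eq_zero {M : ℕ} (D : Module.End ℂ (Alg (M + 2) s))
    (hmul : ∀ a b, D a = 0 → D b = 0 → D (a * b) = 0) (h1 : D 1 = 0)
    (hfirst : D (x (M + 2) s 0) = 0) (hlast : D (x (M + 2) s (Fin.rev 0)) = 0)
    (i : (ℕ × ℕ) × ℕ) : D (mono h (qRadius M s 0) i) = 0 := by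
  have hpow : ∀ a, D a = 0 → ∀ k : ℕ, D (a ^ k) = 0 := by
    intro a ha k
    induction k with
    | zero => rwa [pow_zero]
    | succ k ih => rw [pow_succ]; exact hmul _ _ ih ha
  have hQ : D (incl h (qRadius M s 0)) = 0 := by
    have := congrArg D (last_first (M := M) h)
    rw [map_add, hmul _ _ hlast hfirst, hmul _ _ hfirst hlast, zero_add, map_smul, eq_comm,
      smul_eq_zero] at this
    exact this.resolve_left (lam_zero_ne h)
  rw [mono, assemble_single, map_pow]
  exact hmul _ _ (hpow _ hQ _) (hmul _ _ (hpow _ hfirst _) (hpow _ hlast _))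

theorem kOp_mono {M : ℕ} (v : Fin ((M + 2) / 2) → ℤ) (hv : pairing v (wt (M + 2) 0) = 0)
    (i : (ℕ × ℕ) × ℕ) :
    kOp h v (mono h (qRadius M s 0) i) = mono h (qRadius M s 0) i := by
  have := map_mono_eq_zero h (kOp h v - LinearMap.id) ?_ ?_ ?_ ?_ i
  · exact sub_eq_zero.mp this
  · intro a b ha hb
    rw [LinearMap.sub_apply, LinearMap.id_apply, sub_eq_zero] at ha hb ⊢
    rw [kOp_mul, ha, hb]
  · exact sub_eq_zero.mpr (map_one (torus h v))
  · refine sub_eq_zero.mpr ((torus_first h v).trans ?_)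
    rw [hv, zpow_zero, one_smul]
    rfl
  · refine sub_eq_zero.mpr ((torus_last h v).trans ?_)
    rw [hv, neg_zero, zpow_zero, one_smul]
    rfl

theorem eOp_mono {M : ℕ} (hM : 3 ≤ M) (hN : 3 ≤ M + 2) (i : Fin (M / 2)) (k : (ℕ × ℕ) × ℕ) :
    eOp h hN (nodeSucc i) (mono h (qRadius M s 0) k) = 0 :=
  map_mono_eq_zero h _ (fun a b ha hb => by rw [eOp_mul, ha, hb, mul_zero, zero_mul, add_zero])
    (by simpa using eOp_algebraMap h hN (nodeSucc i) 1) (eOp_first h hN _) (eOp_last h hM hN i) k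

theorem fOp_mono {M : ℕ} (hM : 3 ≤ M) (hN : 3 ≤ M + 2) (i : Fin (M / 2)) (k : (ℕ × ℕ) × ℕ) :
    fOp h hN (nodeSucc i) (mono h (qRadius M s 0) k) = 0 := by
  refine map_mono_eq_zero h _
    (fun a b ha hb => by rw [fOp_mul, ha, hb, mul_zero, zero_mul, add_zero])
    (by simpa using fOp_algebraMap h hN (nodeSucc i) 1) ?_ ?_ k
  · rw [fOp_x, fX, src_nodeSucc, tgt_nodeSucc hM, rev_sh, if_neg (sh_ne_zero _).symm,
      if_neg (sh_ne_zero _).symm]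
  · rw [fOp_x, fX, src_nodeSucc, tgt_nodeSucc hM, rev_sh, if_neg (sh_ne_rev_zero _).symm,
      if_neg (sh_ne_rev_zero _).symm]

/-- The powers of `Q_2`, `x_1` and `x_{1'}` are invariant; for `Q_2` this follows from its being
proportional to the commutator of the other two. -/
theorem mono_mem_invariants {M : ℕ} (hM : 2 ≤ M) (hN : 3 ≤ M + 2) (k : (ℕ × ℕ) × ℕ) :
    mono h (qRadius M s 0) k ∈ invariants (N := M + 2) h hN := by
  change ∀ X ∈ subU (M + 2) s, _
  rw [subU]
  split_ifs with h4
  · apply counit_act_of_adjoin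
    rintro X ⟨i, hi, hX⟩
    obtain rfl | ⟨j, rfl⟩ := node_cases_succ i
    · simp [nodeZero] at hi
    rcases hX with rfl | rfl <;>
      rw [action_projU, counit_projU, lift_actGen_gen, lift_counitGen_gen, actGen, kOp_mono,
        counitGen, one_smul]
    · rw [pairing_single, wt_first_nodeSucc, mul_zero]
    · rw [pairing_neg, pairing_single, wt_first_nodeSucc, mul_zero, neg_zero]
  · apply counit_act_of_adjoin
    have hM' : 3 ≤ M := by omega
    rintro X ⟨i, hi, hX⟩
    obtain rfl | ⟨j, rfl⟩ := node_cases_succ i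
    · simp [nodeZero] at hi
    have hp := pairing_root_first hM' j
    rcases hX with rfl | rfl | rfl | rfl
    · rw [action_projU, counit_projU, (lift_actGen_kRoot h hN _).1, (lift_counitGen_kRoot _).1,
        kOp_mono h _ hp, one_smul]
    · rw [action_projU, counit_projU, (lift_actGen_kRoot h hN _).2, (lift_counitGen_kRoot _).2,
        kOp_mono h _ (by rw [pairing_neg, hp, neg_zero]), one_smul]
    · rw [action_projU, counit_projU, lift_actGen_gen, lift_counitGen_gen, actGen, eOp_mono h hM',
        counitGen, zero_smul]
    · rw [action_projU, counit_projU, lift_actGen_gen, lift_counitGen_gen, actGen, fOp_mono h hM',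
        counitGen, zero_smul]

theorem torus_of_mem_invariants {M : ℕ} (hM : 2 ≤ M) (hN : 3 ≤ M + 2) {a : Alg (M + 2) s}
    (ha : a ∈ invariants (N := M + 2) h hN) (i : Fin (M / 2)) :
    torus h (Pi.single (nodeSucc i) 2) a = a := by
  change ∀ X ∈ subU (M + 2) s, _ at ha
  rw [subU] at ha
  suffices hS : Pi.single (nodeSucc i) 2 ∈ fixingWeights h a from hS
  split_ifs at ha with h4
  · have := ha _ (Algebra.subset_adjoin ⟨nodeSucc i, by have := i.2; simp only [nodeSucc]; omega,
      Or.inl rfl⟩)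
    rw [action_projU, counit_projU, lift_actGen_gen, lift_counitGen_gen, actGen, counitGen,
      one_smul] at this
    have h1 : Pi.single (nodeSucc i) 1 ∈ fixingWeights h a := this
    have h2 := (fixingWeights h a).add_mem h1 h1
    rwa [← Pi.single_add] at h2
  · refine two_mem_of_root_mem (by omega) _ (fun j hj => ?_) _ (by simp [nodeSucc])
    have := ha _ (Algebra.subset_adjoin ⟨j, hj, Or.inl rfl⟩)
    rwa [action_projU, counit_projU, (lift_actGen_kRoot h hN _).1, (lift_counitGen_kRoot _).1,
      one_smul] at this

theorem eOp_of_mem_invariants {M : ℕ} (hM : 3 ≤ M) (hN : 3 ≤ M + 2) {a : Alg (M + 2) s}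
    (ha : a ∈ invariants (N := M + 2) h hN) (i : Fin (M / 2)) :
    eOp h hN (nodeSucc i) a = 0 := by
  change ∀ X ∈ subU (M + 2) s, _ at ha
  rw [subU, if_neg (by omega)] at ha
  have := ha _ (Algebra.subset_adjoin ⟨nodeSucc i, by simp [nodeSucc],
    Or.inr (Or.inr (Or.inl rfl))⟩)
  rwa [action_projU, counit_projU, lift_actGen_gen, lift_counitGen_gen, actGen, counitGen,
    zero_smul] at this

/-- The invariants have invariant components, which are polynomials in `Q_2`. -/
theorem invariants_eq_span {M : ℕ} (hM : 2 ≤ M) (hN : 3 ≤ M + 2) :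
    invariants (N := M + 2) h hN = Submodule.span ℂ (Set.range (mono h (qRadius M s 0))) := by
  apply le_antisymm
  · intro a ha
    obtain ⟨f, rfl⟩ := assemble_surjective h a
    refine Submodule.span_mono (Set.image_subset_range _ _) (assemble_mem_span_mono h fun kl => ?_)
    rw [← adjoin_eq_span_pow]
    have hw := weaklyInvariant_component h f (torus_of_mem_invariants h hM hN ha)
      (fun _ i hi => by
        -- for `M = 2`, the only node is the last one of the even case
        have hM' : 3 ≤ M := by
          by_contra hlt
          have := i.2
          exact hi ⟨by omega, by omega⟩
        exact eOp_of_mem_invariants h hM' hN ha i) kl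
    have := mem_adjoin_of_weaklyInvariant h M _ hw
    obtain ⟨M, rfl⟩ := Nat.exists_eq_add_of_le' hM
    exact this
  · rw [Submodule.span_le]
    rintro _ ⟨k, rfl⟩
    exact mono_mem_invariants h hM hN k

end SubInvariants

/-! ### Directness of the sums -/

section Direct

variable {M : ℕ} {s : ℂ}

theorem polyMap_eq_sum (hN : 3 ≤ M + 2) (z : Alg (M + 2) s) (kl : ℕ × ℕ) (p : Polynomial ℂ) :
    polyMap hN z kl p = p.sum fun m c =>
      c • (z ^ m * (x (M + 2) s 0 ^ kl.1 * x (M + 2) s (Fin.rev 0) ^ kl.2)) := by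
  change Polynomial.aeval z p * (x (M + 2) s 0 ^ kl.1 * x (M + 2) s (Fin.rev 0) ^ kl.2) = _
  rw [Polynomial.aeval_def, Polynomial.eval₂_eq_sum, Polynomial.sum, Polynomial.sum,
    Finset.sum_mul]
  exact Finset.sum_congr rfl fun m _ => by rw [← Algebra.smul_def, smul_mul_assoc]

theorem polySpace_eq_span (hN : 3 ≤ M + 2) (z : Alg (M + 2) s) (kl : ℕ × ℕ) :
    polySpace hN z kl = Submodule.span ℂ (Set.range fun m : ℕ =>
      z ^ m * (x (M + 2) s 0 ^ kl.1 * x (M + 2) s (Fin.rev 0) ^ kl.2)) := by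
  apply le_antisymm
  · rintro _ ⟨p, rfl⟩
    rw [polyMap_eq_sum]
    exact Submodule.sum_mem _ fun m _ => Submodule.smul_mem _ _ (Submodule.subset_span ⟨m, rfl⟩)
  · rw [Submodule.span_le]
    rintro _ ⟨m, rfl⟩
    refine ⟨Polynomial.X ^ m, ?_⟩
    change Polynomial.aeval z (Polynomial.X ^ m) * _ = _
    rw [map_pow, Polynomial.aeval_X]
    rfl

theorem iSup_polySpace (hN : 3 ≤ M + 2) (z : Alg (M + 2) s) :
    ⨆ kl, polySpace hN z kl = Submodule.span ℂ (Set.range fun i : (ℕ × ℕ) × ℕ =>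
      z ^ i.2 * (x (M + 2) s 0 ^ i.1.1 * x (M + 2) s (Fin.rev 0) ^ i.1.2)) := by
  simp only [polySpace_eq_span]
  rw [← Submodule.span_iUnion]
  congr 1
  ext a
  simp

theorem iSupIndep_polySpace (hN : 3 ≤ M + 2) {z : Alg (M + 2) s}
    (hz : LinearIndependent ℂ fun i : (ℕ × ℕ) × ℕ =>
      z ^ i.2 * (x (M + 2) s 0 ^ i.1.1 * x (M + 2) s (Fin.rev 0) ^ i.1.2)) :
    iSupIndep (polySpace hN z) := by
  intro kl
  set v := fun i : (ℕ × ℕ) × ℕ =>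
    z ^ i.2 * (x (M + 2) s 0 ^ i.1.1 * x (M + 2) s (Fin.rev 0) ^ i.1.2) with hv
  have hd := hz.disjoint_span_image (s := {i | i.1 = kl}) (t := {i | i.1 ≠ kl})
    (Set.disjoint_left.mpr fun i hi hi' => hi' hi)
  refine hd.mono ?_ (iSup₂_le fun kl' hne => ?_)
  · rw [polySpace_eq_span]
    refine Submodule.span_mono ?_
    rintro _ ⟨m, rfl⟩
    exact ⟨(kl, m), rfl, rfl⟩
  · rw [polySpace_eq_span]
    refine Submodule.span_mono ?_
    rintro _ ⟨m, rfl⟩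
    exact ⟨(kl', m), hne, rfl⟩

theorem polyMap_injective (hN : 3 ≤ M + 2) {z : Alg (M + 2) s}
    (hz : LinearIndependent ℂ fun i : (ℕ × ℕ) × ℕ =>
      z ^ i.2 * (x (M + 2) s 0 ^ i.1.1 * x (M + 2) s (Fin.rev 0) ^ i.1.2)) (kl : ℕ × ℕ) :
    Function.Injective (polyMap hN z kl) := by
  rw [injective_iff_map_eq_zero]
  intro p hp
  rw [polyMap_eq_sum, Polynomial.sum] at hp
  have hl := hz.comp (fun m : ℕ => (kl, m)) fun a b hab => (Prod.ext_iff.mp hab).2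
  have := linearIndependent_iff'.mp hl p.support p.coeff hp
  ext m
  by_cases hm : m ∈ p.support
  · rw [this m hm, Polynomial.coeff_zero]
  · rw [Polynomial.notMem_support_iff.mp hm, Polynomial.coeff_zero]

end Direct

end QEuclid

theorem proposition3 (N : ℕ) (hN : 4 ≤ N) (s : ℂ) (hs : s ≠ 0)
    (hq : ∀ m : ℕ, 0 < m → (s ^ 2) ^ m ≠ 1) :
    -- here `q = s ^ 2`
    -- the sum of the spaces `ℂ[Q_2] x_1 ^ k x_{1'} ^ l` is direct, and equals the invariants
    (iSupIndep (QEuclid.polySpace (by omega) (QEuclid.qRadius N s 1)) ∧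
      (∀ kl : ℕ × ℕ,
        Function.Injective (QEuclid.polyMap (by omega) (QEuclid.qRadius N s 1) kl)) ∧
      QEuclid.invariants (QEuclid.Generic.mk hs hq) (by omega) =
        ⨆ kl : ℕ × ℕ, QEuclid.polySpace (by omega) (QEuclid.qRadius N s 1) kl) ∧
    -- the same for the spaces `ℂ[Q] x_1 ^ k x_{1'} ^ l`
    (iSupIndep (QEuclid.polySpace (by omega) (QEuclid.qRadius N s 0)) ∧
      (∀ kl : ℕ × ℕ,
        Function.Injective (QEuclid.polyMap (by omega) (QEuclid.qRadius N s 0) kl)) ∧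
      QEuclid.invariants (QEuclid.Generic.mk hs hq) (by omega) =
        ⨆ kl : ℕ × ℕ, QEuclid.polySpace (by omega) (QEuclid.qRadius N s 0) kl) := by
  obtain ⟨M, rfl⟩ : ∃ M, N = M + 2 := ⟨N - 2, by omega⟩
  have hM : 2 ≤ M := by omega
  have h : QEuclid.Generic s := ⟨hs, hq⟩
  have hpow : LinearIndependent ℂ (fun n : ℕ => QEuclid.qRadius M s 0 ^ n) := by
    obtain ⟨K, rfl⟩ := Nat.exists_eq_add_of_le' hM
    exact QEuclid.linearIndependent_pow_qRadius h
  have hmono := QEuclid.linearIndependent_mono h hpow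
  have emono : QEuclid.mono h (QEuclid.qRadius M s 0) = fun i : (ℕ × ℕ) × ℕ =>
      QEuclid.qRadius (M + 2) s 1 ^ i.2 * (QEuclid.x (M + 2) s 0 ^ i.1.1 *
        QEuclid.x (M + 2) s (Fin.rev 0) ^ i.1.2) := by
    funext i
    rw [QEuclid.mono, QEuclid.assemble_single, map_pow, QEuclid.incl_qRadius]
  obtain ⟨htri, hspan⟩ := QEuclid.triangular_qRadius (M := M) h
  have hind := htri hmono
  have hinv := QEuclid.invariants_eq_span h hM (by omega)
  have hmono' := hmono
  rw [emono] at hmono'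
  refine ⟨⟨QEuclid.iSupIndep_polySpace _ hmono', QEuclid.polyMap_injective _ hmono', ?_⟩,
    QEuclid.iSupIndep_polySpace _ hind, QEuclid.polyMap_injective _ hind, ?_⟩
  · rw [QEuclid.iSup_polySpace, hinv, emono]
  · rw [QEuclid.iSup_polySpace, hinv, hspan]
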